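/- **Conventions.** An $L_\infty$-algebra is a graded real vector space $V=\bigoplus_{k\ge 1}V_k$, concentrated in positive degrees, with graded symmetric multilinear maps $l_n:V^{\times n}\to V$ of degree $-1$ ($n\ge 1$) such that for all $n\ge 1$ and homogeneous $v_1,\dots,v_n$ $$\sum_{i=1}^{n}\ \sum_{\sigma\in \mathrm{Sh}(i,n-i)}\varepsilon(\sigma)\, l_{n-i+1}\big(l_i(v_{\sigma(1)},\dots,v_{\sigma(i)}),v_{\sigma(i+1)},\dots,v_{\sigma(n)}\big)=0 ,$$ where $\varepsilon(\sigma)$ is the Koszul sign and $\mathrm{Sh}(i,n-i)$ is the set of permutations that are increasing on $\{1,\dots,i\}$ and on $\{i+1,\dots,n\}$. A graded subspace is an $L_\infty$-subalgebra if it is closed under all $l_n$. Let $M$ be a smooth manifold (finite-dimensional, Hausdorff, second countable, without boundary), let $m\ge 0$ and let $\omega\in\Omega^{m+1}(M)$ be closed, i.e. $(M,\omega)$ is pre-$m$-symplectic. Let $\mathfrak X^k(M)=\Gamma(\Lambda^kTM)=\Lambda^k_{C^\infty(M)}\mathfrak X(M)$. Contraction is $\iota_{X_1\cdots X_k}=\iota_{X_1}\circ\dots\circ\iota_{X_k}$,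 where $\iota_X\alpha=\alpha(X,\dots)$. Let $\nu$ be the graded symmetric form of the Schouten bracket (of degree $-1$), i.e. the local operation with $$\nu(X_1\cdots X_p,\,Y_1\cdots Y_q)=(-1)^{p-1}\sum_{i,j}(-1)^{i+j}[X_i,Y_j]\,X_1\cdots\widehat{X_i}\cdots X_p\,Y_1\cdots\widehat{Y_j}\cdots Y_q$$ for vector fields $X_i,Y_j$ and $p,q\ge 1$. The Hamiltonian pairs of degree $k$ are $$\widetilde{\mathfrak X}^k(M)=\{(x,\alpha)\in\mathfrak X^k(M)\times\Omega^{m-k}(M)\;:\;\iota_x\omega=d\alpha\}.$$ Put $\widetilde\Xi_1^{\,j}(M)=\widetilde{\mathfrak X}^{\,j+1}(M)$ for $0\le j\le m-1$, $\widetilde\Xi_i^{\,j}(M)=\Omega^{m-i-j}(M)$ for $i\ge 2$ and $0\le j\le m-i$, and $\widetilde\Xi_i^{\,j}(M)=0$ otherwise. Let $\widetilde\Xi(M)$ be the graded vector space with $\widetilde\Xi_k(M)=\bigoplus_{i+j=k}\widetilde\Xi_i^{\,j}(M)$. Define brackets on $\widetilde\Xi(M)$ as follows; all values not listed are zero. *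 $\tilde l_1\alpha=(0,-d\alpha)\in\widetilde\Xi_1^{\,j}(M)$ for $\alpha\in\widetilde\Xi_2^{\,j}(M)$, and $\tilde l_1\alpha=-d\alpha\in\widetilde\Xi_{i-1}^{\,j}(M)$ for $\alpha\in\widetilde\Xi_i^{\,j}(M)$, $i\ge 3$. * For $(x_a,\alpha_a)\in\widetilde\Xi_1^{\,j_a}(M)$, $a=1,\dots,k$, $k\ge 2$, the value of $\tilde l_k$ lies in $\widetilde\Xi_{k-1}^{\,j_1+\dots+j_k}(M)$, and is zero when $k-1+j_1+\dots+j_k>m$. Otherwise $$\tilde l_2\big((x_1,\alpha_1),(x_2,\alpha_2)\big)=\big(\nu(x_1,x_2),\,\iota_{x_1x_2}\omega\big),\qquad \tilde l_k\big((x_1,\alpha_1),\dots,(x_k,\alpha_k)\big)=\iota_{x_1\cdots x_k}\omega\quad(k\ge 3).$$ **Statement.** 1. $(\widetilde\Xi(M),\{\tilde l_k\}_{k\ge 1})$ is an $L_\infty$-algebra (in particular the brackets take values in $\widetilde\Xi(M)$), and every $\tilde l_k$ has bidegree $(-1,0)$ for the bigrading $(i,j)$. 2. The base row $\bigoplus_i\widetilde\Xi_i^{\,0}(M)$,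 that is $\widetilde{\mathfrak X}^1(M)$ in degree $1$ and $\Omega^{m-i}(M)$ in degrees $2\le i\le m$, is an $L_\infty$-subalgebra. 3. This subalgebra is the Poisson Lie $m$-algebra used in the theory of homotopy moment maps (Frégier–Rogers–Zambon). Precisely, let $P=\bigoplus_{k=0}^{m-1}P_k$ be the latter: $P_0=\{(v,\alpha)\in\mathfrak X(M)\times\Omega^{m-1}(M):\iota_v\omega=-d\alpha\}$ and $P_k=\Omega^{m-1-k}(M)$ for $1\le k\le m-1$. Its graded antisymmetric brackets, of degree $n-2$, are $l^P_1=d$ on $P_k$ for $k\ge 1$ (regarded as a map to $0\times\Omega^{m-1}(M)$ if $k=1$), $l^P_1=0$ on $P_0$, $l^P_2\big((v_1,\alpha_1),(v_2,\alpha_2)\big)=([v_1,v_2],\iota_{v_2}\iota_{v_1}\omega)$, $l^P_n\big((v_1,\alpha_1),\dots,(v_n,\alpha_n)\big)=-(-1)^{n(n+1)/2}\iota_{v_n}\cdots\iota_{v_1}\omega$ for $n\ge 3$, and zero otherwise. Let $F$ be the linear map with $F(v,\alpha)=(v,-\alpha)\in\widetilde\Xi_1^{\,0}(M)$ on $P_0$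 and $F(\alpha)=-\alpha\in\widetilde\Xi_{k+1}^{\,0}(M)$ on $P_k$, $k\ge 1$. Then $F$ maps $P_k$ bijectively onto $\widetilde\Xi_{k+1}^{\,0}(M)$ for every $k$, and it intertwines the brackets up to the décalage signs: for $n\ge 1$ and $z_a\in P_{e_a}$, $$\tilde l_n(Fz_1,\dots,Fz_n)=(-1)^{\,n(n-2)+\sum_{a=1}^n (n-a)e_a}\,F\,l^P_n(z_1,\dots,z_n).$$ -/

import Mathlib

set_option linter.unusedSectionVars false
noncomputable section
namespace PreSymplectic

section Manifold
open VectorField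
open scoped Manifold ContDiff Bundle

/-- The algebra `C^∞(M)` of smooth real functions on `M`. -/
abbrev SmoothFun (E : Type*) [NormedAddCommGroup E] [NormedSpace ℝ E]
    (M : Type*) [TopologicalSpace M] [ChartedSpace E M] : Type _ :=
  C^∞⟮𝓘(ℝ, E), M; ℝ⟯

/-- The space `𝔛(M)` of smooth vector fields on `M`: smooth sections of the tangent bundle. -/
abbrev VectorFields (E : Type*) [NormedAddCommGroup E] [NormedSpace ℝ E]
    (M : Type*) [TopologicalSpace M] [ChartedSpace E M] [IsManifold 𝓘(ℝ, E) ∞ M] : Type _ :=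
  Cₛ^∞⟮𝓘(ℝ, E); E, (TangentSpace 𝓘(ℝ, E) : M → Type _)⟯

theorem SmoothFun.mdifferentiableAt {E : Type*} [NormedAddCommGroup E] [NormedSpace ℝ E]
    {M : Type*} [TopologicalSpace M] [ChartedSpace E M] (f : SmoothFun E M) (x : M) :
    MDifferentiableAt 𝓘(ℝ, E) 𝓘(ℝ, ℝ) f x :=
  (f.contMDiff x).mdifferentiableAt (by simp)

variable {E : Type*} [NormedAddCommGroup E] [NormedSpace ℝ E]
  {M : Type*} [TopologicalSpace M] [ChartedSpace E M] [IsManifold 𝓘(ℝ, E) ∞ M]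

/-- Pointwise multiplication of a vector field by a smooth function. -/
instance : SMul (SmoothFun E M) (VectorFields E M) :=
  ⟨fun f X => ⟨fun x => f x • X x, f.contMDiff.smul_section X.contMDiff⟩⟩

@[simp] theorem smul_vf_apply (f : SmoothFun E M) (X : VectorFields E M) (x : M) :
    (f • X) x = f x • X x := rfl

instance : Module (SmoothFun E M) (VectorFields E M) where
  one_smul X := by ext x; simp
  mul_smul f g X := by ext x; simp [mul_smul]
  smul_zero f := by ext x; simp
  smul_add f X Y := by ext x; simp
  add_smul f g X := by ext x; simp [add_smul]
  zero_smul X := by ext x; simp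

instance : IsScalarTower ℝ (SmoothFun E M) (VectorFields E M) where
  smul_assoc r f X := by ext x; simp [mul_smul]

theorem contMDiff_deriv (X : VectorFields E M) (f : SmoothFun E M) :
    ContMDiff 𝓘(ℝ, E) 𝓘(ℝ, ℝ) ∞ (fun x => mvfderiv 𝓘(ℝ, E) f x (X x)) :=
  (contMDiff_snd_tangentBundle_modelSpace ℝ 𝓘(ℝ, ℝ)).comp
    ((f.contMDiff.contMDiff_tangentMap (m := ∞) le_rfl).comp X.contMDiff)

/-- The action `⁅X, f⁆ = X f` of vector fields on functions: the derivative of `f` along `X`. -/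
instance : Bracket (VectorFields E M) (SmoothFun E M) :=
  ⟨fun X f => ⟨fun x => mvfderiv 𝓘(ℝ, E) f x (X x), contMDiff_deriv X f⟩⟩

theorem lie_fun_apply (X : VectorFields E M) (f : SmoothFun E M) (x : M) :
    ⁅X, f⁆ x = mvfderiv 𝓘(ℝ, E) f x (X x) := rfl

theorem VectorFields.mdifferentiableAt (X : VectorFields E M) (x : M) :
    MDifferentiableAt 𝓘(ℝ, E) (𝓘(ℝ, E).prod 𝓘(ℝ, E))
      (fun y => (⟨y, X y⟩ : TangentBundle 𝓘(ℝ, E) M)) x :=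
  (X.contMDiff x).mdifferentiableAt (by simp)

instance : IsManifold 𝓘(ℝ, E) (minSmoothness ℝ 3) M :=
  IsManifold.of_le (n := ∞) (by simp only [minSmoothness_of_isRCLikeNormedField]; exact WithTop.coe_le_coe.2 le_top)

instance : IsManifold 𝓘(ℝ, E) (((⊤ : ℕ∞) : ℕ∞ω) + 1) M := ‹IsManifold 𝓘(ℝ, E) ∞ M›

variable [FiniteDimensional ℝ E]

/-- The Lie bracket of vector fields. -/
instance : Bracket (VectorFields E M) (VectorFields E M) :=
  ⟨fun X Y => ⟨mlieBracket 𝓘(ℝ, E) X Y,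
    have : CompleteSpace E := FiniteDimensional.complete ℝ E
    ContDiff.mlieBracket_vectorField (m := ⊤) (n := ⊤) X.contMDiff Y.contMDiff
      (by simp [minSmoothness_of_isRCLikeNormedField])⟩⟩

theorem lie_vf_apply (X Y : VectorFields E M) (x : M) :
    ⁅X, Y⁆ x = mlieBracket 𝓘(ℝ, E) X Y x := rfl

instance : LieRing (VectorFields E M) where
  add_lie X Y Z := by
    have : CompleteSpace E := FiniteDimensional.complete ℝ E
    ext x
    exact mlieBracket_add_left (X.mdifferentiableAt x) (Y.mdifferentiableAt x)
  lie_add X Y Z := by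
    have : CompleteSpace E := FiniteDimensional.complete ℝ E
    ext x
    exact mlieBracket_add_right (Y.mdifferentiableAt x) (Z.mdifferentiableAt x)
  lie_self X := by
    ext x
    exact congrFun mlieBracket_self x
  leibniz_lie X Y Z := by
    have : CompleteSpace E := FiniteDimensional.complete ℝ E
    have h2 : minSmoothness ℝ 2 ≤ (∞ : ℕ∞ω) := by
      simp only [minSmoothness_of_isRCLikeNormedField]; exact WithTop.coe_le_coe.2 le_top
    ext x
    exact leibniz_identity_mlieBracket_apply ((X.contMDiff x).of_le h2)
      ((Y.contMDiff x).of_le h2) ((Z.contMDiff x).of_le h2)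

instance : LieAlgebra ℝ (VectorFields E M) where
  lie_smul r X Y := by
    have : CompleteSpace E := FiniteDimensional.complete ℝ E
    ext x
    exact mlieBracket_const_smul_right (Y.mdifferentiableAt x)

/-- `[X, f Y] = (X f) Y + f [X, Y]`, for `Y` differentiable at the point only. -/
theorem mlieBracket_fun_smul (X : VectorFields E M) (f : SmoothFun E M)
    {U : (y : M) → TangentSpace 𝓘(ℝ, E) y} {x : M}
    (hU : MDifferentiableAt 𝓘(ℝ, E) (𝓘(ℝ, E).prod 𝓘(ℝ, E))
      (fun y => (⟨y, U y⟩ : TangentBundle 𝓘(ℝ, E) M)) x) :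
    mlieBracket 𝓘(ℝ, E) X (⇑f • U) x = ⁅X, f⁆ x • U x + f x • mlieBracket 𝓘(ℝ, E) X U x := by
  have : CompleteSpace E := FiniteDimensional.complete ℝ E
  exact mlieBracket_smul_right (f.mdifferentiableAt x) hU

theorem mlieBracket_mlieBracket_smul (X Y : VectorFields E M) (f : SmoothFun E M)
    {U : (y : M) → TangentSpace 𝓘(ℝ, E) y} {x : M}
    (hU : ContMDiffAt 𝓘(ℝ, E) (𝓘(ℝ, E).prod 𝓘(ℝ, E)) ∞
      (fun y => (⟨y, U y⟩ : TangentBundle 𝓘(ℝ, E) M)) x) :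
    mlieBracket 𝓘(ℝ, E) X (mlieBracket 𝓘(ℝ, E) Y (⇑f • U)) x =
      ⁅X, ⁅Y, f⁆⁆ x • U x + ⁅Y, f⁆ x • mlieBracket 𝓘(ℝ, E) X U x +
      (⁅X, f⁆ x • mlieBracket 𝓘(ℝ, E) Y U x +
        f x • mlieBracket 𝓘(ℝ, E) X (mlieBracket 𝓘(ℝ, E) Y U) x) := by
  have : CompleteSpace E := FiniteDimensional.complete ℝ E
  have hU' := hU.mdifferentiableAt (by simp)
  have hYU := (ContMDiffAt.mlieBracket_vectorField (m := ⊤) (n := ⊤) (Y.contMDiff x) hU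
      (by simp [minSmoothness_of_isRCLikeNormedField])).mdifferentiableAt (by simp)
  have key : mlieBracket 𝓘(ℝ, E) Y (⇑f • U) =ᶠ[nhds x]
      (⇑⁅Y, f⁆ • U + ⇑f • mlieBracket 𝓘(ℝ, E) Y U) := by
    have h1 := (contMDiffAt_iff_contMDiffAt_nhds (n := 1) (by simp)).1
      (hU.of_le (WithTop.coe_le_coe.2 le_top))
    filter_upwards [h1] with y hy
    exact mlieBracket_fun_smul Y f (hy.mdifferentiableAt (by simp))
  have e := Filter.EventuallyEq.mlieBracket_vectorField_eq
    (Filter.EventuallyEq.refl (nhds x) (⇑X)) key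
  rw [e, mlieBracket_add_right, mlieBracket_fun_smul X _ hU', mlieBracket_fun_smul X _ hYU]
  · exact (((⁅Y, f⁆ : SmoothFun E M).mdifferentiableAt x)).smul_section hU'
  · exact ((f.mdifferentiableAt x)).smul_section hYU

/-- The commutator formula `[X, Y] f = X (Y f) - Y (X f)`. -/
theorem lie_lie_fun (X Y : VectorFields E M) (f : SmoothFun E M) (x : M) :
    ⁅⁅X, Y⁆, f⁆ x = ⁅X, ⁅Y, f⁆⁆ x - ⁅Y, ⁅X, f⁆⁆ x := by
  have : CompleteSpace E := FiniteDimensional.complete ℝ E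
  have h2 : minSmoothness ℝ 2 ≤ (∞ : ℕ∞ω) := by
    simp only [minSmoothness_of_isRCLikeNormedField]; exact WithTop.coe_le_coe.2 le_top
  rcases subsingleton_or_nontrivial E with hE | hE
  · have h0 (Z : VectorFields E M) (g : SmoothFun E M) : ⁅Z, g⁆ x = 0 := by
      have : Z x = 0 := Subsingleton.elim (α := E) _ _
      rw [lie_fun_apply, this, map_zero]
    simp [h0]
  · obtain ⟨v, hv⟩ := exists_ne (0 : E)
    let v' : TangentSpace 𝓘(ℝ, E) x := v
    let U := FiberBundle.extend E v'
    have hUx : U x = v' := FiberBundle.extend_apply_self E v'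
    have hU : ContMDiffAt 𝓘(ℝ, E) (𝓘(ℝ, E).prod 𝓘(ℝ, E)) ∞
      (fun y => (⟨y, U y⟩ : TangentBundle 𝓘(ℝ, E) M)) x :=
        FiberBundle.contMDiffAt_extend 𝓘(ℝ, E) E v'
    have hfU : ContMDiffAt 𝓘(ℝ, E) (𝓘(ℝ, E).prod 𝓘(ℝ, E)) ∞
      (fun y => (⟨y, (⇑f • U) y⟩ : TangentBundle 𝓘(ℝ, E) M)) x :=
        (f.contMDiff x).smul_section hU
    have e1 := leibniz_identity_mlieBracket_apply ((X.contMDiff x).of_le h2)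
      ((Y.contMDiff x).of_le h2) (hfU.of_le h2)
    have e2 := leibniz_identity_mlieBracket_apply ((X.contMDiff x).of_le h2)
      ((Y.contMDiff x).of_le h2) (hU.of_le h2)
    have e3 := mlieBracket_fun_smul ⁅X, Y⁆ f (hU.mdifferentiableAt (by simp))
    rw [mlieBracket_mlieBracket_smul X Y f hU, mlieBracket_mlieBracket_smul Y X f hU] at e1
    change mlieBracket 𝓘(ℝ, E) (mlieBracket 𝓘(ℝ, E) X Y) (⇑f • U) x =
      _ • U x + f x • mlieBracket 𝓘(ℝ, E) (mlieBracket 𝓘(ℝ, E) X Y) U x at e3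
    rw [e3, e2] at e1
    have e4 : (⁅⁅X, Y⁆, f⁆ x - (⁅X, ⁅Y, f⁆⁆ x - ⁅Y, ⁅X, f⁆⁆ x)) • U x = 0 := by
      rw [sub_smul, sub_smul]
      generalize (⁅⁅X, Y⁆, f⁆ x) • U x = a at *
      generalize (⁅X, ⁅Y, f⁆⁆ x) • U x = b at *
      generalize (⁅Y, ⁅X, f⁆⁆ x) • U x = c at *
      rw [smul_add] at e1
      have e5 : b - c - a = 0 := by
        rw [← sub_eq_zero] at e1
        rw [← e1]
        abel
      rw [← neg_eq_zero, ← e5]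
      abel
    rw [hUx] at e4
    have := (smul_eq_zero.1 e4).resolve_right hv
    linarith

instance : LieRingModule (VectorFields E M) (SmoothFun E M) where
  add_lie X Y f := by ext x; exact (mvfderiv 𝓘(ℝ, E) f x).map_add (X x) (Y x)
  lie_add X f g := by
    ext x
    have := mvfderiv_add (I := 𝓘(ℝ, E)) (f.mdifferentiableAt x) (g.mdifferentiableAt x)
    exact congrArg (fun L => L (X x)) this
  leibniz_lie X Y f := by ext x; have := lie_lie_fun X Y f x; simp only [ContMDiffMap.coe_add, Pi.add_apply]; linarith

instance : LieRinehartRing (SmoothFun E M) (VectorFields E M) where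
  lie_smul_eq_mul' f g X := by
    ext x
    exact (mvfderiv 𝓘(ℝ, E) g x).map_smul (f x) (X x)
  leibniz_mul_right' X f g := by
    ext x
    have := mvfderiv_mul (I := 𝓘(ℝ, E)) (f.mdifferentiableAt x) (g.mdifferentiableAt x)
    have := congrArg (fun L => L (X x)) this
    refine this.trans ?_
    change f x * ⁅X, g⁆ x + g x * ⁅X, f⁆ x = f x * ⁅X, g⁆ x + ⁅X, f⁆ x * g x
    ring
  leibniz_smul_right' X Y f := by
    ext x
    refine (mlieBracket_fun_smul X f (Y.mdifferentiableAt x)).trans ?_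
    exact add_comm _ _

instance : LieRinehartAlgebra ℝ (SmoothFun E M) (VectorFields E M) where
  smul_lie r X f := by
    ext x
    exact (mvfderiv 𝓘(ℝ, E) f x).map_smul r (X x)
  lie_smul r X f := by
    ext x
    have h := mvfderiv_mul (I := 𝓘(ℝ, E)) (mdifferentiableAt_const (c := r) (x := x))
      (f.mdifferentiableAt x)
    have h' := congrArg (fun L => L (X x)) h
    refine h'.trans ?_
    rw [mvfderiv_const]
    simp [lie_fun_apply]

end Manifold

/-! ### Differential forms and the exterior derivative

The algebra is written for a Lie-Rinehart algebra `(A, L)` over `ℝ`; it is used for the functions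
`A = C^∞(M)` and the vector fields `L = 𝔛(M)` on a manifold `M`. -/

section Forms
variable {A L : Type*} [CommRing A] [Algebra ℝ A] [LieRing L] [LieAlgebra ℝ L] [Module A L]
  [LieRingModule L A] [LieRinehartRing A L] [LieRinehartAlgebra ℝ A L]

/-- Differential `n`-forms: alternating `A`-multilinear maps `L × ⋯ × L → A`. For `A = C^∞(M)` and
`L = 𝔛(M)` these are exactly the smooth `n`-forms on `M`. -/
abbrev Form (A L : Type*) [CommRing A] [AddCommGroup L] [Module A L] (n : ℕ) : Type _ :=
  L [⋀^Fin n]→ₗ[A] A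

instance (n : ℕ) : IsScalarTower ℝ A (Form A L n) :=
  ⟨fun r a α => by ext v; simp⟩

open Fin

/-- The value on vector fields of the exterior derivative of a form of positive degree,
`dω(v_0, …, v_{n+1}) = ∑_i (-1)^i v_i(ω(…, v̂_i, …))
  + ∑_{i<j} (-1)^{i+j} ω([v_i, v_j], …, v̂_i, …, v̂_j, …)`.
In the second sum the pair `i < j` of indices is written as `i, j + 1` with `i ≤ j`. -/
def koszul {n : ℕ} (ω : Form A L (n + 1)) (v : Fin (n + 2) → L) : A :=
  ∑ i : Fin (n + 2), (-1) ^ (i : ℕ) * ⁅v i, ω (i.removeNth v)⁆ -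
    ∑ i : Fin (n + 1), ∑ j ≥ i, (-1) ^ (i + j : ℕ) *
      ω (Matrix.vecCons ⁅v i.castSucc, v j.succ⁆ (j.removeNth (i.castSucc.removeNth v)))

/-- A form, as a real multilinear map. -/
def Form.toReal {n : ℕ} (ω : Form A L n) : L [⋀^Fin n]→ₗ[ℝ] A :=
  { ω.toMultilinearMap.restrictScalars ℝ with map_eq_zero_of_eq' := ω.map_eq_zero_of_eq' }

theorem Form.toReal_apply {n : ℕ} (ω : Form A L n) (v : Fin n → L) : ω.toReal v = ω v := rfl

/-- The bilinear expression `X (ω(…))`. -/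
def dAux1 {n : ℕ} (ω : L [⋀^Fin n]→ₗ[ℝ] A) : L →ₗ[ℝ] L [⋀^Fin n]→ₗ[ℝ] A where
  toFun X := (LieModule.toEnd ℝ L A X).compAlternatingMap ω
  map_add' X Y := by ext v; simp
  map_smul' r X := by ext v; simp

/-- The expression `ω([X, Y], …)`. -/
def dAux2 {n : ℕ} (ω : L [⋀^Fin (n + 1)]→ₗ[ℝ] A) : L →ₗ[ℝ] L →ₗ[ℝ] L [⋀^Fin n]→ₗ[ℝ] A :=
  LinearMap.mk₂ ℝ (fun X Y => ω.curryLeft ⁅X, Y⁆) (by simp) (by simp) (by simp) (by simp)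

/-- The exterior derivative as an alternating real multilinear map. -/
def koszulReal {n : ℕ} (ω : L [⋀^Fin (n + 1)]→ₗ[ℝ] A) : L [⋀^Fin (n + 2)]→ₗ[ℝ] A :=
  .alternatizeUncurryFin (dAux1 ω) -
    (1 / 2 : ℝ) • .alternatizeUncurryFin (AlternatingMap.alternatizeUncurryFinLM ∘ₗ dAux2 ω)

theorem koszulReal_apply {n : ℕ} (ω : Form A L (n + 1)) (v : Fin (n + 2) → L) :
    koszulReal ω.toReal v = koszul ω v := by
  rw [koszulReal, AlternatingMap.sub_apply, AlternatingMap.smul_apply,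
    AlternatingMap.alternatizeUncurryFin_alternatizeUncurryFinLM_comp_apply, koszul]
  congr 1
  · rw [AlternatingMap.alternatizeUncurryFin_apply]
    refine Finset.sum_congr rfl fun i _ => ?_
    simp [dAux1, Form.toReal_apply, zsmul_eq_mul]
  · simp only [Finset.smul_sum]
    refine Finset.sum_congr rfl fun i _ => Finset.sum_congr rfl fun j _ => ?_
    have h : ⁅v j.succ, v i.castSucc⁆ = - ⁅v i.castSucc, v j.succ⁆ := (lie_skew _ _).symm
    simp only [dAux2, LinearMap.mk₂_apply, h, map_neg, AlternatingMap.neg_apply, AlternatingMap.curryLeft_apply_apply, Form.toReal_apply]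
    rw [sub_neg_eq_add, ← two_smul ℝ, smul_comm _ (2 : ℝ), smul_smul, zsmul_eq_mul]
    norm_num

theorem removeNth_zero_cons {α : Type*} {n : ℕ} (X : α) (w : Fin (n + 1) → α) :
    Fin.removeNth 0 (Fin.cons X w : Fin (n + 2) → α) = w := by
  ext i; simp [Fin.removeNth]

theorem removeNth_succ_cons {α : Type*} {n : ℕ} (X : α) (w : Fin (n + 1) → α) (i : Fin (n + 1)) :
    Fin.removeNth i.succ (Fin.cons X w : Fin (n + 2) → α) = Fin.cons X (i.removeNth w) := by
  ext k; refine Fin.cases ?_ (fun k => ?_) k <;> simp [Fin.removeNth]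

theorem Form.map_cons_smul {n : ℕ} (ω : Form A L (n + 1)) (a : A) (X : L) (v : Fin n → L) :
    ω (Fin.cons (a • X) v) = a * ω (Fin.cons X v) :=
  ω.map_vecCons_smul v a X

theorem Form.map_cons_sub {n : ℕ} (ω : Form A L (n + 1)) (X Y : L) (v : Fin n → L) :
    ω (Fin.cons (X - Y) v) = ω (Fin.cons X v) - ω (Fin.cons Y v) :=
  congrArg (fun f => f v) (map_sub (AlternatingMap.curryLeft ω) X Y)

theorem lie_smul_left (a : A) (X Y : L) : ⁅a • X, Y⁆ = a • ⁅X, Y⁆ - ⁅Y, a⁆ • X := by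
  rw [← lie_skew, LieRinehartRing.leibniz_smul_right, ← lie_skew X Y, smul_neg]
  abel

theorem koszul_cons_smul {n : ℕ} (ω : Form A L (n + 1)) (a : A) (X : L) (w : Fin (n + 1) → L) :
    koszul ω (Fin.cons (a • X) w : Fin (n + 2) → L) =
      a * koszul ω (Fin.cons X w : Fin (n + 2) → L) := by
  have key (X : L) : koszul ω (Fin.cons X w : Fin (n + 2) → L) =
      (⁅X, ω w⁆ + ∑ j : Fin (n + 1), (-1) ^ (j + 1 : ℕ) * ⁅w j, ω (Fin.cons X (j.removeNth w))⁆) -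
      (∑ j : Fin (n + 1), (-1) ^ (j : ℕ) * ω (Fin.cons ⁅X, w j⁆ (j.removeNth w)) +
        ∑ i : Fin n, ∑ j ≥ i.succ, (-1) ^ (i + 1 + j : ℕ) *
          ω (Fin.cons ⁅w i.castSucc, w j⁆
            (j.removeNth (i.castSucc.succ.removeNth (Fin.cons X w : Fin (n + 2) → L))))) := by
    unfold koszul
    congr 1
    · rw [Fin.sum_univ_succ]
      simp only [removeNth_zero_cons, removeNth_succ_cons, Fin.cons_zero, Fin.cons_succ,
        Fin.val_zero, Fin.val_succ, pow_zero, one_mul]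
    · rw [Fin.sum_univ_succ]
      have : Finset.Ici (0 : Fin (n + 1)) = Finset.univ := by ext; simp
      simp only [Fin.castSucc_zero, removeNth_zero_cons, Fin.cons_zero, Fin.cons_succ, this,
        Fin.val_zero, Fin.val_succ, zero_add, Matrix.vecCons, ← Fin.succ_castSucc]
  have h2 (i : Fin n) (j : Fin (n + 1)) (hj : j ∈ Finset.Ici i.succ) (Z : L) : ω (Fin.cons Z
        (j.removeNth (i.castSucc.succ.removeNth (Fin.cons (a • X) w : Fin (n + 2) → L)))) =
      a * ω (Fin.cons Z
        (j.removeNth (i.castSucc.succ.removeNth (Fin.cons X w : Fin (n + 2) → L)))) := by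
    obtain _ | n := n
    · exact i.elim0
    · obtain ⟨j, rfl⟩ : ∃ k, j = Fin.succ k :=
        ⟨j.pred (by rintro rfl; simp at hj), by simp⟩
      simp only [removeNth_succ_cons]
      exact Form.map_cons_smul (AlternatingMap.curryLeft ω Z) a X _
  have h3 : ∑ i : Fin n, ∑ j ≥ i.succ, (-1 : A) ^ (i + 1 + j : ℕ) *
          ω (Fin.cons ⁅w i.castSucc, w j⁆
            (j.removeNth (i.castSucc.succ.removeNth (Fin.cons (a • X) w : Fin (n + 2) → L)))) =
      a * ∑ i : Fin n, ∑ j ≥ i.succ, (-1 : A) ^ (i + 1 + j : ℕ) *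
          ω (Fin.cons ⁅w i.castSucc, w j⁆
            (j.removeNth (i.castSucc.succ.removeNth (Fin.cons X w : Fin (n + 2) → L)))) := by
    simp only [Finset.mul_sum]
    refine Finset.sum_congr rfl fun i _ => Finset.sum_congr rfl fun j hj => ?_
    rw [h2 i j hj]
    ring
  rw [key, key, h3]
  simp only [Form.map_cons_smul, Form.map_cons_sub, lie_smul_left,
    LieRinehartRing.lie_smul_eq_mul, LieRinehartRing.leibniz_mul_right, smul_eq_mul]
  simp only [mul_sub, mul_add, Finset.sum_add_distrib, Finset.sum_sub_distrib, Finset.mul_sum]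
  have h4 : ∑ j : Fin (n + 1), (-1) ^ (j + 1 : ℕ) * (⁅w j, a⁆ * ω (Fin.cons X (j.removeNth w))) =
      - ∑ j : Fin (n + 1), (-1) ^ (j : ℕ) * (⁅w j, a⁆ * ω (Fin.cons X (j.removeNth w))) := by
    rw [← Finset.sum_neg_distrib]
    exact Finset.sum_congr rfl fun j _ => by ring
  rw [h4]
  simp only [mul_left_comm a]
  ring

theorem koszul_update_smul {n : ℕ} (ω : Form A L (n + 1)) (v : Fin (n + 2) → L) (i : Fin (n + 2))
    (a : A) (X : L) :
    koszul ω (Function.update v i (a • X)) = a * koszul ω (Function.update v i X) := by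
  have h0 (v : Fin (n + 2) → L) (Y : L) : Function.update v 0 Y = Fin.cons Y (Fin.tail v) := by
    rw [← Fin.cons_self_tail v, Fin.update_cons_zero, Fin.tail_cons]
  by_cases hi : i = 0
  · subst hi
    rw [h0, h0, koszul_cons_smul]
  · have h (Y : L) : koszul ω (Function.update v i Y) =
        - koszul ω (Function.update (v ∘ Equiv.swap i 0) 0 Y) := by
      rw [← koszulReal_apply, ← koszulReal_apply,
        ← AlternatingMap.map_swap _ _ hi]
      congr 1
      rw [Function.update_comp_equiv]
      simp [Function.comp_assoc, ← Equiv.coe_trans]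
    rw [h, h, h0, h0, koszul_cons_smul, mul_neg]

/-- The exterior derivative of a form of positive degree. -/
def dPos (n : ℕ) : Form A L (n + 1) →ₗ[ℝ] Form A L (n + 2) where
  toFun ω :=
    { toFun := koszul ω
      map_update_add' := fun {dec} v i X Y => by
        rw [Subsingleton.elim dec (instDecidableEqFin _)]
        simp only [← koszulReal_apply, AlternatingMap.map_update_add]
      map_update_smul' := fun {dec} v i a X => by
        rw [Subsingleton.elim dec (instDecidableEqFin _)]
        exact koszul_update_smul ω v i a X
      map_eq_zero_of_eq' := fun v i j h hij => by
        rw [← koszulReal_apply]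
        exact AlternatingMap.map_eq_zero_of_eq _ v h hij }
  map_add' ω η := by
    ext v
    simp [koszul, mul_add, Finset.sum_add_distrib]
    ring
  map_smul' r ω := by
    ext v
    simp [koszul, smul_sub, Finset.smul_sum]

/-- The differential of a function. -/
def dZero : Form A L 0 →ₗ[ℝ] Form A L 1 where
  toFun f :=
    { toFun := fun v => ⁅v 0, f ![]⁆
      map_update_add' := fun {dec} v i X Y => by
        obtain rfl := Subsingleton.elim i 0
        simp
      map_update_smul' := fun {dec} v i a X => by
        obtain rfl := Subsingleton.elim i 0
        simp
      map_eq_zero_of_eq' := fun v i j h hij => (hij (Subsingleton.elim _ _)).elim }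
  map_add' f g := by ext v; simp
  map_smul' r f := by ext v; simp

/-- The exterior derivative of `n`-forms. -/
def dForm : ∀ n : ℕ, Form A L n →ₗ[ℝ] Form A L (n + 1)
  | 0 => dZero
  | n + 1 => dPos n

/-- The space of all differential forms, with its components in the various degrees. -/
abbrev Forms (A L : Type*) [CommRing A] [AddCommGroup L] [Module A L] : Type _ :=
  ∀ n : ℕ, Form A L n

/-- The algebra of multivector fields, the exterior algebra of the `A`-module `L`; for `A = C^∞(M)`
and `L = 𝔛(M)` its degree `n` part `⋀[A]^n L` is the space of sections of `Λⁿ TM`. -/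
abbrev Multivectors (A L : Type*) [CommRing A] [AddCommGroup L] [Module A L] : Type _ :=
  ExteriorAlgebra A L

/-! ### Contraction -/

/-- The contraction `ι_X α = α(X, …)` of forms with a vector field (zero on functions). -/
def contractVF : L →ₗ[A] Module.End A (Forms A L) where
  toFun X := { toFun := fun α n => (α (n + 1)).curryLeft X
               map_add' := fun α β => by ext; simp
               map_smul' := fun a α => by ext; simp }
  map_add' X Y := by ext; simp
  map_smul' a X := by ext; simp

/-- The contraction of forms with multivector fields, the algebra homomorphism determined by
`ι_{X_1 ⋯ X_n} = ι_{X_1} ∘ ⋯ ∘ ι_{X_n}`. -/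
def contract : Multivectors A L →ₐ[A] Module.End A (Forms A L) :=
  ExteriorAlgebra.lift A ⟨contractVF, fun X => by
    ext α n v
    exact DFunLike.congr_fun (AlternatingMap.curryLeft_same (α (n + 1 + 1)) X) v⟩

/-- A vector field, as a multivector field of degree one. -/
abbrev vf : L →ₗ[A] Multivectors A L := ExteriorAlgebra.ι A

local notation "Λ" => Multivectors A L

/-! ### The Schouten bracket -/

/-- The grade involution, `x ↦ (-1)^n x` on multivector fields of degree `n`. -/
def grade : Multivectors A L →ₐ[A] Multivectors A L := CliffordAlgebra.involute

theorem grade_vf_mul (X : L) (x : Λ) : grade (vf (A := A) X * x) = - (vf X * grade x) := by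
  rw [map_mul, grade, vf, ExteriorAlgebra.ι, CliffordAlgebra.involute_ι, neg_mul]

theorem grade_algebraMap (f : A) : grade (algebraMap A Λ f) = algebraMap A Λ f := AlgHom.commutes _ _

theorem mul_vf (x : Λ) (X : L) : x * vf X = vf X * grade x := by
  induction x using CliffordAlgebra.left_induction with
  | algebraMap r => rw [grade_algebraMap, Algebra.commutes]
  | add x y hx hy => rw [add_mul, hx, hy, map_add, mul_add]
  | ι_mul x Y hx =>
    change vf (A := A) Y * x * vf X = _ * grade (vf (A := A) Y * x)
    have h : vf (A := A) Y * vf X = - (vf X * vf Y) :=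
      eq_neg_of_add_eq_zero_left (ExteriorAlgebra.ι_add_mul_swap Y X)
    rw [grade_vf_mul, mul_assoc, hx, ← mul_assoc, h, mul_neg, neg_mul, mul_assoc]

/-! The Lie derivative of multivector fields and the Schouten bracket are both obtained from the
following extension principle. Let `P` be a module over the multivector fields, `c : A → P` a
derivation and `D : L → P` a real linear map with `D (f X) = f D(X) - X c(f)`. Then there is a unique
real linear extension `T` of `c` to all multivector fields with `T (X x) = x D(X) - X T(x)` for
vector fields `X`, so that `T (X_1 ⋯ X_n) = ∑_i (-1)^(i-1) X_1 ⋯ X̂_i ⋯ X_n D(X_i)`. -/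

section Twist
variable {P : Type*} [AddCommGroup P] [Module ℝ P] [Module A P] [Module (Multivectors A L) P]
  [IsScalarTower A (Multivectors A L) P] [IsScalarTower ℝ A P]

/-- The pairs of a multivector field and an element of `P`, with the module structure over `A`
twisted by the derivation `c`. -/
def Twist (_ : Derivation ℝ A P) : Type _ := Multivectors A L × P

variable (c : Derivation ℝ A P)

/-- The pair `(x, z)`. -/
def Twist.mk (x : Multivectors A L) (z : P) : Twist (A := A) (L := L) c := (x, z)

instance : AddCommGroup (Twist (A := A) (L := L) c) := inferInstanceAs (AddCommGroup (Λ × P))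

/-- The twisted module structure `f (x, z) = (f x, f z + (-1)^|x| x c(f))`. -/
instance : Module A (Twist (A := A) (L := L) c) where
  smul f p := (f • p.1, f • p.2 + grade p.1 • c f)
  one_smul p := by
    change ((1 : A) • p.1, (1 : A) • p.2 + grade p.1 • c 1) = p
    simp only [one_smul, Derivation.map_one_eq_zero, smul_zero, add_zero]
    rfl
  mul_smul f g p := by
    change ((f * g) • p.1, (f * g) • p.2 + grade p.1 • c (f * g)) =
      (f • g • p.1, f • (g • p.2 + grade p.1 • c g) + grade (g • p.1) • c f)
    rw [Derivation.leibniz, smul_add, smul_add, smul_comm (grade p.1) f, smul_comm (grade p.1) g,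
      map_smul, smul_assoc, mul_smul, mul_smul]
    congr 1
    abel
  smul_zero f := by
    change (f • (0 : Λ), f • (0 : P) + grade (0 : Λ) • c f) = 0
    simp
  smul_add f p q := by
    change (f • (p.1 + q.1), f • (p.2 + q.2) + grade (p.1 + q.1) • c f) =
      (f • p.1 + f • q.1, (f • p.2 + grade p.1 • c f) + (f • q.2 + grade q.1 • c f))
    simp [add_smul]
    abel
  add_smul f g p := by
    change ((f + g) • p.1, (f + g) • p.2 + grade p.1 • c (f + g)) =
      (f • p.1 + g • p.1, (f • p.2 + grade p.1 • c f) + (g • p.2 + grade p.1 • c g))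
    simp [add_smul]
    abel
  zero_smul p := by
    change ((0 : A) • p.1, (0 : A) • p.2 + grade p.1 • c 0) = 0
    simp

variable {c} {D : L →ₗ[ℝ] P}

/-- The operator `(x, z) ↦ (X x, x D(X) - X z)` attached to a vector field `X`. -/
def twistMul (hD : ∀ (f : A) (X : L), D (f • X) = f • D X - vf (A := A) X • c f) :
    L →ₗ[A] Twist (A := A) (L := L) c →ₗ[A] Twist (A := A) (L := L) c :=
  LinearMap.mk₂ A (fun X p => ((vf X * p.1, p.1 • D X - vf (A := A) X • p.2) : Λ × P))
    (fun X Y p => by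
      refine Prod.ext ?_ ?_
      · change vf (X + Y) * p.1 = vf X * p.1 + vf Y * p.1
        rw [map_add, add_mul]
      · change p.1 • D (X + Y) - vf (A := A) (X + Y) • p.2 =
          (p.1 • D X - vf (A := A) X • p.2) + (p.1 • D Y - vf (A := A) Y • p.2)
        rw [map_add, map_add, smul_add, add_smul]
        abel)
    (fun f X p => by
      refine Prod.ext ?_ ?_
      · change vf (f • X) * p.1 = f • (vf X * p.1)
        rw [map_smul, smul_mul_assoc]
      · change p.1 • D (f • X) - vf (A := A) (f • X) • p.2 =
          f • (p.1 • D X - vf (A := A) X • p.2) + grade (vf X * p.1) • c f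
        rw [hD, map_smul, grade_vf_mul, smul_sub, smul_sub, ← mul_smul, mul_vf, neg_smul,
          smul_assoc, smul_comm p.1 f]
        abel)
    (fun X p q => by
      refine Prod.ext ?_ ?_
      · change vf X * (p.1 + q.1) = vf X * p.1 + vf X * q.1
        rw [mul_add]
      · change (p.1 + q.1) • D X - vf (A := A) X • (p.2 + q.2) =
          (p.1 • D X - vf (A := A) X • p.2) + (q.1 • D X - vf (A := A) X • q.2)
        rw [smul_add, add_smul]
        abel)
    (fun f X p => by
      refine Prod.ext ?_ ?_
      · change vf X * (f • p.1) = f • (vf X * p.1)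
        rw [mul_smul_comm]
      · change (f • p.1) • D X - vf (A := A) X • (f • p.2 + grade p.1 • c f) =
          f • (p.1 • D X - vf (A := A) X • p.2) + grade (vf X * p.1) • c f
        rw [grade_vf_mul, smul_sub, smul_add, ← mul_smul, neg_smul,
          smul_assoc, smul_comm _ f]
        abel)

theorem twistMul_apply (hD : ∀ (f : A) (X : L), D (f • X) = f • D X - vf (A := A) X • c f)
    (X : L) (p : Twist (A := A) (L := L) c) :
    twistMul hD X p = ((vf X * p.1, p.1 • D X - vf (A := A) X • p.2) : Λ × P) := rfl

theorem twistMul_twistMul (hD : ∀ (f : A) (X : L), D (f • X) = f • D X - vf (A := A) X • c f)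
    (X : L) (p : Twist (A := A) (L := L) c) :
    twistMul hD X (twistMul hD X p) = (0 : QuadraticForm A L) X • p := by
  have h : vf (A := A) X * vf X = 0 := ExteriorAlgebra.ι_sq_zero X
  rw [zero_apply, zero_smul]
  refine Prod.ext ?_ ?_
  · change vf X * (vf X * p.1) = 0
    rw [← mul_assoc, h, zero_mul]
  · change (vf (A := A) X * p.1) • D X - vf (A := A) X • (p.1 • D X - vf (A := A) X • p.2) = 0
    rw [smul_sub, ← mul_smul, ← mul_smul, h, zero_smul]
    abel

/-- The map `x ↦ (x, T x)`. -/
def twistFold (hD : ∀ (f : A) (X : L), D (f • X) = f • D X - vf (A := A) X • c f) :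
    Multivectors A L →ₗ[A] Twist (A := A) (L := L) c :=
  CliffordAlgebra.foldr 0 (twistMul hD) (twistMul_twistMul hD) (Twist.mk c 1 0)

theorem twistFold_vf_mul (hD : ∀ (f : A) (X : L), D (f • X) = f • D X - vf (A := A) X • c f)
    (X : L) (x : Λ) : twistFold hD (vf X * x) = twistMul hD X (twistFold hD x) := by
  unfold twistFold
  rw [vf, ExteriorAlgebra.ι, CliffordAlgebra.foldr_mul, CliffordAlgebra.foldr_ι]

theorem twistFold_algebraMap (hD : ∀ (f : A) (X : L), D (f • X) = f • D X - vf (A := A) X • c f)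
    (f : A) : twistFold hD (algebraMap A _ f) = Twist.mk c (algebraMap A Λ f) (c f) := by
  unfold twistFold
  rw [CliffordAlgebra.foldr_algebraMap]
  change Twist.mk c (f • (1 : Λ)) (f • (0 : P) + grade (1 : Λ) • c f) = _
  rw [map_one, one_smul, smul_zero, zero_add, Algebra.algebraMap_eq_smul_one]

theorem twistFold_fst (hD : ∀ (f : A) (X : L), D (f • X) = f • D X - vf (A := A) X • c f)
    (x : Λ) : (twistFold hD x).1 = x := by
  induction x using CliffordAlgebra.left_induction with
  | algebraMap r => rw [twistFold_algebraMap]; rfl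
  | add x y hx hy => rw [map_add]; exact congrArg₂ (· + ·) hx hy
  | ι_mul x Y hx =>
    change (twistFold hD (vf (A := A) Y * x)).1 = vf (A := A) Y * x
    rw [twistFold_vf_mul, twistMul_apply, hx]

/-- The extension `T` of `c` and `D` to all multivector fields. -/
def twistExtend (hD : ∀ (f : A) (X : L), D (f • X) = f • D X - vf (A := A) X • c f) :
    Multivectors A L →ₗ[ℝ] P where
  toFun x := (twistFold hD x).2
  map_add' x y := by rw [map_add]; rfl
  map_smul' r x := by
    rw [← algebraMap_smul A r x, map_smul]
    change algebraMap ℝ A r • (twistFold hD x).2 + grade (twistFold hD x).1 • c (algebraMap ℝ A r) =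
      r • (twistFold hD x).2
    rw [Derivation.map_algebraMap, smul_zero, add_zero, algebraMap_smul]

theorem extend_algebraMap (hD : ∀ (f : A) (X : L), D (f • X) = f • D X - vf (A := A) X • c f)
    (f : A) : twistExtend hD (algebraMap A _ f) = c f :=
  congrArg Prod.snd (twistFold_algebraMap hD f)

theorem extend_vf_mul (hD : ∀ (f : A) (X : L), D (f • X) = f • D X - vf (A := A) X • c f)
    (X : L) (x : Λ) : twistExtend hD (vf X * x) = x • D X - vf (A := A) X • twistExtend hD x := by
  refine (congrArg Prod.snd (twistFold_vf_mul hD X x)).trans ?_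
  rw [twistMul_apply, twistFold_fst]
  rfl

end Twist

theorem algebraMap_real_smul (r : ℝ) (f : A) : algebraMap A Λ (r • f) = r • algebraMap A Λ f := by
  rw [Algebra.algebraMap_eq_smul_one, Algebra.algebraMap_eq_smul_one, smul_assoc]

/-- The derivation `f ↦ (Y ↦ Y f)`. -/
def lieFun : Derivation ℝ A (L →ₗ[ℝ] Multivectors A L) :=
  Derivation.mk'
    (LinearMap.mk₂ ℝ (fun f X => algebraMap A Λ ⁅X, f⁆) (by simp)
      (by intro r f X; rw [lie_smul, algebraMap_real_smul]) (by simp)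
      (by intro r f X; rw [smul_lie, algebraMap_real_smul]))
    (fun f g => by
      ext X
      simp only [LinearMap.mk₂_apply, LinearMap.add_apply, LinearMap.smul_apply,
        LieRinehartRing.leibniz_mul_right, smul_eq_mul, map_add, map_mul, Algebra.smul_def]
      rw [Algebra.commutes g])

/-- The map `X ↦ (Y ↦ [X, Y])`. -/
def lieVF : L →ₗ[ℝ] L →ₗ[ℝ] Multivectors A L :=
  LinearMap.mk₂ ℝ (fun X Y => vf ⁅X, Y⁆) (by simp) (by simp) (by simp) (by simp)

theorem lieVF_smul (f : A) (X : L) :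
    (lieVF (f • X) : L →ₗ[ℝ] Multivectors A L) = f • lieVF X - vf (A := A) X • lieFun f := by
  ext Y
  change vf ⁅f • X, Y⁆ = f • vf ⁅X, Y⁆ - vf X * algebraMap A Λ ⁅Y, f⁆
  rw [lie_smul_left, map_sub, map_smul, map_smul, ← Algebra.commutes, ← Algebra.smul_def]

/-- The grade involution, as a real linear map. -/
def gradeR : Multivectors A L →ₗ[ℝ] Multivectors A L := grade.toLinearMap.restrictScalars ℝ

/-- The Lie derivative of multivector fields along vector fields: `lieDer Y` is the derivation of
the exterior algebra which is `Y` on functions and `[Y, ·]` on vector fields. -/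
def lieDer : L →ₗ[ℝ] Multivectors A L →ₗ[ℝ] Multivectors A L :=
  (twistExtend (lieVF_smul (A := A) (L := L)) ∘ₗ gradeR).flip

theorem lieDer_apply (Y : L) (x : Λ) :
    lieDer Y x = twistExtend (lieVF_smul (A := A) (L := L)) (grade x) Y := rfl

theorem lieDer_algebraMap (Y : L) (f : A) :
    lieDer Y (algebraMap A Λ f) = algebraMap A Λ ⁅Y, f⁆ := by
  rw [lieDer_apply, grade_algebraMap, extend_algebraMap]
  rfl

theorem grade_grade (x : Λ) : grade (grade x) = x := CliffordAlgebra.involute_involute x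

theorem lieDer_vf_mul (Y X : L) (x : Λ) :
    lieDer Y (vf X * x) = vf ⁅Y, X⁆ * x + vf X * lieDer Y x := by
  rw [lieDer_apply, lieDer_apply, grade_vf_mul, map_neg, extend_vf_mul]
  change -(grade x * vf ⁅X, Y⁆ - vf X * twistExtend (lieVF_smul (A := A) (L := L)) (grade x) Y) = _
  rw [mul_vf, grade_grade, ← lie_skew, map_neg]
  noncomm_ring

/-- The differential of a function, as an `A`-linear functional on vector fields. -/
def funDiff (f : A) : Module.Dual A L where
  toFun X := ⁅X, f⁆
  map_add' X Y := add_lie X Y f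
  map_smul' a X := by simp

/-- The derivation `f ↦ ι_{df}` of functions, where `ι_{df}` contracts multivector fields with the
differential of `f`. -/
def contractDiff : Derivation ℝ A (Multivectors A L →ₗ[ℝ] Multivectors A L) :=
  Derivation.mk'
    { toFun := fun f => (CliffordAlgebra.contractLeft (Q := (0 : QuadraticForm A L)) (funDiff f)).restrictScalars ℝ
      map_add' := fun f g => by
        have : (funDiff (f + g) : Module.Dual A L) = funDiff f + funDiff g := by ext X; simp [funDiff]
        rw [this, map_add]
        rfl
      map_smul' := fun r f => by
        have : (funDiff (r • f) : Module.Dual A L) = algebraMap ℝ A r • funDiff f := by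
          ext X
          change ⁅X, r • f⁆ = algebraMap ℝ A r * ⁅X, f⁆
          rw [lie_smul, Algebra.smul_def]
        rw [this, map_smul]
        ext x
        simp }
    (fun f g => by
        have : (funDiff (f * g) : Module.Dual A L) = f • funDiff g + g • funDiff f := by ext X; simp [funDiff, mul_comm]
        ext x
        simp [this])

theorem lieDer_smul (f : A) (X : L) :
    (lieDer (f • X) : Multivectors A L →ₗ[ℝ] Multivectors A L) = f • lieDer X - vf (A := A) X • contractDiff f := by
  ext x
  change lieDer (f • X) x = f • lieDer X x - vf X * CliffordAlgebra.contractLeft (funDiff f) x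
  induction x using CliffordAlgebra.left_induction with
  | algebraMap r =>
    erw [lieDer_algebraMap, lieDer_algebraMap]
    simp [Algebra.smul_def]
  | add x y hx hy => rw [map_add, map_add, map_add, hx, hy, smul_add, mul_add]; abel
  | ι_mul x Y hx =>
    rw [CliffordAlgebra.contractLeft_ι_mul]
    change lieDer (f • X) (vf Y * x) = f • lieDer X (vf Y * x) - vf X * (⁅Y, f⁆ • x - vf Y * _)
    rw [lieDer_vf_mul, lieDer_vf_mul, hx, lie_smul_left]
    have h : vf (A := A) X * vf Y = - (vf Y * vf X) :=
      eq_neg_of_add_eq_zero_left (ExteriorAlgebra.ι_add_mul_swap X Y)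
    rw [map_sub, map_smul, map_smul, sub_mul, smul_mul_assoc, smul_mul_assoc, mul_sub, mul_sub,
      smul_add, mul_smul_comm, mul_smul_comm]
    have h' : ∀ z : Λ, vf (A := A) X * (vf Y * z) = - (vf Y * (vf X * z)) := fun z => by
      rw [← mul_assoc, h, neg_mul, mul_assoc]
    erw [h']
    abel

/-- The Schouten bracket `ν` of multivector fields, in its graded symmetric form of degree `-1`
(with respect to the degree `n` of elements of `⋀ⁿ L`):
`ν(X_1 ⋯ X_n, y) = ∑_i (-1)^(i-1) X_1 ⋯ X̂_i ⋯ X_n (L_{X_i} y)` for vector fields `X_i`, and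
`ν(f, y) = ι_{df} y` for functions `f`. Thus
`ν(X_1 ⋯ X_n, Y_1 ⋯ Y_m) =
  (-1)^(n-1) ∑_{i,j} (-1)^(i+j) [X_i, Y_j] X_1 ⋯ X̂_i ⋯ X_n Y_1 ⋯ Ŷ_j ⋯ Y_m`. -/
def schouten : Multivectors A L →ₗ[ℝ] Multivectors A L →ₗ[ℝ] Multivectors A L :=
  twistExtend lieDer_smul

theorem lie_one (X : L) : ⁅X, (1 : A)⁆ = 0 := by
  have := LieRinehartRing.leibniz_mul_right X (1 : A) 1
  simpa only [mul_one, smul_eq_mul, one_mul, left_eq_add] using this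

theorem schouten_algebraMap (f : A) (y : Λ) :
    schouten (algebraMap A Λ f) y = CliffordAlgebra.contractLeft (funDiff f) y := by
  rw [schouten, extend_algebraMap]
  rfl

theorem schouten_vf_mul (X : L) (x y : Λ) :
    schouten (vf X * x) y = x * lieDer X y - vf X * schouten x y := by
  rw [schouten, extend_vf_mul]
  rfl

theorem schouten_vf (X : L) (y : Λ) : schouten (vf X) y = lieDer X y := by
  have h := schouten_vf_mul X (1 : Λ) y
  have h0 : (funDiff (1 : A) : Module.Dual A L) = 0 := by
    ext X
    exact lie_one X
  rw [mul_one, one_mul, ← map_one (algebraMap A Λ), schouten_algebraMap, h0] at h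
  simpa using h

theorem schouten_vf_vf (X Y : L) : schouten (vf X : Λ) (vf Y) = vf ⁅X, Y⁆ := by
  have h1 : lieDer X (1 : Λ) = 0 := by
    rw [← map_one (algebraMap A Λ), lieDer_algebraMap, lie_one, map_zero]
  have h := lieDer_vf_mul X Y (1 : Λ)
  rw [schouten_vf]
  simpa [h1] using h

/-- The exterior derivative on the space of all forms. -/
def extDeriv : Forms A L →ₗ[ℝ] Forms A L where
  toFun α
    | 0 => 0
    | n + 1 => dForm n (α n)
  map_add' α β := by
    funext n
    cases n <;> simp
  map_smul' r α := by
    funext n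
    cases n <;> simp

end Forms

/-! ### `L∞`-algebras -/

section LInfinity
variable {W : Type*} [AddCommGroup W] [Module ℝ W]

/-- The Koszul sign of the permutation `σ` acting on homogeneous elements of degrees
`e 0, …, e (n - 1)`: the product of `(-1) ^ (e (σ a) * e (σ b))` over the inversions `a < b`,
`σ b < σ a` of `σ`. -/
def koszulSign {n : ℕ} (e : Fin n → ℤ) (σ : Equiv.Perm (Fin n)) : ℤˣ :=
  ∏ p : Fin n × Fin n with p.1 < p.2 ∧ σ p.2 < σ p.1, Int.negOnePow (e (σ p.1) * e (σ p.2))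

/-- The `(p, q)`-unshuffles: permutations of `p + q` letters which are increasing on the first `p`
letters and on the last `q` letters. -/
def unshuffles (p q : ℕ) : Finset (Equiv.Perm (Fin (p + q))) :=
  {σ | StrictMono (fun a : Fin p => σ (Fin.castAdd q a)) ∧
    StrictMono (fun b : Fin q => σ (Fin.natAdd p b))}

/-- The composite of `l (q + 1)` with `l p`: the value of
`∑_σ ε(σ) l_{q+1}(l_p(v_{σ(1)}, …, v_{σ(p)}), v_{σ(p+1)}, …, v_{σ(p+q)})`, summed over the
`(p, q)`-unshuffles, on homogeneous elements `v` of degrees `e`. -/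
def bracketComp (l : ∀ n : ℕ, MultilinearMap ℝ (fun _ : Fin n => W) W) (p q : ℕ)
    (e : Fin (p + q) → ℤ) (v : Fin (p + q) → W) : W :=
  ∑ σ ∈ unshuffles p q, koszulSign e σ •
    l (q + 1) (Fin.cons (l p fun a => v (σ (Fin.castAdd q a))) fun b => v (σ (Fin.natAdd p b)))

/-- The family of subspaces `𝒱 k` (`k : ℤ`) of `W` is independent, so that `⨁ k, 𝒱 k` is a graded
vector space, and the multilinear maps `l n`, `n ≥ 1`, make it an `L∞`-algebra: the grading is
concentrated in positive degrees, every `l n` has degree `-1` and is graded symmetric, and the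
(generalized) Jacobi identities `∑_{i + j = n + 1} l_j ∘ l_i = 0` hold for all `n ≥ 1`. (The maps
may be defined on all of `W`; only their restrictions to the subspaces `𝒱 k` matter.) -/
structure IsLInfinityAlgebra (𝒱 : ℤ → Submodule ℝ W)
    (l : ∀ n : ℕ, MultilinearMap ℝ (fun _ : Fin n => W) W) : Prop where
  graded : iSupIndep 𝒱
  positive : ∀ k ≤ 0, 𝒱 k = ⊥
  degree : ∀ n ≥ 1, ∀ (e : Fin n → ℤ) (v : Fin n → W), (∀ a, v a ∈ 𝒱 (e a)) →
    l n v ∈ 𝒱 (∑ a, e a - 1)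
  symmetric : ∀ n ≥ 1, ∀ (e : Fin n → ℤ) (v : Fin n → W), (∀ a, v a ∈ 𝒱 (e a)) →
    ∀ σ : Equiv.Perm (Fin n), koszulSign e σ • l n (v ∘ σ) = l n v
  jacobi : ∀ n ≥ 1, ∀ (e : Fin n → ℤ) (v : Fin n → W), (∀ a, v a ∈ 𝒱 (e a)) →
    ∑ i : Fin n, bracketComp l (i + 1) (n - (i + 1))
      (fun a => e (Fin.cast (by omega) a)) (fun a => v (Fin.cast (by omega) a)) = 0

/-- The graded subspace `𝒮` is an `L∞`-subalgebra of `(𝒱, l)`. -/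
structure IsLInfinitySubalgebra (𝒮 𝒱 : ℤ → Submodule ℝ W)
    (l : ∀ n : ℕ, MultilinearMap ℝ (fun _ : Fin n => W) W) : Prop where
  le : ∀ k, 𝒮 k ≤ 𝒱 k
  closed : ∀ n ≥ 1, ∀ (e : Fin n → ℤ) (v : Fin n → W), (∀ a, v a ∈ 𝒮 (e a)) →
    l n v ∈ 𝒮 (∑ a, e a - 1)

end LInfinity

/-! ### The bigraded space of Hamiltonian pairs and form columns -/

section Pairs
variable {A L : Type*} [CommRing A] [Algebra ℝ A] [LieRing L] [LieAlgebra ℝ L] [Module A L]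
  [LieRingModule L A] [LieRinehartRing A L] [LieRinehartAlgebra ℝ A L]

/-- The forms of degree `p`, as a subspace of the space of all forms. -/
def homForms (A L : Type*) [CommRing A] [Algebra ℝ A] [AddCommGroup L] [Module A L] (p : ℕ) :
    Submodule ℝ (Forms A L) :=
  LinearMap.range (LinearMap.single ℝ (fun n => Form A L n) p)

/-- An `n`-form as an element of the space of all forms. -/
def Form.total {n : ℕ} (α : Form A L n) : Forms A L := Pi.single n α

variable {m : ℕ} (ω : Form A L (m + 1))

/-- Pairs `(x, α)` of a multivector field of degree `k` and a form of degree `p` with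
`ι_x ω = dα`. For `k + p = m` these are the Hamiltonian pairs of degree `k`. -/
def hamiltonianPairs (k p : ℕ) : Submodule ℝ (Multivectors A L × Forms A L) where
  carrier := {z | z.1 ∈ ⋀[A]^k L ∧ z.2 ∈ homForms A L p ∧ contract z.1 ω.total = extDeriv z.2}
  add_mem' := by
    rintro x y ⟨h1, h2, h3⟩ ⟨h1', h2', h3'⟩
    refine ⟨add_mem h1 h1', add_mem h2 h2', ?_⟩
    rw [Prod.fst_add, Prod.snd_add, map_add, map_add, LinearMap.add_apply, h3, h3']
  zero_mem' := ⟨zero_mem _, zero_mem _, by simp⟩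
  smul_mem' := by
    rintro r x ⟨h1, h2, h3⟩
    refine ⟨?_, Submodule.smul_mem _ r h2, ?_⟩
    · rw [Prod.smul_fst, ← algebraMap_smul A r x.1]
      exact Submodule.smul_mem _ _ h1
    · rw [Prod.smul_fst, Prod.smul_snd, ← algebraMap_smul A r x.1, map_smul, map_smul,
        LinearMap.smul_apply, h3, algebraMap_smul]

/-- The component `Ξ̃_i^j` of bidegree `(i, j)`: for `i = 1` the Hamiltonian pairs `(x, α)` with
`x` of degree `j + 1` and `α` of degree `m - 1 - j`; for `i ≥ 2` the forms of degree `m - i - j`,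
placed in the second factor. It vanishes for `i = 0` and for `i + j > m`. -/
def component : ℕ → ℕ → Submodule ℝ (Multivectors A L × Forms A L)
  | 0, _ => ⊥
  | 1, j => if 1 + j ≤ m then hamiltonianPairs ω (j + 1) (m - (1 + j)) else ⊥
  | i + 2, j => if i + 2 + j ≤ m then Submodule.prod ⊥ (homForms A L (m - (i + 2 + j))) else ⊥

/-- The space in which the graded pieces of `Ξ̃` live: a function of the bidegree `(i, j)`, whose
values are pairs of a multivector field and a form. -/
abbrev Ambient (A L : Type*) [CommRing A] [AddCommGroup L] [Module A L] : Type _ :=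
  ℕ × ℕ → Multivectors A L × Forms A L

/-- Families whose entry at `(i, j)` lies in `Ξ̃_i^j` and vanishes unless `P i j`. -/
def pairsOn (P : ℕ → ℕ → Prop) : Submodule ℝ (Ambient A L) where
  carrier := {w | ∀ i j, w (i, j) ∈ component ω i j ∧ (¬ P i j → w (i, j) = 0)}
  add_mem' := fun {w w'} h h' i j =>
    ⟨add_mem (h i j).1 (h' i j).1, fun hP => by
      rw [Pi.add_apply, (h i j).2 hP, (h' i j).2 hP, add_zero]⟩
  zero_mem' := fun _ _ => ⟨zero_mem _, fun _ => rfl⟩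
  smul_mem' := fun r w h i j =>
    ⟨Submodule.smul_mem _ r (h i j).1, fun hP => by rw [Pi.smul_apply, (h i j).2 hP, smul_zero]⟩

/-- The degree `k` part `Ξ̃_k = ⨁_{i + j = k} Ξ̃_i^j` of the graded vector space `Ξ̃`. -/
def pairs (k : ℤ) : Submodule ℝ (Ambient A L) := pairsOn ω fun i j => (i + j : ℤ) = k

/-- The elements of `Ξ̃` of bidegree `(p, q)`. -/
def bihomogeneous (p q : ℤ) : Submodule ℝ (Ambient A L) :=
  pairsOn ω fun i j => (i : ℤ) = p ∧ (j : ℤ) = q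

/-- The degree `k` part of the base row `j = 0` of `Ξ̃`. -/
def baseRow (k : ℤ) : Submodule ℝ (Ambient A L) := pairsOn ω fun i j => (i : ℤ) = k ∧ j = 0

/-- The unary bracket: `-d` from the column `i + 1` to the column `i`, for `i ≥ 1`
(with values in `0 × Ω`). -/
def unaryBracket : Ambient A L →ₗ[ℝ] Ambient A L where
  toFun w p := if 1 ≤ p.1 then (0, - extDeriv (w (p.1 + 1, p.2)).2) else 0
  map_add' w w' := by
    funext p
    by_cases h : 1 ≤ p.1 <;> simp [h, add_comm]
  map_smul' r w := by
    funext p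
    by_cases h : 1 ≤ p.1 <;> simp [h]

/-- The Schouten bracket as a multilinear map. -/
def schoutenMultilinear : MultilinearMap ℝ (fun _ : Fin 2 => Multivectors A L) (Multivectors A L) where
  toFun x := schouten (x 0) (x 1)
  map_update_add' := fun {dec} x i y z => by
    rw [Subsingleton.elim dec (instDecidableEqFin _)]
    fin_cases i <;> simp
  map_update_smul' := fun {dec} x i r y => by
    rw [Subsingleton.elim dec (instDecidableEqFin _)]
    fin_cases i <;> simp

/-- The map `(x_1, …, x_n) ↦ ι_{x_1 ⋯ x_n} ω`. -/
def contractOmega (n : ℕ) : MultilinearMap ℝ (fun _ : Fin n => Multivectors A L) (Forms A L) :=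
  LinearMap.compMultilinearMap
    { toFun := fun x => contract x ω.total
      map_add' := fun x y => by rw [map_add, LinearMap.add_apply]
      map_smul' := fun r x => by
        rw [← algebraMap_smul A r x, map_smul, LinearMap.smul_apply, algebraMap_smul,
          RingHom.id_apply] }
    (MultilinearMap.mkPiAlgebraFin ℝ n (Multivectors A L))

/-- The value of the `n`-ary bracket, `n ≥ 2`, on Hamiltonian pairs, in terms of their multivector
field parts: `(ν(x_1, x_2), ι_{x_1 x_2} ω)` for `n = 2`, and `ι_{x_1 ⋯ x_n} ω` for `n ≥ 3`. -/
def pairBracket : ∀ n : ℕ,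
    MultilinearMap ℝ (fun _ : Fin n => Multivectors A L) (Multivectors A L × Forms A L)
  | 2 => schoutenMultilinear.prod (contractOmega ω 2)
  | n => MultilinearMap.prod 0 (contractOmega ω n)

/-- The multivector field part of the entry in bidegree `(1, j)`. -/
def columnOne (j : ℕ) : Ambient A L →ₗ[ℝ] Multivectors A L :=
  LinearMap.fst ℝ _ _ ∘ₗ LinearMap.proj (1, j)

/-- The brackets of `Ξ̃`: `l 1 = -d` on the columns `i ≥ 2`, and for `n ≥ 2` the only non-zero
bracket is that of `n` elements of the column `i = 1`, of bidegrees `(1, j_1), …, (1, j_n)`, with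
values in bidegree `(n - 1, j_1 + ⋯ + j_n)` (it is zero if there is no such component). -/
def pairsBracket : ∀ n : ℕ, MultilinearMap ℝ (fun _ : Fin n => Ambient A L) (Ambient A L)
  | 0 => 0
  | 1 => unaryBracket.compMultilinearMap
      (MultilinearMap.ofSubsingleton ℝ (Ambient A L) (Ambient A L) (0 : Fin 1) LinearMap.id)
  | n + 2 => MultilinearMap.pi fun p =>
      if p.1 = n + 1 ∧ p.1 + p.2 ≤ m then
        ∑ js ∈ Finset.Nat.antidiagonalTuple (n + 2) p.2,
          (pairBracket ω (n + 2)).compLinearMap fun a => columnOne (js a)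
      else 0

/-! ### The Poisson Lie `m`-algebra -/

/-- The pairs `(v, α)` of a vector field and a form of degree `p` with `ι_v ω = -dα`. -/
def poissonPairs (p : ℕ) : Submodule ℝ (L × Forms A L) where
  carrier := {z | z.2 ∈ homForms A L p ∧ contractVF z.1 ω.total = - extDeriv z.2}
  add_mem' := by
    rintro x y ⟨h1, h2⟩ ⟨h1', h2'⟩
    exact ⟨add_mem h1 h1', by
      rw [Prod.fst_add, Prod.snd_add, map_add, map_add, LinearMap.add_apply, h2, h2', neg_add]⟩
  zero_mem' := ⟨zero_mem _, by simp⟩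
  smul_mem' := by
    rintro r x ⟨h1, h2⟩
    exact ⟨Submodule.smul_mem _ r h1, by
      rw [Prod.smul_fst, Prod.smul_snd, ← algebraMap_smul A r x.1, map_smul, map_smul,
        LinearMap.smul_apply, h2, algebraMap_smul, smul_neg]⟩

/-- The degree `k` part of the Poisson Lie `m`-algebra, `0 ≤ k ≤ m - 1`: in degree `0` pairs
`(v, α)` of a vector field and an `(m - 1)`-form with `ι_v ω = -dα`, in degree `k ≥ 1` forms of
degree `m - 1 - k`, placed in the second factor. -/
def poissonLie (k : ℤ) : Submodule ℝ (L × Forms A L) :=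
  if k = 0 ∧ 1 ≤ m then poissonPairs ω (m - 1)
  else if 1 ≤ k ∧ k + 1 ≤ m then Submodule.prod ⊥ (homForms A L (m - 1 - k.toNat))
  else ⊥

/-- The brackets of the Poisson Lie `m`-algebra (graded antisymmetric, the `n`-ary bracket having
degree `n - 2`): the unary bracket is `d` on forms of degree at most `m - 2` and zero on the pairs,
the binary one is `([v_1, v_2], ι_{v_2} ι_{v_1} ω)`, and for `n ≥ 3` the `n`-ary one is
`-(-1) ^ (n (n + 1) / 2) ι_{v_n} ⋯ ι_{v_1} ω`, depending on the vector field parts only. -/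
def poissonLieBracket : ∀ n : ℕ, (Fin n → L × Forms A L) → L × Forms A L
  | 0, _ => 0
  | 1, z => (0, fun p => if p + 1 ≤ m then extDeriv (z 0).2 p else 0)
  | 2, z => (⁅(z 0).1, (z 1).1⁆, contractVF (z 1).1 (contractVF (z 0).1 ω.total))
  | n + 3, z => (0, (-(-1 : ℝ) ^ ((n + 3) * (n + 4) / 2)) •
      contract (List.ofFn fun a => vf (z a).1).reverse.prod ω.total)

/-- The inclusion of the Poisson Lie `m`-algebra in `Ξ̃`, of degree one: a pair `(v, α)` goes to
the Hamiltonian pair `(v, -α)` in bidegree `(1, 0)`, a form `α` of degree `m - i` with `i ≥ 2` goes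
to `-α` in bidegree `(i, 0)`. -/
def poissonLieInclusion (A L : Type*) [CommRing A] [Algebra ℝ A] [LieRing L] [LieAlgebra ℝ L]
    [Module A L] [LieRingModule L A] [LieRinehartRing A L] [LieRinehartAlgebra ℝ A L] (m : ℕ) :
    L × Forms A L →ₗ[ℝ] Ambient A L where
  toFun z p := if 1 ≤ p.1 ∧ p.1 ≤ m ∧ p.2 = 0 then
      (if p.1 = 1 then vf z.1 else 0, - Form.total (z.2 (m - p.1)))
    else 0
  map_add' z z' := by
    funext p
    rw [Pi.add_apply]
    split_ifs <;> simp [Form.total, Pi.single_add, add_comm]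
  map_smul' r z := by
    funext p
    rw [Pi.smul_apply]
    split_ifs <;> simp [Form.total, Pi.single_smul]

end Pairs

end PreSymplectic
end

noncomputable section
namespace PreSymplectic

/-! ### Cartan calculus -/

section Cartan
variable {A L : Type*} [CommRing A] [Algebra ℝ A] [LieRing L] [LieAlgebra ℝ L] [Module A L]
  [LieRingModule L A] [LieRinehartRing A L] [LieRinehartAlgebra ℝ A L]

/-! Everything rests on one identity. Let `ω` be closed and let all `ι_{x_a} ω` be closed, as they
are for Hamiltonian pairs, being exact. Then `d ι_{x_1 ⋯ x_n} ω` is the contraction of `ω` with the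
sum over `a < b` of `± ν(x_a, x_b) x_1 ⋯ x̂_a ⋯ x̂_b ⋯ x_n` (`extDeriv_contractR_prod`). For two
factors it says that `(ν(x_1, x_2), ι_{x_1 x_2} ω)` is again a Hamiltonian pair, so that the binary
bracket is well defined. For `n ≥ 3` factors it is the form part of the `n`-th Jacobi identity.

Indeed, brackets of arity at least two see only the multivector parts in the column `i = 1`. The
bracket `l_1` has values with zero multivector part, and `l_n` with `n ≥ 3` has values in columns `i
≥ 2`. Hence for `n ≥ 3` only two kinds of composites survive: `l_1 l_n`, which is `- d ι_{x_1 ⋯ x_n}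
ω`, and `l_{n-1}` applied to an `l_2`, summed over (2, n-2)-unshuffles, which is the right side of
the identity. For `n = 3` there is also a multivector part, the graded Jacobi identity of `ν`
(`schouten_schouten`). The cases `n = 1, 2` use `d² = 0` and the vanishing of `l_1` on the first
column. The Koszul signs are those of the exterior algebra, since an element of bidegree `(1, j)`
has total degree `j + 1`, the degree of its multivector field.

The identity is iterated from the case of two factors, where `ι_{ν(x, y)}` is an iterated graded
commutator of `d`, `ι_x` and `ι_y` (`contractR_schouten`). This follows from Cartan calculus for
vector fields by induction on the number of vector fields in a product.

On the base row the multivector fields are vector fields. The comparison with the Poisson Lie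
`m`-algebra is then a matter of signs: reversing `ι_{v_n} ⋯ ι_{v_1}` costs `(-1)^(n(n-1)/2)`, and
together with the sign in `l^P_n` and the one in `F` this leaves `(-1)^n`. -/

theorem contractVF_apply (X : L) (α : Forms A L) (n : ℕ) (w : Fin n → L) :
    contractVF X α n w = α (n + 1) (Fin.cons X w) := rfl

theorem extDeriv_zero_deg (α : Forms A L) : extDeriv α 0 = 0 := rfl

theorem extDeriv_succ (α : Forms A L) (n : ℕ) : extDeriv α (n + 1) = dForm n (α n) := rfl

theorem dForm_zero_apply (f : Form A L 0) (v : Fin 1 → L) : dForm 0 f v = ⁅v 0, f ![]⁆ := rfl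

theorem dForm_succ_apply {n : ℕ} (α : Form A L (n + 1)) (v : Fin (n + 2) → L) :
    dForm (n + 1) α v = koszul α v := rfl

/-- The Lie derivative of forms along a vector field. -/
def lieForm (X : L) : Forms A L →ₗ[ℝ] Forms A L where
  toFun α := contractVF X (extDeriv α) + extDeriv (contractVF X α)
  map_add' α β := by simp only [map_add]; abel
  map_smul' r α := by
    have h (β : Forms A L) : contractVF X (r • β) = r • contractVF X β := by
      exact LinearMap.map_smul_of_tower (contractVF X) r β
    rw [map_smul, h, h, map_smul, smul_add, RingHom.id_apply]

theorem lieForm_apply (X : L) (α : Forms A L) :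
    lieForm X α = contractVF X (extDeriv α) + extDeriv (contractVF X α) := rfl

theorem lieForm_zero_deg (X : L) (α : Forms A L) (w : Fin 0 → L) :
    lieForm X α 0 w = ⁅X, α 0 w⁆ := by
  have hw : w = ![] := Subsingleton.elim _ _
  subst hw
  change dForm 0 (α 0) (Fin.cons X ![]) + extDeriv (contractVF X α) 0 ![] = _
  rw [extDeriv_zero_deg, dForm_zero_apply]
  simp

/-- Isolates the terms of the Koszul formula in which `X` differentiates or is bracketed. In the
remaining ones `X` stays an argument of the form; up to sign these are the terms of `d ι_X`, and
they cancel in Cartan's formula. -/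
theorem koszul_cons {n : ℕ} (ω : Form A L (n + 1)) (X : L) (w : Fin (n + 1) → L) :
    koszul ω (Fin.cons X w : Fin (n + 2) → L) =
      (⁅X, ω w⁆ + ∑ j : Fin (n + 1), (-1) ^ (j + 1 : ℕ) * ⁅w j, ω (Fin.cons X (j.removeNth w))⁆) -
      (∑ j : Fin (n + 1), (-1) ^ (j : ℕ) * ω (Fin.cons ⁅X, w j⁆ (j.removeNth w)) +
        ∑ i : Fin n, ∑ j ≥ i.succ, (-1) ^ (i + 1 + j : ℕ) *
          ω (Fin.cons ⁅w i.castSucc, w j⁆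
            (j.removeNth (i.castSucc.succ.removeNth (Fin.cons X w : Fin (n + 2) → L))))) := by
  unfold koszul
  congr 1
  · rw [Fin.sum_univ_succ]
    simp only [removeNth_zero_cons, removeNth_succ_cons, Fin.cons_zero, Fin.cons_succ,
      Fin.val_zero, Fin.val_succ, pow_zero, one_mul]
  · rw [Fin.sum_univ_succ]
    have : Finset.Ici (0 : Fin (n + 1)) = Finset.univ := by ext; simp
    simp only [Fin.castSucc_zero, removeNth_zero_cons, Fin.cons_zero, Fin.cons_succ, this,
      Fin.val_zero, Fin.val_succ, zero_add, Matrix.vecCons, ← Fin.succ_castSucc]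

theorem Form.cons_cons_swap {n : ℕ} (ω : Form A L (n + 2)) (X Y : L) (w : Fin n → L) :
    ω (Fin.cons X (Fin.cons Y w : Fin (n + 1) → L)) =
      - ω (Fin.cons Y (Fin.cons X w : Fin (n + 1) → L)) := by
  rw [← AlternatingMap.map_swap ω _ (i := 0) (j := 1) (by simp)]
  congr 1
  ext k
  refine Fin.cases ?_ (fun k => Fin.cases ?_ (fun k => ?_) k) k
  · simp
  · simp
  · rw [Function.comp_apply, Equiv.swap_apply_of_ne_of_ne (Fin.succ_ne_zero _)
      (by rw [← Fin.succ_zero_eq_one]; exact fun h => Fin.succ_ne_zero _ (Fin.succ_injective _ h))]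
    rfl

theorem sum_Ici_succ {B : Type*} [AddCommMonoid B] {n : ℕ} (i : Fin n) (f : Fin (n + 1) → B) :
    ∑ j ≥ i.succ, f j = ∑ j ≥ i, f j.succ := by
  have h : Finset.Ici i.succ = (Finset.Ici i).map (Fin.succEmb n) := by
    ext k
    refine Fin.cases ?_ (fun k => ?_) k <;> simp
  rw [h, Finset.sum_map]
  rfl

/-- In `ι_X d α + d ι_X α` all terms with `X` as an untouched argument cancel in pairs. What is left
is a formula with a single sum, so the commutation relations below need no further work with double
sums. -/
theorem lieForm_succ_deg (X : L) (α : Forms A L) (n : ℕ) (w : Fin (n + 1) → L) :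
    lieForm X α (n + 1) w = ⁅X, α (n + 1) w⁆ -
      ∑ j : Fin (n + 1), (-1) ^ (j : ℕ) * α (n + 1) (Fin.cons ⁅X, w j⁆ (j.removeNth w)) := by
  have h1 : lieForm X α (n + 1) w = koszul (α (n + 1)) (Fin.cons X w : Fin (n + 2) → L) +
      dForm n (contractVF X α n) w := rfl
  rw [h1, koszul_cons]
  cases n with
  | zero =>
    rw [dForm_zero_apply]
    simp only [Fin.sum_univ_succ, Finset.univ_eq_empty, Finset.sum_empty]
    have : (Fin.removeNth 0 w : Fin 0 → L) = ![] := Subsingleton.elim _ _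
    simp [contractVF_apply, this]
    ring
  | succ n =>
    rw [dForm_succ_apply, koszul]
    have h2 : ∀ i : Fin (n + 1), ∑ j ≥ i.succ, (-1 : A) ^ (i + 1 + j : ℕ) *
          α (n + 2) (Fin.cons ⁅w i.castSucc, w j⁆
            (j.removeNth (i.castSucc.succ.removeNth (Fin.cons X w : Fin (n + 3) → L)))) =
        - ∑ j ≥ i, (-1) ^ (i + j : ℕ) * contractVF X α (n + 1)
          (Matrix.vecCons ⁅w i.castSucc, w j.succ⁆ (j.removeNth (i.castSucc.removeNth w))) := by
      intro i
      rw [sum_Ici_succ, ← Finset.sum_neg_distrib]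
      refine Finset.sum_congr rfl fun j _ => ?_
      simp only [removeNth_succ_cons, contractVF_apply, Matrix.vecCons]
      rw [Form.cons_cons_swap, Fin.val_succ]
      ring
    have h3 : ∑ j : Fin (n + 2), (-1 : A) ^ (j + 1 : ℕ) *
        ⁅w j, α (n + 2) (Fin.cons X (j.removeNth w))⁆ = - ∑ j : Fin (n + 2), (-1 : A) ^ (j : ℕ) *
        ⁅w j, contractVF X α (n + 1) (j.removeNth w)⁆ := by
      rw [← Finset.sum_neg_distrib]
      refine Finset.sum_congr rfl fun j _ => ?_
      rw [contractVF_apply, pow_succ]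
      ring
    rw [Finset.sum_congr rfl fun i _ => h2 i, h3, Finset.sum_neg_distrib]
    ring

/-- Forms of positive degree agree if their contractions with all vector fields do. -/
theorem Forms.ext_contract {α β : Forms A L} (n : ℕ)
    (h : ∀ X : L, contractVF X α n = contractVF X β n) : α (n + 1) = β (n + 1) := by
  ext v
  rw [← Fin.cons_self_tail v]
  exact congrArg (fun γ => γ (Fin.tail v)) (h (v 0))

/-- When `L_X α` is evaluated on `Y` and `w`, the term of index zero is the contraction with `[X,
Y]`. In the others `Y` is exchanged with `[X, w_i]`, and the sign this costs makes up for the shift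
of the index. -/
theorem contractVF_lieForm (X Y : L) (α : Forms A L) :
    contractVF Y (lieForm X α) = lieForm X (contractVF Y α) - contractVF ⁅X, Y⁆ α := by
  funext n
  ext w
  rw [contractVF_apply, lieForm_succ_deg, Fin.sum_univ_succ]
  simp only [Fin.cons_zero, Fin.cons_succ, Fin.val_zero, Fin.val_succ, pow_zero, one_mul,
    Pi.sub_apply, AlternatingMap.sub_apply, contractVF_apply]
  cases n with
  | zero =>
    rw [lieForm_zero_deg, contractVF_apply]
    simp
  | succ n =>
    rw [lieForm_succ_deg]
    simp only [contractVF_apply, removeNth_zero_cons, removeNth_succ_cons]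
    have (i : Fin (n + 1)) : (-1 : A) ^ (i + 1 : ℕ) * α (n + 1 + 1) (Fin.cons ⁅X, w i⁆
          (Fin.cons Y (i.removeNth w) : Fin (n + 1) → L)) = (-1 : A) ^ (i : ℕ) *
          α (n + 1 + 1) (Fin.cons Y (Fin.cons ⁅X, w i⁆ (i.removeNth w) : Fin (n + 1) → L)) := by
      rw [Form.cons_cons_swap, pow_succ]
      ring
    rw [Finset.sum_congr rfl fun i _ => this i]
    ring

theorem contractVF_extDeriv (X : L) (α : Forms A L) :
    contractVF X (extDeriv α) = lieForm X α - extDeriv (contractVF X α) := by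
  rw [lieForm_apply, add_sub_cancel_right]

/-- Contracting with `Z` lowers the degree, and the extra contractions with brackets match by the
Jacobi identity. In degree zero this is the action of vector fields on functions. -/
theorem lieForm_lieForm (X Y : L) (α : Forms A L) :
    lieForm X (lieForm Y α) - lieForm Y (lieForm X α) = lieForm ⁅X, Y⁆ α := by
  funext n
  induction n generalizing α with
  | zero =>
    ext w
    simp only [Pi.sub_apply, AlternatingMap.sub_apply, lieForm_zero_deg]
    rw [lie_lie]
  | succ n ih =>
    refine Forms.ext_contract n fun Z => ?_
    rw [map_sub]
    simp only [contractVF_lieForm, map_sub]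
    have h := ih (contractVF Z α)
    simp only [Pi.sub_apply] at h ⊢
    rw [← h, lie_lie X Y Z, map_sub, LinearMap.sub_apply, Pi.sub_apply]
    abel

/-- By Cartan's formula, the difference of the two sides contracted with `Z` consists of `[L_X, L_Z]
- L_[X,Z]`, which vanishes, and of the same assertion for `ι_Z α` in one degree less. -/
theorem lieForm_extDeriv (X : L) (α : Forms A L) :
    lieForm X (extDeriv α) = extDeriv (lieForm X α) := by
  funext n
  induction n generalizing α with
  | zero =>
    ext w
    rw [lieForm_zero_deg, extDeriv_zero_deg, extDeriv_zero_deg]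
    simp
  | succ n ih =>
    refine Forms.ext_contract n fun Z => ?_
    rw [contractVF_lieForm]
    simp only [contractVF_extDeriv, contractVF_lieForm, map_sub, Pi.sub_apply]
    rw [ih, ← lieForm_lieForm]
    simp only [Pi.sub_apply]
    abel

/-- Cartan's formula and `L_Z d = d L_Z` give `ι_Z d² = d² ι_Z`, and contraction lowers the degree.
-/
theorem extDeriv_extDeriv (α : Forms A L) : extDeriv (extDeriv α) = 0 := by
  funext n
  induction n generalizing α with
  | zero => rfl
  | succ n ih =>
    refine Forms.ext_contract n fun Z => ?_
    rw [contractVF_extDeriv, lieForm_extDeriv, contractVF_extDeriv, map_sub, sub_sub_cancel, ih,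
      map_zero]

/-! ### Homogeneous forms inside the space of all forms -/

theorem Form.total_apply_same {n : ℕ} (α : Form A L n) : α.total n = α := Pi.single_eq_same n α

theorem Form.total_apply_of_ne {n k : ℕ} (α : Form A L n) (h : k ≠ n) : α.total k = 0 :=
  Pi.single_eq_of_ne h α

theorem extDeriv_total {n : ℕ} (α : Form A L n) : extDeriv α.total = (dForm n α).total := by
  funext k
  by_cases h : k = n + 1
  · subst h
    rw [Form.total_apply_same, extDeriv_succ, Form.total_apply_same]
  · rw [Form.total_apply_of_ne _ h]
    cases k with
    | zero => rfl
    | succ k => rw [extDeriv_succ, Form.total_apply_of_ne _ (by omega), map_zero]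

theorem mem_homForms {p : ℕ} {α : Forms A L} : α ∈ homForms A L p ↔ ∀ n ≠ p, α n = 0 := by
  constructor
  · rintro ⟨β, rfl⟩ n hn
    exact Pi.single_eq_of_ne hn β
  · intro h
    refine ⟨α p, ?_⟩
    funext n
    by_cases hn : n = p
    · subst hn
      exact Pi.single_eq_same n _
    · exact (Pi.single_eq_of_ne hn _).trans (h n hn).symm

theorem total_mem_homForms {p : ℕ} (α : Form A L p) : α.total ∈ homForms A L p := ⟨α, rfl⟩

theorem total_eq_self {p : ℕ} {α : Forms A L} (h : α ∈ homForms A L p) :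
    Form.total (α p) = α := by
  funext n
  by_cases hn : n = p
  · subst hn
    exact Form.total_apply_same _
  · rw [Form.total_apply_of_ne _ hn, mem_homForms.1 h n hn]

theorem extDeriv_mem_homForms {p : ℕ} {α : Forms A L} (h : α ∈ homForms A L p) :
    extDeriv α ∈ homForms A L (p + 1) := by
  rw [← total_eq_self h, extDeriv_total]
  exact total_mem_homForms _

end Cartan

/-! ### The Gerstenhaber algebra of multivector fields -/

section Gerstenhaber
variable {A L : Type*} [CommRing A] [Algebra ℝ A] [LieRing L] [LieAlgebra ℝ L] [Module A L]
  [LieRingModule L A] [LieRinehartRing A L] [LieRinehartAlgebra ℝ A L]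

local notation "Λ" => Multivectors A L

/-- The real span of the products of `p` vector fields; it is `⋀ᵖ L` for `p ≥ 1`. -/
def prodSpan (A L : Type*) [CommRing A] [Algebra ℝ A] [LieRing L] [LieAlgebra ℝ L] [Module A L]
    [LieRingModule L A] [LieRinehartRing A L] [LieRinehartAlgebra ℝ A L] :
    ℕ → Submodule ℝ (Multivectors A L)
  | 0 => Submodule.span ℝ {1}
  | p + 1 => Submodule.span ℝ {z | ∃ X : L, ∃ x ∈ prodSpan A L p, vf X * x = z}

theorem one_mem_prodSpan : (1 : Λ) ∈ prodSpan A L 0 := Submodule.mem_span_singleton_self 1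

theorem vf_mul_mem_prodSpan {p : ℕ} (X : L) {x : Λ} (hx : x ∈ prodSpan A L p) :
    vf X * x ∈ prodSpan A L (p + 1) :=
  Submodule.subset_span ⟨X, x, hx, rfl⟩

theorem vf_mem_prodSpan (X : L) : (vf X : Λ) ∈ prodSpan A L 1 := by
  simpa using vf_mul_mem_prodSpan X (one_mem_prodSpan (A := A))

/-- Real linear identities need to be checked only at `1` and passed from `x` to `X x`. Functions
never appear as separate factors, so derivations of `A` do not enter. -/
theorem prodSpan_induction {motive : ℕ → Λ → Prop} (zero : ∀ p, motive p 0) (one : motive 0 1)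
    (vf_mul : ∀ p X, ∀ x ∈ prodSpan A L p, motive p x → motive (p + 1) (vf X * x))
    (add : ∀ p x y, motive p x → motive p y → motive p (x + y))
    (smul : ∀ p (r : ℝ) x, motive p x → motive p (r • x)) {p : ℕ} {x : Λ}
    (hx : x ∈ prodSpan A L p) : motive p x := by
  induction p generalizing x with
  | zero =>
    obtain ⟨r, rfl⟩ := Submodule.mem_span_singleton.1 hx
    exact smul 0 r 1 one
  | succ p ih =>
    refine Submodule.span_induction ?_ (zero _) (fun x y _ _ => add _ x y)
      (fun r x _ => smul _ r x) hx
    rintro _ ⟨X, x, hx, rfl⟩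
    exact vf_mul p X x hx (ih hx)

theorem mul_mem_prodSpan {p q : ℕ} {x y : Λ} (hx : x ∈ prodSpan A L p) (hy : y ∈ prodSpan A L q) :
    x * y ∈ prodSpan A L (p + q) := by
  refine prodSpan_induction (motive := fun p x => x * y ∈ prodSpan A L (p + q)) ?_ ?_ ?_ ?_ ?_ hx
  · intro p
    simp
  · simpa using hy
  · intro p X x _ h
    rw [mul_assoc, add_right_comm]
    exact vf_mul_mem_prodSpan X h
  · intro p x y h h'
    rw [add_mul]
    exact add_mem h h'
  · intro p r x h
    rw [smul_mul_assoc]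
    exact Submodule.smul_mem _ r h

theorem prodSpan_le {p : ℕ} {x : Λ} (hx : x ∈ prodSpan A L p) : x ∈ ⋀[A]^p L := by
  refine prodSpan_induction (motive := fun p x => x ∈ ⋀[A]^p L) ?_ ?_ ?_ ?_ ?_ hx
  · exact fun p => zero_mem _
  · exact Submodule.one_le.1 (le_of_eq (pow_zero _).symm)
  · intro p X x _ h
    change _ ∈ (LinearMap.range (ExteriorAlgebra.ι A)) ^ (p + 1)
    rw [pow_succ']
    exact Submodule.mul_mem_mul ⟨X, rfl⟩ h
  · exact fun p x y => add_mem
  · intro p r x h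
    rw [← algebraMap_smul A r x]
    exact Submodule.smul_mem _ _ h

/-- A coefficient in `A` is absorbed by a vector field, so the real span of products is the whole
exterior power. This needs at least one factor: in degree zero `prodSpan` consists of the real
constants only. -/
theorem mem_prodSpan {p : ℕ} {x : Λ} (hx : x ∈ ⋀[A]^(p + 1) L) : x ∈ prodSpan A L (p + 1) := by
  induction p generalizing x with
  | zero =>
    change _ ∈ (LinearMap.range (ExteriorAlgebra.ι A)) ^ 1 at hx
    rw [pow_one] at hx
    obtain ⟨X, rfl⟩ := hx
    exact vf_mem_prodSpan X
  | succ p ih =>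
    change _ ∈ (LinearMap.range (ExteriorAlgebra.ι A)) ^ (p + 1 + 1) at hx
    rw [pow_succ'] at hx
    refine Submodule.mul_induction_on hx ?_ ?_
    · rintro _ ⟨X, rfl⟩ x hx
      exact vf_mul_mem_prodSpan X (ih hx)
    · exact fun x y => add_mem

theorem grade_of_mem {p : ℕ} {x : Λ} (hx : x ∈ prodSpan A L p) : grade x = (-1 : ℝ) ^ p • x := by
  refine prodSpan_induction (motive := fun p x => grade x = (-1 : ℝ) ^ p • x) ?_ ?_ ?_ ?_ ?_ hx
  · simp
  · simp
  · intro p X x _ h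
    rw [grade_vf_mul, h, pow_succ, mul_smul_comm]
    module
  · intro p x y h h'
    rw [map_add, h, h', smul_add]
  · intro p r x h
    change gradeR (r • x) = _
    rw [map_smul, smul_comm]
    exact congrArg _ h

theorem mul_vf_of_mem {p : ℕ} {x : Λ} (hx : x ∈ prodSpan A L p) (X : L) :
    x * vf X = (-1 : ℝ) ^ p • (vf X * x) := by
  rw [mul_vf, grade_of_mem hx, mul_smul_comm]

/-- Multivector fields commute in the graded sense. -/
theorem prodSpan_mul_comm {p q : ℕ} {x y : Λ} (hx : x ∈ prodSpan A L p)
    (hy : y ∈ prodSpan A L q) : x * y = (-1 : ℝ) ^ (p * q) • (y * x) := by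
  refine prodSpan_induction (motive := fun p x => x * y = (-1 : ℝ) ^ (p * q) • (y * x))
    ?_ ?_ ?_ ?_ ?_ hx
  · simp
  · simp
  · intro p X x _ h
    rw [mul_assoc, h, ← mul_assoc y, mul_vf_of_mem hy, mul_smul_comm, smul_mul_assoc, mul_assoc,
      smul_smul]
    congr 1
    -- Only the parities of the degrees matter, so the sign identity is checked in each case
    -- separately.
    rcases neg_one_pow_eq_or ℝ q with h | h <;> rcases neg_one_pow_eq_or ℝ p with h' | h' <;>
      simp [pow_add, pow_mul, add_mul, h, h']
  · intro p x x' h h'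
    rw [add_mul, mul_add, h, h', smul_add]
  · intro p r x h
    rw [smul_mul_assoc, mul_smul_comm, h, smul_comm]

/-! The Lie derivative -/

theorem lieDer_one (X : L) : lieDer X (1 : Λ) = 0 := by
  rw [← map_one (algebraMap A Λ), lieDer_algebraMap, lie_one, map_zero]

theorem lieDer_vf (X Y : L) : lieDer X (vf Y : Λ) = vf ⁅X, Y⁆ := by
  simpa [lieDer_one] using lieDer_vf_mul X Y (1 : Λ)

theorem lieDer_mul (X : L) {q : ℕ} {y : Λ} (hy : y ∈ prodSpan A L q) (z : Λ) :
    lieDer X (y * z) = lieDer X y * z + y * lieDer X z := by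
  refine prodSpan_induction
    (motive := fun _ y => lieDer X (y * z) = lieDer X y * z + y * lieDer X z) ?_ ?_ ?_ ?_ ?_ hy
  · simp
  · simp [lieDer_one]
  · intro q Y y _ h
    rw [mul_assoc, lieDer_vf_mul, h, lieDer_vf_mul]
    noncomm_ring
  · intro q y y' h h'
    rw [add_mul, map_add, h, h', map_add]
    noncomm_ring
  · intro q r y h
    rw [smul_mul_assoc, map_smul, h, map_smul, smul_mul_assoc, smul_mul_assoc, smul_add]

theorem lieDer_mem (X : L) {q : ℕ} {y : Λ} (hy : y ∈ prodSpan A L q) :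
    lieDer X y ∈ prodSpan A L q := by
  refine prodSpan_induction (motive := fun q y => lieDer X y ∈ prodSpan A L q) ?_ ?_ ?_ ?_ ?_ hy
  · simp
  · simp [lieDer_one]
  · intro q Y y hy h
    rw [lieDer_vf_mul]
    exact add_mem (vf_mul_mem_prodSpan _ hy) (vf_mul_mem_prodSpan _ h)
  · intro q y y' h h'
    rw [map_add]
    exact add_mem h h'
  · intro q r y h
    rw [map_smul]
    exact Submodule.smul_mem _ r h

/-- Both sides are derivations of the exterior algebra, and on vector fields they agree by the
Jacobi identity of `L`. -/
theorem lieDer_lie (X Y : L) {q : ℕ} {y : Λ} (hy : y ∈ prodSpan A L q) :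
    lieDer ⁅X, Y⁆ y = lieDer X (lieDer Y y) - lieDer Y (lieDer X y) := by
  refine prodSpan_induction (motive := fun q y => lieDer ⁅X, Y⁆ y =
    lieDer X (lieDer Y y) - lieDer Y (lieDer X y)) ?_ ?_ ?_ ?_ ?_ hy
  · simp
  · simp [lieDer_one]
  · intro q Z y hy h
    simp only [lieDer_vf_mul, h, map_add, lie_lie X Y Z, map_sub]
    noncomm_ring
  · intro q y y' h h'
    simp only [map_add, h, h']
    abel
  · intro q r y h
    simp only [map_smul, h, smul_sub]

/-! The Schouten bracket -/

theorem schouten_one_left (y : Λ) : schouten (1 : Λ) y = 0 := by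
  have h0 : (funDiff (1 : A) : Module.Dual A L) = 0 := by
    ext X
    exact lie_one X
  rw [← map_one (algebraMap A Λ), schouten_algebraMap, h0, map_zero]
  rfl

theorem schouten_one_right {p : ℕ} {x : Λ} (hx : x ∈ prodSpan A L p) :
    schouten x (1 : Λ) = 0 := by
  refine prodSpan_induction (motive := fun _ x => schouten x (1 : Λ) = 0) ?_ ?_ ?_ ?_ ?_ hx
  · simp
  · exact schouten_one_left 1
  · intro p X x _ h
    rw [schouten_vf_mul, h, lieDer_one]
    simp
  · intro p x x' h h'
    rw [map_add, LinearMap.add_apply, h, h', add_zero]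
  · intro p r x h
    rw [map_smul, LinearMap.smul_apply, h, smul_zero]

/-- The bracket lowers the total degree by one, so the degree of `x` is written `p + 1` to avoid
subtraction. For this reason the induction starts from a single vector field instead of from `1`. -/
theorem schouten_mem {p q : ℕ} {x y : Λ} (hx : x ∈ prodSpan A L (p + 1))
    (hy : y ∈ prodSpan A L q) : schouten x y ∈ prodSpan A L (p + q) := by
  induction p generalizing x with
  | zero =>
    refine Submodule.span_induction ?_ (by simp) ?_ ?_ hx
    · rintro _ ⟨X, x, hx, rfl⟩
      obtain ⟨r, rfl⟩ := Submodule.mem_span_singleton.1 hx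
      rw [mul_smul_comm, mul_one, map_smul, LinearMap.smul_apply, schouten_vf, zero_add]
      exact Submodule.smul_mem _ r (lieDer_mem X hy)
    · intro x x' _ _ h h'
      rw [map_add, LinearMap.add_apply]
      exact add_mem h h'
    · intro r x _ h
      rw [map_smul, LinearMap.smul_apply]
      exact Submodule.smul_mem _ r h
  | succ p ih =>
    refine Submodule.span_induction ?_ (by simp) ?_ ?_ hx
    · rintro _ ⟨X, x, hx, rfl⟩
      rw [schouten_vf_mul]
      refine sub_mem (mul_mem_prodSpan hx (lieDer_mem X hy)) ?_
      rw [add_right_comm]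
      exact vf_mul_mem_prodSpan X (ih hx)
    · intro x x' _ _ h h'
      rw [map_add, LinearMap.add_apply]
      exact add_mem h h'
    · intro r x _ h
      rw [map_smul, LinearMap.smul_apply]
      exact Submodule.smul_mem _ r h

/-- The Leibniz rule for the Schouten bracket. -/
theorem schouten_mul {p q : ℕ} {x y : Λ} (hx : x ∈ prodSpan A L p) (hy : y ∈ prodSpan A L q)
    (z : Λ) : schouten x (y * z) =
      schouten x y * z + (-1 : ℝ) ^ ((p + 1) * q) • (y * schouten x z) := by
  refine prodSpan_induction (motive := fun p x => schouten x (y * z) =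
      schouten x y * z + (-1 : ℝ) ^ ((p + 1) * q) • (y * schouten x z)) ?_ ?_ ?_ ?_ ?_ hx
  · simp
  · simp [schouten_one_left]
  · intro p X x hx h
    rw [schouten_vf_mul, schouten_vf_mul, schouten_vf_mul, h, lieDer_mul X hy]
    have h1 : y * (x * lieDer X z) = (-1 : ℝ) ^ (p * q) • (x * (y * lieDer X z)) := by
      rw [← mul_assoc, prodSpan_mul_comm hy hx, smul_mul_assoc, mul_comm q, mul_assoc]
    have h2 : y * (vf X * schouten x z) = (-1 : ℝ) ^ q • (vf X * (y * schouten x z)) := by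
      rw [← mul_assoc, mul_vf_of_mem hy, smul_mul_assoc, mul_assoc]
    simp only [mul_add, mul_sub, sub_mul, mul_assoc, mul_smul_comm, h1, h2]
    rcases neg_one_pow_eq_or ℝ q with h | h <;> rcases neg_one_pow_eq_or ℝ p with h' | h' <;>
      simp [pow_add, pow_mul, add_mul, h, h'] <;> abel
  · intro p x x' h h'
    simp only [map_add, LinearMap.add_apply, h, h', add_mul, mul_add, smul_add]
    abel
  · intro p r x h
    simp only [map_smul, LinearMap.smul_apply, h, smul_mul_assoc, mul_smul_comm, smul_add,
      smul_comm r]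

/-- The case of graded symmetry to which the Leibniz rule in the second argument reduces the general
one. -/
theorem schouten_vf_right {p : ℕ} {x : Λ} (hx : x ∈ prodSpan A L p) (Z : L) :
    schouten x (vf Z) = (-1 : ℝ) ^ p • lieDer Z x := by
  refine prodSpan_induction (motive := fun p x => schouten x (vf Z) = (-1 : ℝ) ^ p • lieDer Z x)
    ?_ ?_ ?_ ?_ ?_ hx
  · simp
  · simp [schouten_one_left, lieDer_one]
  · intro p X x hx h
    rw [schouten_vf_mul, h, lieDer_vf, lieDer_vf_mul, mul_vf_of_mem hx, ← lie_skew, map_neg,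
      mul_smul_comm, pow_succ]
    simp only [neg_mul]
    module
  · intro p x x' h h'
    rw [map_add, LinearMap.add_apply, h, h', map_add, smul_add]
  · intro p r x h
    rw [map_smul, LinearMap.smul_apply, h, map_smul, smul_comm]

/-- The graded symmetry of the Schouten bracket. -/
theorem schouten_symm {p q : ℕ} {x y : Λ} (hx : x ∈ prodSpan A L p) (hy : y ∈ prodSpan A L q) :
    schouten x y = (-1 : ℝ) ^ (p * q) • schouten y x := by
  refine prodSpan_induction (motive := fun q y => schouten x y =
    (-1 : ℝ) ^ (p * q) • schouten y x) ?_ ?_ ?_ ?_ ?_ hy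
  · simp
  · simp [schouten_one_left, schouten_one_right hx]
  · intro q Y y hy h
    rw [schouten_mul hx (vf_mem_prodSpan Y), schouten_vf_right hx, schouten_vf_mul, h,
      smul_mul_assoc, prodSpan_mul_comm (lieDer_mem Y hx) hy]
    simp only [mul_smul_comm, smul_sub]
    rcases neg_one_pow_eq_or ℝ q with h | h <;> rcases neg_one_pow_eq_or ℝ p with h' | h' <;>
      simp [pow_add, pow_mul, mul_add, h, h'] <;> abel
  · intro q y y' h h'
    rw [map_add, h, h', map_add, LinearMap.add_apply, smul_add]
  · intro q r y h
    rw [map_smul, h, map_smul, LinearMap.smul_apply, smul_comm]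

/-- The recursion for `ν` involves only products and Lie derivatives. `L_Z` is a derivation of the
former, and its commutators with the latter are `L_[Z,X]`. This is the Jacobi identity with one
entry a vector field. -/
theorem lieDer_schouten (Z : L) {p q : ℕ} {x y : Λ} (hx : x ∈ prodSpan A L p)
    (hy : y ∈ prodSpan A L q) :
    lieDer Z (schouten x y) = schouten (lieDer Z x) y + schouten x (lieDer Z y) := by
  refine prodSpan_induction (motive := fun _ x => lieDer Z (schouten x y) =
    schouten (lieDer Z x) y + schouten x (lieDer Z y)) ?_ ?_ ?_ ?_ ?_ hx
  · simp
  · simp [schouten_one_left, lieDer_one]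
  · intro p X x hx h
    rw [schouten_vf_mul, lieDer_vf_mul, map_sub, lieDer_mul Z hx, lieDer_vf_mul, h, map_add,
      LinearMap.add_apply, schouten_vf_mul, schouten_vf_mul, schouten_vf_mul, lieDer_lie Z X hy]
    noncomm_ring
  · intro p x x' h h'
    simp only [map_add, LinearMap.add_apply, h, h']
    abel
  · intro p r x h
    simp only [map_smul, LinearMap.smul_apply, h, smul_add]

/-- The graded Jacobi identity of the Schouten bracket. -/
theorem schouten_schouten {p q s : ℕ} {x y z : Λ} (hx : x ∈ prodSpan A L (p + 1))
    (hy : y ∈ prodSpan A L (q + 1)) (hz : z ∈ prodSpan A L s) :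
    schouten (schouten x y) z = (-1 : ℝ) ^ p •
      (schouten x (schouten y z) - (-1 : ℝ) ^ (p * q) • schouten y (schouten x z)) := by
  have hxy : schouten x y ∈ prodSpan A L (p + (q + 1)) := schouten_mem hx hy
  refine prodSpan_induction (motive := fun s z => schouten (schouten x y) z = (-1 : ℝ) ^ p •
      (schouten x (schouten y z) - (-1 : ℝ) ^ (p * q) • schouten y (schouten x z)))
      ?_ ?_ ?_ ?_ ?_ hz
  · simp
  · simp [schouten_one_right hx, schouten_one_right hy, schouten_one_right hxy]
  · intro s Z z hz h
    have hZ : (vf Z : Λ) ∈ prodSpan A L 1 := vf_mem_prodSpan Z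
    have hxZ : lieDer Z x ∈ prodSpan A L (p + 1) := lieDer_mem Z hx
    have hyZ : lieDer Z y ∈ prodSpan A L (q + 1) := lieDer_mem Z hy
    -- The Leibniz rule is applied to `Z z` in all brackets. The terms in which `z` stays
    -- unbracketed say that `L_Z` is a derivation of `ν`, those in which `Z` does are the induction
    -- hypothesis, and the mixed terms cancel between the two orders of `x` and `y`.
    simp only [schouten_mul hxy hZ, schouten_mul hx hZ, schouten_mul hy hZ, h, map_add, map_smul,
      schouten_vf_right hx, schouten_vf_right hy, schouten_vf_right hxy, smul_mul_assoc,
      schouten_mul hx hyZ, schouten_mul hy hxZ, lieDer_schouten Z hx hy, schouten_symm hy hxZ]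
    simp only [add_mul, mul_sub, mul_smul_comm]
    rcases neg_one_pow_eq_or ℝ q with h | h <;> rcases neg_one_pow_eq_or ℝ p with h' | h' <;>
      simp [pow_add, pow_mul, mul_add, h, h', smul_sub, smul_add, -neg_add_rev, -neg_sub] <;>
        abel
  · intro s z z' h h'
    simp only [map_add, h, h', smul_add, smul_sub]
    abel
  · intro s r z h
    simp only [map_smul, h, smul_sub, smul_comm r]

/-! Contraction with multivector fields -/

theorem contract_one (α : Forms A L) : contract (1 : Λ) α = α := by
  rw [map_one]
  rfl

theorem contract_vf (X : L) (α : Forms A L) : contract (vf X : Λ) α = contractVF X α := by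
  rw [contract, ExteriorAlgebra.lift_ι_apply]

theorem contract_mul (x y : Λ) (α : Forms A L) : contract (x * y) α = contract x (contract y α) := by
  rw [map_mul]
  rfl

/-- The contraction, as a real bilinear map. -/
def contractR : Multivectors A L →ₗ[ℝ] Forms A L →ₗ[ℝ] Forms A L :=
  LinearMap.mk₂ ℝ (fun x α => contract x α)
    (fun x y α => by rw [map_add, LinearMap.add_apply])
    (fun r x α => by
      rw [← algebraMap_smul A r x, map_smul, LinearMap.smul_apply, algebraMap_smul])
    (fun x α β => by rw [map_add])
    (fun r x α => LinearMap.map_smul_of_tower (contract x) r α)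

theorem contractR_apply (x : Λ) (α : Forms A L) : contractR x α = contract x α := rfl

theorem contractR_vf_mul (X : L) (x : Λ) (α : Forms A L) :
    contractR (vf X * x) α = contractVF X (contractR x α) := by
  rw [contractR_apply, contract_mul, contract_vf, contractR_apply]

theorem contractR_mul (x y : Λ) (α : Forms A L) :
    contractR (x * y) α = contractR x (contractR y α) := contract_mul x y α

theorem contractR_one (α : Forms A L) : contractR (1 : Λ) α = α := contract_one α

theorem contractR_vf (X : L) (α : Forms A L) : contractR (vf X : Λ) α = contractVF X α :=
  contract_vf X α

/-- For vector fields `y` this is `[L_X, ι_Y] = ι_[X,Y]`. It spreads to products because `L_X` is a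
derivation of the exterior algebra and contraction is multiplicative. -/
theorem contractR_lieDer (X : L) {q : ℕ} {y : Λ} (hy : y ∈ prodSpan A L q) (α : Forms A L) :
    contractR (lieDer X y) α = lieForm X (contractR y α) - contractR y (lieForm X α) := by
  refine prodSpan_induction (motive := fun q y => ∀ α, contractR (lieDer X y) α =
    lieForm X (contractR y α) - contractR y (lieForm X α)) ?_ ?_ ?_ ?_ ?_ hy α
  · simp
  · simp [lieDer_one, contractR_one]
  · intro q Y y hy h α
    rw [lieDer_vf_mul, map_add, LinearMap.add_apply, contractR_vf_mul, contractR_vf_mul,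
      contractR_vf_mul, contractR_vf_mul, h, map_sub, contractVF_lieForm]
    abel
  · intro q y y' h h' α
    simp only [map_add, LinearMap.add_apply, h, h']
    abel
  · intro q r y h α
    simp only [map_smul, LinearMap.smul_apply, h, smul_sub]

/-- The contraction with the Schouten bracket as an iterated graded commutator. -/
theorem contractR_schouten {p q : ℕ} {x y : Λ} (hx : x ∈ prodSpan A L p)
    (hy : y ∈ prodSpan A L q) (α : Forms A L) :
    contractR (schouten x y) α = extDeriv (contractR (x * y) α) -
      (-1 : ℝ) ^ p • contractR x (extDeriv (contractR y α)) -
      (-1 : ℝ) ^ ((p + 1) * q) • contractR y (extDeriv (contractR x α)) +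
      (-1 : ℝ) ^ (p + q) • contractR (x * y) (extDeriv α) := by
  refine prodSpan_induction (motive := fun p x => ∀ α, contractR (schouten x y) α =
      extDeriv (contractR (x * y) α) -
      (-1 : ℝ) ^ p • contractR x (extDeriv (contractR y α)) -
      (-1 : ℝ) ^ ((p + 1) * q) • contractR y (extDeriv (contractR x α)) +
      (-1 : ℝ) ^ (p + q) • contractR (x * y) (extDeriv α)) ?_ ?_ ?_ ?_ ?_ hx α
  · simp
  · simp [schouten_one_left, contractR_one]
  · intro p X x hx h α
    rw [schouten_vf_mul, map_sub, LinearMap.sub_apply, prodSpan_mul_comm hx (lieDer_mem X hy),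
      map_smul, LinearMap.smul_apply, contractR_mul, contractR_lieDer X hy, ← contractR_mul y x,
      prodSpan_mul_comm hy hx, map_smul, LinearMap.smul_apply, mul_assoc]
    simp only [contractR_vf_mul, h, lieForm_apply, map_smul, map_add, map_sub]
    -- The Lie derivatives have been expanded by Cartan's formula. Once `ι_X` is moved past `ι_y`,
    -- both sides are the same combination of words in contractions and `d`.
    have e (β : Forms A L) : contractVF X (contractR y β) =
        (-1 : ℝ) ^ q • contractR y (contractVF X β) := by
      rw [← contractR_vf, ← contractR_mul, ← contractR_vf, ← contractR_mul, mul_vf_of_mem hy,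
        map_smul, LinearMap.smul_apply, smul_smul, ← mul_pow]
      simp
    have e' (r : ℝ) (β : Forms A L) : contractVF X (r • β) = r • contractVF X β :=
      LinearMap.map_smul_of_tower (contractVF X) r β
    simp only [e', e]
    rcases neg_one_pow_eq_or ℝ q with h | h <;> rcases neg_one_pow_eq_or ℝ p with h' | h' <;>
      simp [pow_add, pow_mul, add_mul, h, h', mul_comm q p] <;> module
  · intro p x x' h h' α
    simp only [add_mul, map_add, LinearMap.add_apply, h, h', smul_add]
    abel
  · intro p r x h α
    simp only [smul_mul_assoc, map_smul, LinearMap.smul_apply, h, smul_add, smul_sub, smul_comm r]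

end Gerstenhaber

/-! ### Permutations and Koszul signs -/

section Permutations

/-- The permutation with `0 ↦ a`, which is `τ` on the remaining letters. -/
def consPerm {n : ℕ} (a : Fin (n + 1)) (τ : Equiv.Perm (Fin n)) : Equiv.Perm (Fin (n + 1)) :=
  a.cycleRange⁻¹ * Equiv.Perm.decomposeFin.symm (0, τ)

@[simp] theorem consPerm_zero {n : ℕ} (a : Fin (n + 1)) (τ : Equiv.Perm (Fin n)) :
    consPerm a τ 0 = a := by
  simp [consPerm, Equiv.Perm.inv_def]

@[simp] theorem consPerm_succ {n : ℕ} (a : Fin (n + 1)) (τ : Equiv.Perm (Fin n)) (k : Fin n) :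
    consPerm a τ k.succ = a.succAbove (τ k) := by
  simp [consPerm, Equiv.Perm.inv_def]

/-- Permutations are thus built up by choosing the first letter and then permuting the rest, which
allows Koszul signs to be computed one letter at a time. -/
theorem exists_consPerm {n : ℕ} (σ : Equiv.Perm (Fin (n + 1))) :
    ∃ a τ, σ = consPerm a τ := by
  obtain ⟨⟨b, τ⟩, h⟩ := Equiv.Perm.decomposeFin.symm.surjective ((σ 0).cycleRange * σ)
  have h0 := congrArg (fun ρ => ρ 0) h
  simp at h0
  subst h0
  exact ⟨σ 0, τ, by rw [consPerm, h, inv_mul_cancel_left]⟩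

/-- The sign of moving the letter `a` to the front. -/
def moveSign {n : ℕ} (e : Fin (n + 1) → ℤ) (a : Fin (n + 1)) : ℤˣ :=
  ∏ c : Fin n, if a.succAbove c < a then Int.negOnePow (e a * e (a.succAbove c)) else 1

@[simp] theorem moveSign_zero {n : ℕ} (e : Fin (n + 1) → ℤ) : moveSign e 0 = 1 := by
  simp [moveSign]

theorem moveSign_succ {n : ℕ} (e : Fin (n + 2) → ℤ) (a : Fin (n + 1)) :
    moveSign e a.succ = Int.negOnePow (e a.succ * e 0) * moveSign (fun i => e i.succ) a := by
  rw [moveSign, Fin.prod_univ_succ, moveSign]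
  simp

/-- The inversions at the first position correspond to the letters smaller than `a`. All others are
inversions of `τ`, because `a.succAbove` is increasing. -/
theorem koszulSign_consPerm {n : ℕ} (e : Fin (n + 1) → ℤ) (a : Fin (n + 1))
    (τ : Equiv.Perm (Fin n)) : koszulSign e (consPerm a τ) =
      moveSign e a * koszulSign (fun i => e (a.succAbove i)) τ := by
  simp only [koszulSign, Finset.prod_filter, Fintype.prod_prod_type]
  rw [Fin.prod_univ_succ, Fin.prod_univ_succ]
  congr 1
  · rw [if_neg (by simp), one_mul, moveSign]
    simpa using Equiv.prod_comp τ fun c => if a.succAbove c < a then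
      Int.negOnePow (e a * e (a.succAbove c)) else 1
  · refine Finset.prod_congr rfl fun i _ => ?_
    rw [Fin.prod_univ_succ, if_neg (by simp), one_mul]
    simp only [consPerm_succ, Fin.succ_lt_succ_iff, Fin.succAbove_lt_succAbove_iff]

@[simp] theorem koszulSign_one {n : ℕ} (e : Fin n → ℤ) : koszulSign e 1 = 1 := by
  rw [koszulSign, Finset.filter_false_of_mem, Finset.prod_empty]
  rintro p - ⟨h1, h2⟩
  exact lt_asymm h1 h2

theorem koszulSign_permCongr {n n' : ℕ} (h : n = n') (e : Fin n' → ℤ) (σ : Equiv.Perm (Fin n)) :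
    koszulSign e ((finCongr h).permCongr σ) = koszulSign (fun i => e (Fin.cast h i)) σ := by
  subst h
  rfl

/-! ### Unshuffles of types `(n, 0)` and `(2, n)` -/

theorem perm_eq_one_of_strictMono {n : ℕ} (σ : Equiv.Perm (Fin n)) (h : StrictMono σ) : σ = 1 := by
  ext i
  have := Subsingleton.elim (h.orderIsoOfSurjective σ σ.surjective) (OrderIso.refl (Fin n))
  exact congrArg (fun f : Fin n ≃o Fin n => (f i : ℕ)) this

theorem sum_unshuffles_zero {B : Type*} [AddCommMonoid B] (n : ℕ)
    (F : Equiv.Perm (Fin (n + 0)) → B) : ∑ σ ∈ unshuffles n 0, F σ = F 1 := by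
  have : unshuffles n 0 = {1} := by
    ext σ
    simp only [unshuffles, Finset.mem_filter, Finset.mem_univ, true_and, Finset.mem_singleton]
    constructor
    · rintro ⟨h, -⟩
      exact perm_eq_one_of_strictMono σ h
    · rintro rfl
      exact ⟨fun i j h => h, fun i => i.elim0⟩
  rw [this, Finset.sum_singleton]

/-- The unshuffle which moves the letters `a` and `a.succAbove b` to the front. -/
def unshuffleTwo {n : ℕ} (a : Fin (n + 2)) (b : Fin (n + 1)) : Equiv.Perm (Fin (2 + n)) :=
  (finCongr (Nat.add_comm n 2)).permCongr (consPerm a (consPerm b 1))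

theorem unshuffleTwo_zero {n : ℕ} (a : Fin (n + 2)) (b : Fin (n + 1)) :
    unshuffleTwo a b (Fin.castAdd n 0) = Fin.cast (Nat.add_comm n 2) a := by
  change Fin.cast (Nat.add_comm n 2) (consPerm a (consPerm b 1) 0) = _
  rw [consPerm_zero]

theorem unshuffleTwo_one {n : ℕ} (a : Fin (n + 2)) (b : Fin (n + 1)) :
    unshuffleTwo a b (Fin.castAdd n 1) = Fin.cast (Nat.add_comm n 2) (a.succAbove b) := by
  change Fin.cast (Nat.add_comm n 2) (consPerm a (consPerm b 1) (Fin.succ 0)) = _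
  rw [consPerm_succ, consPerm_zero]

theorem unshuffleTwo_natAdd {n : ℕ} (a : Fin (n + 2)) (b : Fin (n + 1)) (c : Fin n) :
    unshuffleTwo a b (Fin.natAdd 2 c) =
      Fin.cast (Nat.add_comm n 2) (a.succAbove (b.succAbove c)) := by
  have : Fin.cast (Nat.add_comm 2 n) (Fin.natAdd 2 c) = c.succ.succ := by
    ext
    simp
  change Fin.cast (Nat.add_comm n 2) (consPerm a (consPerm b 1) (Fin.cast (Nat.add_comm 2 n) (Fin.natAdd 2 c))) = _
  rw [this, consPerm_succ, consPerm_succ]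
  rfl

theorem koszulSign_unshuffleTwo {n : ℕ} (e : Fin (2 + n) → ℤ) (a : Fin (n + 2))
    (b : Fin (n + 1)) : koszulSign e (unshuffleTwo a b) =
      moveSign (fun i => e (Fin.cast (Nat.add_comm n 2) i)) a *
        moveSign (fun i => e (Fin.cast (Nat.add_comm n 2) (a.succAbove i))) b := by
  rw [unshuffleTwo, koszulSign_permCongr, koszulSign_consPerm, koszulSign_consPerm, koszulSign_one,
    mul_one]

theorem strictMono_fin_two {n : ℕ} (f : Fin 2 → Fin n) : StrictMono f ↔ f 0 < f 1 := by
  rw [Fin.strictMono_iff_lt_succ]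
  simp

/-- A `(2, n)`-unshuffle is determined by the two letters that it puts in front, `a` and
`a.succAbove b`. The condition `a ≤ b.castSucc` says that they are in increasing order. -/
theorem sum_unshuffles_two {B : Type*} [AddCommMonoid B] (n : ℕ)
    (F : Equiv.Perm (Fin (2 + n)) → B) : ∑ σ ∈ unshuffles 2 n, F σ =
      ∑ a : Fin (n + 2), ∑ b : Fin (n + 1),
        if a ≤ b.castSucc then F (unshuffleTwo a b) else 0 := by
  rw [← Fintype.sum_prod_type' (fun (a : Fin (n + 2)) (b : Fin (n + 1)) =>
    if a ≤ b.castSucc then F (unshuffleTwo a b) else 0), ← Finset.sum_filter]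
  symm
  refine Finset.sum_nbij (fun p => unshuffleTwo p.1 p.2) ?_ ?_ ?_ fun _ _ => rfl
  · rintro ⟨a, b⟩ h
    simp only [Finset.mem_filter, Finset.mem_univ, true_and] at h
    simp only [unshuffles, Finset.mem_filter, Finset.mem_univ, true_and, strictMono_fin_two,
      unshuffleTwo_zero, unshuffleTwo_one, unshuffleTwo_natAdd]
    refine ⟨Fin.lt_succAbove_iff_le_castSucc a b |>.2 h, fun c c' h => ?_⟩
    exact Fin.strictMono_succAbove a (Fin.strictMono_succAbove b h)
  · rintro ⟨a, b⟩ - ⟨a', b'⟩ - h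
    have h0 := congrArg (fun σ => σ (Fin.castAdd n 0)) h
    have h1 := congrArg (fun σ => σ (Fin.castAdd n 1)) h
    simp only [unshuffleTwo_zero, unshuffleTwo_one, Fin.cast_inj] at h0 h1
    subst h0
    rw [Fin.succAbove_right_inj] at h1
    rw [h1]
  · intro σ hσ
    obtain ⟨σ, rfl⟩ := (finCongr (Nat.add_comm n 2)).permCongr.surjective σ
    obtain ⟨a, τ, rfl⟩ := exists_consPerm σ
    obtain ⟨b, ρ, rfl⟩ := exists_consPerm τ
    simp only [unshuffles, Finset.coe_filter, Finset.mem_univ, true_and, Set.mem_ofPred_eq,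
      strictMono_fin_two] at hσ
    obtain ⟨h1, h2⟩ := hσ
    change consPerm a (consPerm b ρ) 0 < consPerm a (consPerm b ρ) (Fin.succ 0) at h1
    rw [consPerm_zero, consPerm_succ, consPerm_zero, Fin.lt_succAbove_iff_le_castSucc] at h1
    have h3 : ρ = 1 := by
      refine perm_eq_one_of_strictMono ρ fun c c' h => ?_
      have h4 := h2 h
      have h5 (c : Fin n) : Fin.cast (Nat.add_comm 2 n) (Fin.natAdd 2 c) = c.succ.succ := by
        ext
        simp
      change consPerm a (consPerm b ρ) (Fin.cast (Nat.add_comm 2 n) (Fin.natAdd 2 c)) <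
        consPerm a (consPerm b ρ) (Fin.cast (Nat.add_comm 2 n) (Fin.natAdd 2 c')) at h4
      simpa [h5, Fin.succAbove_lt_succAbove_iff] using h4
    subst h3
    exact ⟨(a, b), by simpa using h1, rfl⟩

theorem negOnePow_smul {W : Type*} [AddCommGroup W] [Module ℝ W] (n : ℕ) (x : W) :
    Int.negOnePow (n : ℤ) • x = (-1 : ℝ) ^ n • x := by
  rcases n.even_or_odd with h | h
  · rw [Int.negOnePow_even _ (by exact_mod_cast h), h.neg_one_pow, one_smul, one_smul]
  · rw [Int.negOnePow_odd _ (by exact_mod_cast h), h.neg_one_pow, neg_smul, one_smul,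
      Units.neg_smul, one_smul]

end Permutations

/-! ### Brackets of products of multivector fields -/

section Products
variable {A L : Type*} [CommRing A] [Algebra ℝ A] [LieRing L] [LieAlgebra ℝ L] [Module A L]
  [LieRingModule L A] [LieRinehartRing A L] [LieRinehartAlgebra ℝ A L]

local notation "Λ" => Multivectors A L

theorem units_smul_mul (s : ℤˣ) (x y : Λ) : (s • x) * y = s • (x * y) := by
  rcases Int.units_eq_one_or s with rfl | rfl <;> simp

theorem units_mul_smul (s : ℤˣ) (x y : Λ) : x * (s • y) = s • (x * y) := by
  rcases Int.units_eq_one_or s with rfl | rfl <;> simp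

theorem map_units_smul {W W' : Type*} [AddCommGroup W] [AddCommGroup W'] [Module ℝ W]
    [Module ℝ W'] (f : W →ₗ[ℝ] W') (s : ℤˣ) (x : W) : f (s • x) = s • f x := by
  rcases Int.units_eq_one_or s with rfl | rfl <;> simp

theorem prodSpan_mul_swap {p q : ℕ} {x y : Λ} (hx : x ∈ prodSpan A L p)
    (hy : y ∈ prodSpan A L q) : Int.negOnePow (p * q) • (x * y) = y * x := by
  rw [← Nat.cast_mul, negOnePow_smul, prodSpan_mul_comm hx hy, smul_smul, ← mul_pow]
  simp

theorem ofFn_prod_mem {n : ℕ} {x : Fin n → Λ} {k : Fin n → ℕ} (hx : ∀ i, x i ∈ prodSpan A L (k i)) :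
    (List.ofFn x).prod ∈ prodSpan A L (∑ i, k i) := by
  induction n with
  | zero => simpa using one_mem_prodSpan
  | succ n ih =>
    rw [List.ofFn_succ, List.prod_cons, Fin.sum_univ_succ]
    exact mul_mem_prodSpan (hx 0) (ih fun i => hx i.succ)

/-- The factor `x a` is carried to the front past one factor at a time, and each exchange costs one
factor of `moveSign`. -/
theorem moveSign_smul_prod {n : ℕ} {x : Fin (n + 1) → Λ} {k : Fin (n + 1) → ℕ}
    (hx : ∀ i, x i ∈ prodSpan A L (k i)) (a : Fin (n + 1)) :
    moveSign (fun i => (k i : ℤ)) a • (x a * (List.ofFn fun c => x (a.succAbove c)).prod) =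
      (List.ofFn x).prod := by
  induction n with
  | zero =>
    obtain rfl := Fin.fin_one_eq_zero a
    simp
  | succ n ih =>
    refine Fin.cases ?_ (fun a => ?_) a
    · simp [List.ofFn_succ]
    · rw [moveSign_succ, List.ofFn_succ, List.ofFn_succ, List.prod_cons, List.prod_cons,
        ← ih (fun i => hx i.succ) a]
      simp only [Fin.succ_succAbove_zero, Fin.succ_succAbove_succ]
      rw [← mul_assoc, mul_comm, mul_smul, ← units_smul_mul, prodSpan_mul_swap (hx a.succ) (hx 0),
        mul_assoc, units_mul_smul]

/-- Products of multivector fields are graded symmetric. -/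
theorem koszulSign_smul_prod {n : ℕ} {x : Fin n → Λ} {k : Fin n → ℕ}
    (hx : ∀ i, x i ∈ prodSpan A L (k i)) (σ : Equiv.Perm (Fin n)) :
    koszulSign (fun i => (k i : ℤ)) σ • (List.ofFn (x ∘ σ)).prod = (List.ofFn x).prod := by
  induction n with
  | zero =>
    obtain rfl := Subsingleton.elim σ 1
    simp
  | succ n ih =>
    obtain ⟨a, τ, rfl⟩ := exists_consPerm σ
    rw [koszulSign_consPerm, ← moveSign_smul_prod hx a, List.ofFn_succ, List.prod_cons,
      mul_smul, ← ih (fun i => hx (a.succAbove i)) τ, units_mul_smul]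
    simp [Function.comp_def]

/-- This is the iterated Leibniz rule. The sign for passing `ν(y, ·)` over a factor `x 0` and the
sign for moving `ν(y, x_b)` back in front of it differ by that of exchanging `x_b` and `x 0`, so the
degree of `y` drops out. -/
theorem schouten_prod {n p : ℕ} {x : Fin (n + 1) → Λ} {k : Fin (n + 1) → ℕ} {y : Λ}
    (hy : y ∈ prodSpan A L (p + 1)) (hx : ∀ i, x i ∈ prodSpan A L (k i)) :
    schouten y (List.ofFn x).prod = ∑ b, moveSign (fun i => (k i : ℤ)) b •
      (schouten y (x b) * (List.ofFn fun c => x (b.succAbove c)).prod) := by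
  induction n with
  | zero => simp
  | succ n ih =>
    have h : (List.ofFn x).prod = x 0 * (List.ofFn fun i : Fin (n + 1) => x i.succ).prod := by
      rw [List.ofFn_succ, List.prod_cons]
    rw [h, schouten_mul hy (hx 0), Fin.sum_univ_succ, ih fun i => hx i.succ]
    congr 1
    · rw [moveSign_zero, one_smul]
      rfl
    · rw [Finset.mul_sum, Finset.smul_sum]
      refine Finset.sum_congr rfl fun b _ => ?_
      rw [moveSign_succ, List.ofFn_succ, List.prod_cons]
      simp only [Fin.succ_succAbove_zero, Fin.succ_succAbove_succ]
      rw [← mul_assoc, prodSpan_mul_comm (schouten_mem hy (hx b.succ)) (hx 0), smul_mul_assoc,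
        mul_comm (Int.negOnePow _), mul_smul, ← Nat.cast_mul, negOnePow_smul, units_mul_smul,
        smul_comm, mul_assoc, smul_smul]
      congr 2
      rcases neg_one_pow_eq_or ℝ (k 0) with h | h <;>
      rcases neg_one_pow_eq_or ℝ (k b.succ) with h' | h' <;> rcases neg_one_pow_eq_or ℝ p with h'' | h'' <;>
        simp [pow_add, pow_mul, add_mul, h, h', h'']

/-- The sum of `± ν(x_a, x_b) x_1 ⋯ x̂_a ⋯ x̂_b ⋯ x_n` over the pairs `a < b`. -/
def pairSum {n : ℕ} (k : Fin (n + 2) → ℕ) (x : Fin (n + 2) → Λ) : Λ :=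
  ∑ a : Fin (n + 2), ∑ b : Fin (n + 1), if a ≤ b.castSucc then
    (moveSign (fun i => (k i : ℤ)) a * moveSign (fun i => (k (a.succAbove i) : ℤ)) b) •
      (schouten (x a) (x (a.succAbove b)) *
        (List.ofFn fun c => x (a.succAbove (b.succAbove c))).prod) else 0

theorem pairSum_two (k : Fin 2 → ℕ) (x : Fin 2 → Λ) : pairSum k x = schouten (x 0) (x 1) := by
  simp [pairSum]

/-- The pairs containing the index zero are collected by the Leibniz rule. In the others `x 0` is
pulled in front of `ν(x_a, x_b)`, whose degree is one less than that of `x_a x_b`; this defect of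
one leaves the sign given by the degree of `x 0`. -/
theorem pairSum_succ {n : ℕ} {j : Fin (n + 3) → ℕ} {x : Fin (n + 3) → Λ}
    (hx : ∀ i, x i ∈ prodSpan A L (j i + 1)) :
    pairSum (fun i => j i + 1) x = schouten (x 0) (List.ofFn fun i : Fin (n + 2) => x i.succ).prod +
      (-1 : ℝ) ^ (j 0 + 1) •
        (x 0 * pairSum (fun i => j (Fin.succ i) + 1) (fun i => x (Fin.succ i))) := by
  rw [pairSum, Fin.sum_univ_succ]
  congr 1
  · rw [schouten_prod (hx 0) fun i => hx i.succ]
    simp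
  · rw [pairSum, Finset.mul_sum, Finset.smul_sum]
    refine Finset.sum_congr rfl fun a _ => ?_
    rw [Fin.sum_univ_succ, if_neg (by simp), zero_add, Finset.mul_sum, Finset.smul_sum]
    refine Finset.sum_congr rfl fun b _ => ?_
    rw [← Fin.succ_castSucc, moveSign_succ, moveSign_succ, List.ofFn_succ, List.prod_cons]
    simp only [Fin.succ_le_succ_iff, Fin.succ_succAbove_zero, Fin.succ_succAbove_succ]
    split_ifs
    · rw [← mul_assoc (schouten _ _) (x 0),
        prodSpan_mul_comm (schouten_mem (hx a.succ) (hx (a.succAbove b).succ)) (hx 0),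
        mul_mul_mul_comm, mul_smul, units_mul_smul, ← Int.negOnePow_add, ← Nat.cast_mul,
        ← Nat.cast_mul, ← Nat.cast_add, negOnePow_smul, smul_mul_assoc,
        smul_comm _ ((-1 : ℝ) ^ _), smul_smul, mul_assoc]
      congr 1
      rcases neg_one_pow_eq_or ℝ (j 0) with h | h <;>
      rcases neg_one_pow_eq_or ℝ (j a.succ) with h' | h' <;>
      rcases neg_one_pow_eq_or ℝ (j (a.succAbove b).succ) with h'' | h'' <;>
        simp [pow_add, pow_mul, add_mul, h, h', h'']
    · simp

/-- If `α` and all the `ι_{x_i} α` are closed, then `d ι_{x_1 ⋯ x_n} α` is the contraction of `α`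
with the sum of `± ν(x_a, x_b) x_1 ⋯ x̂_a ⋯ x̂_b ⋯ x_n` over the pairs `a < b`. -/
theorem extDeriv_contractR_prod {n : ℕ} {j : Fin (n + 2) → ℕ} {x : Fin (n + 2) → Λ}
    (hx : ∀ i, x i ∈ prodSpan A L (j i + 1)) {α : Forms A L} (hα : extDeriv α = 0)
    (hxα : ∀ i, extDeriv (contractR (x i) α) = 0) :
    extDeriv (contractR (List.ofFn x).prod α) = contractR (pairSum (fun i => j i + 1) x) α := by
  -- Closedness of `α` and of `ι_x α` removes two of the four terms of `contractR_schouten`. The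
  -- recursion that remains is the one satisfied by `pairSum`.
  have key {p q : ℕ} {x y : Λ} (hx : x ∈ prodSpan A L p) (hy : y ∈ prodSpan A L q)
      (h : extDeriv (contractR x α) = 0) : extDeriv (contractR (x * y) α) =
        contractR (schouten x y) α + (-1 : ℝ) ^ p • contractR x (extDeriv (contractR y α)) := by
    rw [contractR_schouten hx hy, hα, h]
    simp
  induction n with
  | zero =>
    rw [pairSum_two]
    have : (List.ofFn x).prod = x 0 * x 1 := by simp [List.ofFn_succ]
    rw [this, key (hx 0) (hx 1) (hxα 0), hxα 1]
    simp
  | succ n ih =>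
    rw [pairSum_succ hx, List.ofFn_succ, List.prod_cons,
      key (hx 0) (ofFn_prod_mem fun i => hx i.succ) (hxα 0),
      ih (fun i => hx i.succ) (fun i => hxα i.succ), map_add, LinearMap.add_apply, map_smul,
      LinearMap.smul_apply, contractR_mul]

end Products

/-! ### Composites of brackets -/

section Composites
variable {W : Type*} [AddCommGroup W] [Module ℝ W]
  (l : ∀ n : ℕ, MultilinearMap ℝ (fun _ : Fin n => W) W)

/-- The lengths are tied by equations, not substituted, because the Jacobi sum supplies them as `i +
1` and `n - (i + 1)`. -/
theorem bracketComp_two {p q n : ℕ} (h : p + q = n + 2) (hp : p = 2) (e : Fin (n + 2) → ℤ)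
    (v : Fin (n + 2) → W) :
    bracketComp l p q (fun a => e (Fin.cast h a)) (fun a => v (Fin.cast h a)) =
      ∑ a : Fin (n + 2), ∑ b : Fin (n + 1), if a ≤ b.castSucc then
        (moveSign e a * moveSign (fun i => e (a.succAbove i)) b) •
          l (n + 1) (Fin.cons (l 2 ![v a, v (a.succAbove b)])
            fun c => v (a.succAbove (b.succAbove c))) else 0 := by
  subst hp
  obtain rfl : q = n := by omega
  rw [bracketComp, sum_unshuffles_two]
  refine Finset.sum_congr rfl fun a _ => Finset.sum_congr rfl fun b _ => ?_
  refine if_congr Iff.rfl ?_ rfl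
  rw [koszulSign_unshuffleTwo]
  congr 3
  · congr 1
    funext i
    fin_cases i
    · exact congrArg (fun k => v (Fin.cast h k)) (unshuffleTwo_zero a b)
    · exact congrArg (fun k => v (Fin.cast h k)) (unshuffleTwo_one a b)
  · funext c
    rw [unshuffleTwo_natAdd]
    rfl

theorem bracketComp_last {p q n : ℕ} (h : p + q = n) (hq : q = 0) (e : Fin n → ℤ)
    (v : Fin n → W) :
    bracketComp l p q (fun a => e (Fin.cast h a)) (fun a => v (Fin.cast h a)) =
      l 1 fun _ => l n v := by
  subst hq
  subst h
  rw [bracketComp, sum_unshuffles_zero, koszulSign_one, one_smul]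
  congr 1
  funext i
  obtain rfl := Fin.fin_one_eq_zero i
  rfl

theorem bracketComp_eq_zero {p q : ℕ} (e : Fin (p + q) → ℤ) (v : Fin (p + q) → W) (a : Fin (p + q))
    (ha : v a = 0) : bracketComp l p q e v = 0 := by
  refine Finset.sum_eq_zero fun σ _ => ?_
  obtain ⟨b, rfl⟩ := σ.surjective a
  suffices h : l (q + 1) (Fin.cons (l p fun a => v (σ (Fin.castAdd q a)))
      fun b => v (σ (Fin.natAdd p b))) = 0 by rw [h, smul_zero]
  induction b using Fin.addCases with
  | left b =>
    refine MultilinearMap.map_coord_zero _ 0 ?_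
    rw [Fin.cons_zero]
    exact MultilinearMap.map_coord_zero _ b ha
  | right b =>
    refine MultilinearMap.map_coord_zero _ b.succ ?_
    rw [Fin.cons_succ]
    exact ha

end Composites

/-! ### The `L∞`-algebra of Hamiltonian pairs -/

section Brackets
variable {A L : Type*} [CommRing A] [Algebra ℝ A] [LieRing L] [LieAlgebra ℝ L] [Module A L]
  [LieRingModule L A] [LieRinehartRing A L] [LieRinehartAlgebra ℝ A L]

local notation "Λ" => Multivectors A L

/-- Stated through vanishing components and without subtraction of degrees, so that it also gives
`ι_x α = 0` when the degree of `x` exceeds that of `α`. -/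
theorem contractR_apply_eq_zero {p q n : ℕ} {x : Λ} (hx : x ∈ prodSpan A L p) {α : Forms A L}
    (hα : α ∈ homForms A L q) (h : n + p ≠ q) : contractR x α n = 0 := by
  refine prodSpan_induction (motive := fun p x => ∀ n, n + p ≠ q → contractR x α n = 0)
    ?_ ?_ ?_ ?_ ?_ hx n h
  · intro p n _
    simp
  · intro n hn
    rw [contractR_one]
    exact mem_homForms.1 hα n (by simpa using hn)
  · intro p X x _ h n hn
    rw [contractR_vf_mul]
    ext w
    rw [contractVF_apply, h (n + 1) (by omega)]
    rfl
  · intro p x x' h h' n hn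
    rw [map_add, LinearMap.add_apply, Pi.add_apply, h n hn, h' n hn, add_zero]
  · intro p r x h n hn
    rw [map_smul, LinearMap.smul_apply, Pi.smul_apply, h n hn, smul_zero]

theorem contractR_mem_homForms {p q s : ℕ} {x : Λ} (hx : x ∈ prodSpan A L p) {α : Forms A L}
    (hα : α ∈ homForms A L q) (h : s + p = q) : contractR x α ∈ homForms A L s :=
  mem_homForms.2 fun n hn => contractR_apply_eq_zero hx hα (by omega)

variable {m : ℕ} (ω : Form A L (m + 1))

/-! ### Components and the entries in the first column -/

theorem mem_component_one {j : ℕ} {z : Multivectors A L × Forms A L} (h : 1 + j ≤ m) :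
    z ∈ component ω 1 j ↔ z.1 ∈ prodSpan A L (j + 1) ∧ z.2 ∈ homForms A L (m - (1 + j)) ∧
      contractR z.1 ω.total = extDeriv z.2 := by
  rw [component, if_pos h]
  exact and_congr_left fun _ => ⟨mem_prodSpan, prodSpan_le⟩

theorem mem_component_add_two {i j : ℕ} {z : Multivectors A L × Forms A L} (h : i + 2 + j ≤ m) :
    z ∈ component ω (i + 2) j ↔ z.1 = 0 ∧ z.2 ∈ homForms A L (m - (i + 2 + j)) := by
  rw [component, if_pos h]
  exact Submodule.mem_prod

theorem mem_component_of_lt {i j : ℕ} {z : Multivectors A L × Forms A L} (h : m < i + j) :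
    z ∈ component ω i j ↔ z = 0 := by
  match i with
  | 0 => exact Iff.rfl
  | 1 => rw [component, if_neg (by omega), Submodule.mem_bot]
  | i + 2 => rw [component, if_neg (by omega), Submodule.mem_bot]

variable {ω}

theorem columnOne_apply (j : ℕ) (v : Ambient A L) : columnOne j v = (v (1, j)).1 := rfl

theorem columnOne_mem {P : ℕ → ℕ → Prop} {v : Ambient A L} (hv : v ∈ pairsOn ω P) (j : ℕ) :
    columnOne j v ∈ prodSpan A L (j + 1) := by
  have h := (hv 1 j).1
  rw [columnOne_apply]
  by_cases hj : 1 + j ≤ m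
  · exact ((mem_component_one ω hj).1 h).1
  · rw [(mem_component_of_lt ω (by omega)).1 h]
    exact zero_mem _

/-- This is all that the brackets use of the Hamiltonian condition: `ι_x ω` is exact, hence closed,
whichever primitive is chosen. -/
theorem extDeriv_contractR_columnOne {P : ℕ → ℕ → Prop} {v : Ambient A L} (hv : v ∈ pairsOn ω P)
    (j : ℕ) : extDeriv (contractR (columnOne j v) ω.total) = 0 := by
  have h := (hv 1 j).1
  rw [columnOne_apply]
  by_cases hj : 1 + j ≤ m
  · rw [((mem_component_one ω hj).1 h).2.2, extDeriv_extDeriv]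
  · rw [(mem_component_of_lt ω (by omega)).1 h]
    simp

theorem columnOne_eq_zero {P : ℕ → ℕ → Prop} {v : Ambient A L} (hv : v ∈ pairsOn ω P) {j : ℕ}
    (hj : ¬ P 1 j) : columnOne j v = 0 := by
  rw [columnOne_apply, (hv 1 j).2 hj]
  rfl

theorem pairsOn_apply_eq_zero {P : ℕ → ℕ → Prop} {v : Ambient A L} (hv : v ∈ pairsOn ω P)
    {i j : ℕ} (h : i = 0 ∨ m < i + j) : v (i, j) = 0 := by
  rcases h with rfl | h
  · exact (hv 0 j).1
  · exact (mem_component_of_lt ω h).1 (hv i j).1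

variable (ω)

/-! ### Values of the brackets -/

theorem pairBracket_two (x : Fin 2 → Λ) :
    pairBracket ω 2 x = (schouten (x 0) (x 1), contractR (List.ofFn x).prod ω.total) := rfl

theorem pairBracket_add_three (n : ℕ) (x : Fin (n + 3) → Λ) :
    pairBracket ω (n + 3) x = (0, contractR (List.ofFn x).prod ω.total) := rfl

theorem pairBracket_snd (n : ℕ) (x : Fin (n + 2) → Λ) :
    (pairBracket ω (n + 2) x).2 = contractR (List.ofFn x).prod ω.total := by
  cases n <;> rfl

theorem pairsBracket_one (v : Fin 1 → Ambient A L) :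
    pairsBracket ω 1 v = unaryBracket (v 0) := rfl

theorem pairsBracket_apply (n : ℕ) (v : Fin (n + 2) → Ambient A L) (p : ℕ × ℕ) :
    pairsBracket ω (n + 2) v p = if p.1 = n + 1 ∧ p.1 + p.2 ≤ m then
      ∑ js ∈ Finset.Nat.antidiagonalTuple (n + 2) p.2,
        pairBracket ω (n + 2) fun a => columnOne (js a) (v a) else 0 := by
  rw [pairsBracket, MultilinearMap.pi_apply]
  split_ifs
  · rw [_root_.sum_apply]
    rfl
  · rfl

/-- The bracket of elements which have only one entry in the column `i = 1`. -/
theorem pairsBracket_apply_of_columnOne (n : ℕ) (v : Fin (n + 2) → Ambient A L)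
    (k : Fin (n + 2) → ℕ) (hv : ∀ a, ∀ j ≠ k a, columnOne j (v a) = 0) (p : ℕ × ℕ) :
    pairsBracket ω (n + 2) v p = if p.1 = n + 1 ∧ p.1 + p.2 ≤ m ∧ p.2 = ∑ a, k a then
      pairBracket ω (n + 2) fun a => columnOne (k a) (v a) else 0 := by
  have h (js : Fin (n + 2) → ℕ) (hjs : js ≠ k) :
      pairBracket ω (n + 2) (fun a => columnOne (js a) (v a)) = 0 := by
    obtain ⟨a, ha⟩ := Function.ne_iff.1 hjs
    exact MultilinearMap.map_coord_zero _ a (hv a _ ha)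
  rw [pairsBracket_apply]
  by_cases h1 : p.1 = n + 1 ∧ p.1 + p.2 ≤ m
  · rw [if_pos h1]
    by_cases h2 : p.2 = ∑ a, k a
    · rw [if_pos ⟨h1.1, h1.2, h2⟩]
      refine Finset.sum_eq_single k (fun js _ => h js) fun hk => ?_
      exact (hk (Finset.Nat.mem_antidiagonalTuple.2 h2.symm)).elim
    · rw [if_neg fun h => h2 h.2.2]
      refine Finset.sum_eq_zero fun js hjs => h js ?_
      rintro rfl
      exact h2 (Finset.Nat.mem_antidiagonalTuple.1 hjs).symm
  · rw [if_neg h1, if_neg fun h => h1 ⟨h.1, h.2.1⟩]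

theorem pairsBracket_eq_zero (n : ℕ) (v : Fin (n + 2) → Ambient A L) (a : Fin (n + 2))
    (ha : ∀ j, columnOne j (v a) = 0) : pairsBracket ω (n + 2) v = 0 := by
  funext p
  rw [pairsBracket_apply]
  split_ifs
  · exact Finset.sum_eq_zero fun js _ => MultilinearMap.map_coord_zero _ a (ha _)
  · rfl

/-- The values of `l_1` lie in `0 × Ω` and those of `l_n`, `n ≥ 3`, in columns beyond the first.
Hence only `l_2` produces something that a further bracket of arity at least two can see. -/
theorem columnOne_pairsBracket (n : ℕ) (hn : 1 ≤ n) (hn2 : n ≠ 2) (v : Fin n → Ambient A L)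
    (j : ℕ) : columnOne j (pairsBracket ω n v) = 0 := by
  match n with
  | 1 => rfl
  | n + 3 =>
    rw [columnOne_apply, pairsBracket_apply, if_neg (by simp)]
    rfl

/-! Degrees -/

variable {ω} in
theorem unaryBracket_mem {P Q : ℕ → ℕ → Prop} (hPQ : ∀ i j, P (i + 1) j → Q i j)
    {v : Ambient A L} (hv : v ∈ pairsOn ω P) : unaryBracket v ∈ pairsOn ω Q := by
  intro i j
  have hval : unaryBracket v (i, j) =
      if 1 ≤ i then (0, - extDeriv (v (i + 1, j)).2) else 0 := rfl
  constructor
  · rw [hval]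
    split_ifs with hi
    · obtain ⟨i, rfl⟩ : ∃ i', i = i' + 1 := ⟨i - 1, by omega⟩
      have h := (hv (i + 1 + 1) j).1
      by_cases hm : i + 2 + j ≤ m
      · obtain ⟨-, h2⟩ := (mem_component_add_two ω hm).1 h
        have h3 := extDeriv_mem_homForms h2
        have h4 : m - (i + 2 + j) + 1 = m - (i + 1 + j) := by omega
        rw [h4] at h3
        cases i with
        | zero =>
          -- `(0, -dα)` is a Hamiltonian pair because `d² = 0`.
          refine (mem_component_one ω (by omega)).2 ⟨zero_mem _, neg_mem h3, ?_⟩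
          rw [map_neg, extDeriv_extDeriv]
          simp
        | succ i => exact (mem_component_add_two ω (by omega)).2 ⟨rfl, neg_mem h3⟩
      · rw [(mem_component_of_lt ω (by omega)).1 h, Prod.snd_zero, map_zero, neg_zero]
        exact zero_mem _
    · exact zero_mem _
  · intro hQ
    rw [hval, (hv (i + 1) j).2 fun hP => hQ (hPQ i j hP)]
    simp

/-- For two arguments the value has to be a Hamiltonian pair, which is the two-factor case of
`extDeriv_contractR_prod`. For more arguments only the degree of the form has to be counted. -/
theorem pairBracket_mem {n : ℕ} {k : Fin (n + 2) → ℕ} {x : Fin (n + 2) → Λ} (hω : dForm (m + 1) ω = 0)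
    (hx : ∀ a, x a ∈ prodSpan A L (k a + 1))
    (hxω : ∀ a, extDeriv (contractR (x a) ω.total) = 0) (hm : n + 1 + ∑ a, k a ≤ m) :
    pairBracket ω (n + 2) x ∈ component ω (n + 1) (∑ a, k a) := by
  have h := contractR_mem_homForms (s := m - (n + 1 + ∑ a, k a)) (ofFn_prod_mem hx)
    (total_mem_homForms ω) (by rw [Finset.sum_add_distrib]; simp; omega)
  cases n with
  | zero =>
    refine (mem_component_one ω (by omega)).2 ⟨?_, h, ?_⟩
    · rw [pairBracket_two, Fin.sum_univ_two, add_assoc]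
      exact schouten_mem (hx 0) (hx 1)
    · have hω' : extDeriv ω.total = 0 := by
        rw [extDeriv_total, hω]
        exact Pi.single_zero _
      rw [pairBracket_snd, extDeriv_contractR_prod hx hω' hxω, pairSum_two, pairBracket_two]
  | succ n => exact (mem_component_add_two ω (by omega)).2 ⟨rfl, h⟩

/-- The predicates `P` and `Q` stand for any restriction of bidegrees, so that total degree,
bidegree and base row are covered by one argument. -/
theorem pairsBracket_mem {n : ℕ} (hω : dForm (m + 1) ω = 0) {P : Fin (n + 2) → ℕ → ℕ → Prop}
    {Q : ℕ → ℕ → Prop}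
    (hPQ : ∀ k : Fin (n + 2) → ℕ, (∀ a, P a 1 (k a)) → Q (n + 1) (∑ a, k a))
    {v : Fin (n + 2) → Ambient A L} (hv : ∀ a, v a ∈ pairsOn ω (P a)) :
    pairsBracket ω (n + 2) v ∈ pairsOn ω Q := by
  intro i j
  rw [pairsBracket_apply]
  constructor
  · split_ifs with h
    · obtain ⟨rfl, hj⟩ := h
      refine sum_mem fun js hjs => ?_
      obtain rfl := Finset.Nat.mem_antidiagonalTuple.1 hjs
      exact pairBracket_mem ω hω (fun a => columnOne_mem (hv a) _)
        (fun a => extDeriv_contractR_columnOne (hv a) _) hj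
    · exact zero_mem _
  · intro hQ
    split_ifs with h
    · obtain ⟨rfl, hj⟩ := h
      refine Finset.sum_eq_zero fun js hjs => ?_
      obtain rfl := Finset.Nat.mem_antidiagonalTuple.1 hjs
      have : ∃ a, ¬ P a 1 (js a) := by
        by_contra! h
        exact hQ (hPQ js h)
      obtain ⟨a, ha⟩ := this
      exact MultilinearMap.map_coord_zero _ a (columnOne_eq_zero (hv a) ha)
    · rfl

theorem pairsBracket_mem_pairs (hω : dForm (m + 1) ω = 0) {n : ℕ} (hn : 1 ≤ n) (e : Fin n → ℤ)
    (v : Fin n → Ambient A L) (hv : ∀ a, v a ∈ pairs ω (e a)) :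
    pairsBracket ω n v ∈ pairs ω (∑ a, e a - 1) := by
  match n with
  | 1 =>
    refine unaryBracket_mem (fun i j h => ?_) (hv 0)
    rw [Fin.sum_univ_one]
    push_cast at h
    omega
  | n + 2 =>
    refine pairsBracket_mem ω hω (fun k hk => ?_) hv
    rw [← Finset.sum_congr rfl fun a _ => hk a, Finset.sum_add_distrib]
    push_cast
    simp
    ring

theorem pairsBracket_mem_bihomogeneous (hω : dForm (m + 1) ω = 0) {n : ℕ} (hn : 1 ≤ n)
    (p q : Fin n → ℤ) (v : Fin n → Ambient A L) (hv : ∀ a, v a ∈ bihomogeneous ω (p a) (q a)) :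
    pairsBracket ω n v ∈ bihomogeneous ω (∑ a, p a - 1) (∑ a, q a) := by
  match n with
  | 1 =>
    refine unaryBracket_mem (fun i j h => ?_) (hv 0)
    rw [Fin.sum_univ_one, Fin.sum_univ_one]
    push_cast at h
    omega
  | n + 2 =>
    refine pairsBracket_mem ω hω (fun k hk => ?_) hv
    rw [← Finset.sum_congr rfl fun a _ => (hk a).1, ← Finset.sum_congr rfl fun a _ => (hk a).2]
    push_cast
    simp
    ring

theorem pairsBracket_mem_baseRow (hω : dForm (m + 1) ω = 0) {n : ℕ} (hn : 1 ≤ n) (e : Fin n → ℤ)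
    (v : Fin n → Ambient A L) (hv : ∀ a, v a ∈ baseRow ω (e a)) :
    pairsBracket ω n v ∈ baseRow ω (∑ a, e a - 1) := by
  match n with
  | 1 =>
    refine unaryBracket_mem (fun i j h => ?_) (hv 0)
    rw [Fin.sum_univ_one]
    push_cast at h
    omega
  | n + 2 =>
    refine pairsBracket_mem ω hω (fun k hk => ?_) hv
    rw [← Finset.sum_congr rfl fun a _ => (hk a).1]
    refine ⟨?_, Finset.sum_eq_zero fun a _ => (hk a).2⟩
    push_cast
    simp
    ring

/-! ### The grading by total degree -/

theorem baseRow_le_pairs (k : ℤ) : baseRow ω k ≤ pairs ω k := fun v hv i j =>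
  ⟨(hv i j).1, fun h => (hv i j).2 fun h' => h (by rw [h'.2]; simpa using h'.1)⟩

theorem pairs_eq_bot (k : ℤ) (hk : k ≤ 0) : pairs ω k = ⊥ := by
  refine (Submodule.eq_bot_iff _).2 fun v hv => ?_
  funext ⟨i, j⟩
  by_cases h : (i + j : ℤ) = k
  · exact pairsOn_apply_eq_zero hv (Or.inl (by omega))
  · exact (hv i j).2 h

theorem iSupIndep_pairs : iSupIndep (pairs ω) := by
  intro k
  rw [Submodule.disjoint_def]
  intro v hv hv'
  -- The families that vanish on the antidiagonal `i + j = k` form a subspace containing all the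
  -- other graded pieces.
  let S : Submodule ℝ (Ambient A L) :=
    { carrier := {w | ∀ i j : ℕ, (i + j : ℤ) = k → w (i, j) = 0}
      add_mem' := fun {w w'} h h' i j hij => by rw [Pi.add_apply, h i j hij, h' i j hij, add_zero]
      zero_mem' := fun _ _ _ => rfl
      smul_mem' := fun r w h i j hij => by rw [Pi.smul_apply, h i j hij, smul_zero] }
  have hS : ⨆ l, ⨆ (_ : l ≠ k), pairs ω l ≤ S := by
    refine iSup₂_le fun l hl w hw i j hij => (hw i j).2 fun h => hl ?_
    rw [← h, ← hij]
  funext ⟨i, j⟩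
  by_cases h : (i + j : ℤ) = k
  · exact hS hv' i j h
  · exact (hv i j).2 h

/-- Homogeneous elements either have a vanishing entry, or are of positive degrees. -/
theorem exists_eq_zero_or_degrees {n : ℕ} {e : Fin n → ℤ} {v : Fin n → Ambient A L}
    (hv : ∀ a, v a ∈ pairs ω (e a)) :
    (∃ a, v a = 0) ∨ ∃ k : Fin n → ℕ, e = fun a => ((k a + 1 : ℕ) : ℤ) := by
  by_cases h : ∃ a, e a ≤ 0
  · obtain ⟨a, ha⟩ := h
    have := hv a
    rw [pairs_eq_bot ω _ ha] at this
    exact Or.inl ⟨a, this⟩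
  · push Not at h
    refine Or.inr ⟨fun a => (e a - 1).toNat, funext fun a => ?_⟩
    have := h a
    push_cast
    omega

/-- In total degree `k + 1` the first column is occupied only at `j = k`, by a multivector field of
the same degree `k + 1`. This lets the Koszul signs be read in the exterior algebra. -/
theorem columnOne_eq_zero_of_mem_pairs {k : ℕ} {v : Ambient A L}
    (hv : v ∈ pairs ω ((k + 1 : ℕ) : ℤ)) (j : ℕ) (hj : j ≠ k) : columnOne j v = 0 :=
  columnOne_eq_zero hv fun h => hj (by push_cast at h; omega)

/-! Symmetry -/

/-- The form part is symmetric because products in the exterior algebra are. The multivector part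
occurs for two arguments only, where the transposition is the symmetry of `ν`. -/
theorem pairBracket_symm {n : ℕ} {k : Fin (n + 2) → ℕ} {x : Fin (n + 2) → Λ}
    (hx : ∀ a, x a ∈ prodSpan A L (k a)) (σ : Equiv.Perm (Fin (n + 2))) :
    koszulSign (fun a => (k a : ℤ)) σ • pairBracket ω (n + 2) (x ∘ σ) = pairBracket ω (n + 2) x := by
  refine Prod.ext ?_ ?_
  · cases n with
    | zero =>
      obtain ⟨a, τ, rfl⟩ := exists_consPerm σ
      obtain rfl := Subsingleton.elim τ 1
      rw [koszulSign_consPerm, koszulSign_one, mul_one]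
      fin_cases a
      · have : consPerm (0 : Fin 2) 1 = 1 := by decide
        simp [this]
      · have h0 : consPerm (1 : Fin 2) 1 0 = 1 := by decide
        have h1 : consPerm (1 : Fin 2) 1 1 = 0 := by decide
        change moveSign (fun a => (k a : ℤ)) (Fin.succ 0) • schouten (x (consPerm (1 : Fin 2) 1 0))
          (x (consPerm (1 : Fin 2) 1 1)) = schouten (x 0) (x 1)
        rw [moveSign_succ, moveSign_zero, mul_one, h0, h1, ← Nat.cast_mul, negOnePow_smul,
          schouten_symm (hx 0) (hx 1), mul_comm (k 0)]
        rfl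
    | succ n => exact smul_zero _
  · change koszulSign (fun a => (k a : ℤ)) σ • (pairBracket ω (n + 2) (x ∘ σ)).2 = _
    rw [pairBracket_snd, pairBracket_snd, ← koszulSign_smul_prod hx σ]
    exact (map_units_smul (contractR.flip ω.total) _ _).symm

theorem pairsBracket_symm {n : ℕ} (hn : 1 ≤ n) (e : Fin n → ℤ) (v : Fin n → Ambient A L)
    (hv : ∀ a, v a ∈ pairs ω (e a)) (σ : Equiv.Perm (Fin n)) :
    koszulSign e σ • pairsBracket ω n (v ∘ σ) = pairsBracket ω n v := by
  match n with
  | 1 =>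
    obtain rfl := Subsingleton.elim σ 1
    simp
  | n + 2 =>
    rcases exists_eq_zero_or_degrees ω hv with ⟨a, ha⟩ | ⟨k, rfl⟩
    · rw [MultilinearMap.map_coord_zero _ a ha, MultilinearMap.map_coord_zero _ (σ.symm a) (by simp [ha]),
        smul_zero]
    · funext p
      rw [Pi.smul_apply, pairsBracket_apply_of_columnOne ω n v k fun a =>
          columnOne_eq_zero_of_mem_pairs ω (hv a),
        pairsBracket_apply_of_columnOne ω n (v ∘ σ) (k ∘ σ) fun a =>
          columnOne_eq_zero_of_mem_pairs ω (hv (σ a))]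
      simp only [Function.comp_apply, Equiv.sum_comp σ k]
      split_ifs
      · exact pairBracket_symm ω (k := fun a => k a + 1) (fun a => columnOne_mem (hv a) _) σ
      · exact smul_zero _

end Brackets

/-! ### The Jacobi identities -/

section Jacobi
variable {A L : Type*} [CommRing A] [Algebra ℝ A] [LieRing L] [LieAlgebra ℝ L] [Module A L]
  [LieRingModule L A] [LieRinehartRing A L] [LieRinehartAlgebra ℝ A L]

local notation "Λ" => Multivectors A L

/-- The graded Jacobi identity of the Schouten bracket, as a sum over unshuffles. -/
theorem sum_schouten_schouten {j : Fin 3 → ℕ} {x : Fin 3 → Λ}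
    (hx : ∀ a, x a ∈ prodSpan A L (j a + 1)) :
    (∑ a : Fin 3, ∑ b : Fin 2, if a ≤ b.castSucc then
      (moveSign (fun i => ((j i + 1 : ℕ) : ℤ)) a *
          moveSign (fun i => ((j (a.succAbove i) + 1 : ℕ) : ℤ)) b) •
        schouten (schouten (x a) (x (a.succAbove b))) (x (a.succAbove (b.succAbove 0))) else 0) =
      0 := by
  -- The three `(2, 1)`-unshuffles put the pairs `(0, 1)`, `(0, 2)` and `(1, 2)` in front.
  have h : (∑ a : Fin 3, ∑ b : Fin 2, if a ≤ b.castSucc then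
      (moveSign (fun i => ((j i + 1 : ℕ) : ℤ)) a *
          moveSign (fun i => ((j (a.succAbove i) + 1 : ℕ) : ℤ)) b) •
        schouten (schouten (x a) (x (a.succAbove b))) (x (a.succAbove (b.succAbove 0))) else 0) =
      schouten (schouten (x 0) (x 1)) (x 2) +
      Int.negOnePow (((j 2 + 1) * (j 1 + 1) : ℕ) : ℤ) • schouten (schouten (x 0) (x 2)) (x 1) +
      (Int.negOnePow (((j 1 + 1) * (j 0 + 1) : ℕ) : ℤ) *
        Int.negOnePow (((j 2 + 1) * (j 0 + 1) : ℕ) : ℤ)) •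
          schouten (schouten (x 1) (x 2)) (x 0) := by
    have s1 (e : Fin 2 → ℤ) : moveSign e 1 = Int.negOnePow (e 1 * e 0) := by
      rw [← Fin.succ_zero_eq_one, moveSign_succ, moveSign_zero, mul_one]
    have s2 (e : Fin 3 → ℤ) : moveSign e 1 = Int.negOnePow (e 1 * e 0) := by
      rw [← Fin.succ_zero_eq_one, moveSign_succ, moveSign_zero, mul_one]
    have t1 : Fin.succAbove (1 : Fin 3) 0 = 0 := rfl
    have t2 : Fin.succAbove (1 : Fin 3) 1 = 2 := rfl
    have t3 : Fin.succAbove (1 : Fin 2) 0 = 0 := rfl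
    have c1 : ¬ (1 : Fin 3) ≤ 0 := by decide
    have c2 : ¬ (2 : Fin 3) ≤ 0 := by decide
    have c3 : ¬ (2 : Fin 3) ≤ 1 := by decide
    simp only [Fin.sum_univ_three, Fin.sum_univ_two, Fin.castSucc_zero, Fin.castSucc_one,
      if_neg c1, if_neg c2, if_neg c3, moveSign_zero, s1, s2, t1, t2, t3, le_refl, if_true,
      Fin.zero_le, one_mul, one_smul, zero_add, add_zero, Fin.zero_succAbove, Fin.succ_zero_eq_one,
      Fin.succ_one_eq_two, Nat.cast_mul]
  have h0 : schouten (x 0) (x 1) ∈ prodSpan A L (j 0 + (j 1 + 1)) := schouten_mem (hx 0) (hx 1)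
  have h1 : schouten (x 0) (x 2) ∈ prodSpan A L (j 0 + (j 2 + 1)) := schouten_mem (hx 0) (hx 2)
  have h2 : schouten (x 1) (x 2) ∈ prodSpan A L (j 1 + (j 2 + 1)) := schouten_mem (hx 1) (hx 2)
  rw [h, mul_smul, negOnePow_smul, negOnePow_smul, negOnePow_smul,
    schouten_schouten (hx 0) (hx 1) (hx 2), schouten_symm (hx 0) h2, schouten_symm (hx 1) h1]
  rcases neg_one_pow_eq_or ℝ (j 0) with h | h <;> rcases neg_one_pow_eq_or ℝ (j 1) with h' | h' <;>
  rcases neg_one_pow_eq_or ℝ (j 2) with h'' | h'' <;>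
    simp [pow_add, pow_mul, mul_add, h, h', h'']
  abel

variable {m : ℕ} (ω : Form A L (m + 1))

/-! ### The composites in the Jacobi identities -/

theorem bracketComp_pairsBracket_eq_zero {p q : ℕ} (hp : 1 ≤ p) (hp2 : p ≠ 2) (hq : q ≠ 0)
    (e : Fin (p + q) → ℤ) (v : Fin (p + q) → Ambient A L) :
    bracketComp (pairsBracket ω) p q e v = 0 := by
  obtain ⟨q, rfl⟩ := Nat.exists_eq_succ_of_ne_zero hq
  refine Finset.sum_eq_zero fun σ _ => ?_
  rw [pairsBracket_eq_zero ω q _ 0, smul_zero]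
  intro j
  rw [Fin.cons_zero]
  exact columnOne_pairsBracket ω p hp hp2 _ j

theorem unaryBracket_unaryBracket (v : Ambient A L) : unaryBracket (unaryBracket v) = 0 := by
  funext p
  change (if 1 ≤ p.1 then (0, - extDeriv (if 1 ≤ p.1 + 1 then
    ((0, - extDeriv (v (p.1 + 1 + 1, p.2)).2) : Multivectors A L × Forms A L) else 0).2) else 0) = 0
  rw [if_pos (Nat.le_add_left 1 p.1)]
  split_ifs
  · rw [map_neg, extDeriv_extDeriv]
    simp
  · rfl

theorem unaryBracket_pairsBracket_two (v : Fin 2 → Ambient A L) :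
    unaryBracket (pairsBracket ω 2 v) = 0 := by
  funext p
  change (if 1 ≤ p.1 then ((0, - extDeriv (pairsBracket ω 2 v (p.1 + 1, p.2)).2) :
    Multivectors A L × Forms A L) else 0) = 0
  split_ifs with h
  · rw [pairsBracket_apply, if_neg (by simp; omega)]
    simp
  · rfl

/-- The composite `l_1 l_n` for `n ≥ 3`, put in the form in which it cancels against the terms with
an inner `l_2`. -/
theorem unaryBracket_pairsBracket {n : ℕ} (hω : dForm (m + 1) ω = 0) {k : Fin (n + 3) → ℕ}
    {v : Fin (n + 3) → Ambient A L} (hv : ∀ a, v a ∈ pairs ω ((k a + 1 : ℕ) : ℤ)) (p : ℕ × ℕ) :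
    unaryBracket (pairsBracket ω (n + 3) v) p =
      if p.1 = n + 1 ∧ p.1 + p.2 ≤ m ∧ p.2 = ∑ a, k a then
        (0, - contractR (pairSum (fun a => k a + 1) fun a => columnOne (k a) (v a)) ω.total)
      else 0 := by
  change (if 1 ≤ p.1 then ((0, - extDeriv (pairsBracket ω (n + 3) v (p.1 + 1, p.2)).2) :
    Multivectors A L × Forms A L) else 0) = _
  have hω' : extDeriv ω.total = 0 := by
    rw [extDeriv_total, hω]
    exact Pi.single_zero _
  have hx a : columnOne (k a) (v a) ∈ prodSpan A L (k a + 1) := columnOne_mem (hv a) _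
  rw [pairsBracket_apply_of_columnOne ω (n + 1) v k fun a => columnOne_eq_zero_of_mem_pairs ω (hv a),
    ← extDeriv_contractR_prod hx hω' fun a => extDeriv_contractR_columnOne (hv a) _]
  by_cases h : p.1 = n + 1 ∧ p.1 + p.2 ≤ m ∧ p.2 = ∑ a, k a
  · rw [if_pos h, if_pos (by omega)]
    by_cases h' : p.1 + 1 + p.2 ≤ m
    · rw [if_pos ⟨congrArg (· + 1) h.1, h', h.2.2⟩, pairBracket_snd]
    · rw [if_neg fun h'' => h' h''.2.1]
      -- Here `p.1 + p.2 = m`, so the inner bracket has no component to take values in. The form it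
      -- would give vanishes anyway: the product of multivector fields has degree `m + 2`, more than
      -- that of `ω`.
      have h0 : contractR (List.ofFn fun a => columnOne (k a) (v a)).prod ω.total = 0 := by
        funext i
        refine contractR_apply_eq_zero (ofFn_prod_mem hx) (total_mem_homForms ω) ?_
        rw [Finset.sum_add_distrib]
        simp
        omega
      rw [h0]
      rfl
  · rw [if_neg h, if_neg fun h' : p.1 + 1 = n + 1 + 1 ∧ p.1 + 1 + p.2 ≤ m ∧ p.2 = ∑ a, k a =>
      h ⟨by omega, by omega, h'.2.2⟩]
    simp

/-- The form part is the contraction with `pairSum` for any number of arguments. A multivector part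
can arise only from an outer `l_2`, that is for three arguments, and it vanishes by the Jacobi
identity of `ν`. -/
theorem sum_bracketComp_two {n : ℕ} (hω : dForm (m + 1) ω = 0) {k : Fin (n + 3) → ℕ}
    {v : Fin (n + 3) → Ambient A L} (hv : ∀ a, v a ∈ pairs ω ((k a + 1 : ℕ) : ℤ)) (p : ℕ × ℕ) :
    (∑ a : Fin (n + 3), ∑ b : Fin (n + 2), if a ≤ b.castSucc then
        (moveSign (fun i => ((k i + 1 : ℕ) : ℤ)) a *
            moveSign (fun i => ((k (a.succAbove i) + 1 : ℕ) : ℤ)) b) •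
          pairsBracket ω (n + 2) (Fin.cons (pairsBracket ω 2 ![v a, v (a.succAbove b)])
            fun c => v (a.succAbove (b.succAbove c))) else 0) p =
      if p.1 = n + 1 ∧ p.1 + p.2 ≤ m ∧ p.2 = ∑ a, k a then
        (0, contractR (pairSum (fun a => k a + 1) fun a => columnOne (k a) (v a)) ω.total)
      else 0 := by
  have hval (a : Fin (n + 3)) (b : Fin (n + 2)) :
      pairsBracket ω (n + 2) (Fin.cons (pairsBracket ω 2 ![v a, v (a.succAbove b)])
        fun c => v (a.succAbove (b.succAbove c))) p =
      if p.1 = n + 1 ∧ p.1 + p.2 ≤ m ∧ p.2 = ∑ a, k a then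
        pairBracket ω (n + 2) (Fin.cons
          (schouten (columnOne (k a) (v a)) (columnOne (k (a.succAbove b)) (v (a.succAbove b))))
          fun c => columnOne (k (a.succAbove (b.succAbove c))) (v (a.succAbove (b.succAbove c))))
      else 0 := by
    let k' : Fin (n + 2) → ℕ := Fin.cons (k a + k (a.succAbove b))
      fun c => k (a.succAbove (b.succAbove c))
    have hsum : ∑ c, k' c = ∑ c, k c := by
      rw [Fin.sum_univ_succ, Fin.sum_univ_succAbove k a, Fin.sum_univ_succAbove _ b, ← add_assoc]
      rfl
    -- Ensures that the inner bracket is not cut off by the bound `m` when the outer one is not.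
    have hle : k a + k (a.succAbove b) ≤ ∑ c, k c := by
      rw [← hsum, Fin.sum_univ_succ]
      exact Nat.le_add_right _ _
    have hab (i : Fin 2) : (![v a, v (a.succAbove b)] i) ∈
        pairs ω ((![k a, k (a.succAbove b)] i + 1 : ℕ) : ℤ) := by
      fin_cases i
      · exact hv a
      · exact hv (a.succAbove b)
    have h2 : pairsBracket ω 2 ![v a, v (a.succAbove b)] ∈
        pairs ω ((k a + k (a.succAbove b) + 1 : ℕ) : ℤ) := by
      have := pairsBracket_mem_pairs ω hω one_le_two _ _ hab
      convert this using 2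
      rw [Fin.sum_univ_two]
      simp
      ring
    rw [pairsBracket_apply_of_columnOne ω n _ k', hsum]
    · by_cases h : p.1 = n + 1 ∧ p.1 + p.2 ≤ m ∧ p.2 = ∑ a, k a
      · rw [if_pos h, if_pos h]
        congr 1
        funext c
        refine Fin.cases ?_ (fun c => rfl) c
        change columnOne (k a + k (a.succAbove b)) (pairsBracket ω 2 _) = _
        rw [columnOne_apply, pairsBracket_apply_of_columnOne ω 0 _ _ fun i =>
          columnOne_eq_zero_of_mem_pairs ω (hab i), if_pos, pairBracket_two]
        · rfl
        · rw [Fin.sum_univ_two]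
          exact ⟨rfl, by simp only; omega, rfl⟩
      · rw [if_neg h, if_neg h]
    · intro c
      refine Fin.cases ?_ (fun c => ?_) c
      · exact columnOne_eq_zero_of_mem_pairs ω h2
      · exact columnOne_eq_zero_of_mem_pairs ω (hv _)
  have hx a : columnOne (k a) (v a) ∈ prodSpan A L (k a + 1) := columnOne_mem (hv a) _
  simp only [Finset.sum_apply]
  simp only [apply_ite (fun f : Ambient A L => f p), Pi.smul_apply, hval, Pi.zero_apply]
  split_ifs with h
  · refine Prod.ext ?_ ?_
    · rw [Prod.fst_sum]
      simp only [Prod.fst_sum, apply_ite Prod.fst, Prod.smul_fst, Prod.fst_zero]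
      cases n with
      | zero => exact sum_schouten_schouten hx
      | succ n =>
        refine Finset.sum_eq_zero fun a _ => Finset.sum_eq_zero fun b _ => ?_
        rw [pairBracket_add_three, smul_zero, ite_self]
    · simp only [Prod.snd_sum, apply_ite Prod.snd, Prod.smul_snd, Prod.snd_zero, pairBracket_snd,
        List.ofFn_succ (f := Fin.cons _ _), List.prod_cons, Fin.cons_zero, Fin.cons_succ]
      change _ = contractR.flip ω.total (pairSum _ _)
      rw [pairSum, map_sum]
      simp only [map_sum, apply_ite (contractR.flip ω.total), map_units_smul, map_zero]
      rfl
  · simp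

theorem pairsBracket_jacobi (hω : dForm (m + 1) ω = 0) {n : ℕ} (hn : 1 ≤ n) (e : Fin n → ℤ)
    (v : Fin n → Ambient A L) (hv : ∀ a, v a ∈ pairs ω (e a)) :
    ∑ i : Fin n, bracketComp (pairsBracket ω) (i + 1) (n - (i + 1))
      (fun a => e (Fin.cast (by omega) a)) (fun a => v (Fin.cast (by omega) a)) = 0 := by
  rcases exists_eq_zero_or_degrees ω hv with ⟨a, ha⟩ | ⟨k, rfl⟩
  · refine Finset.sum_eq_zero fun i _ => ?_
    refine bracketComp_eq_zero _ _ _ (Fin.cast (by omega) a) ?_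
    simpa using ha
  · have hlast {p q : ℕ} (h : p + q = n) (hq : q = 0) :=
      bracketComp_last (pairsBracket ω) h hq (fun a => ((k a + 1 : ℕ) : ℤ)) v
    match n with
    | 1 =>
      rw [Fin.sum_univ_one]
      exact (hlast _ rfl).trans (unaryBracket_unaryBracket _)
    | 2 =>
      rw [Fin.sum_univ_two, bracketComp_pairsBracket_eq_zero ω (by decide) (by decide) (by decide),
        zero_add]
      exact (hlast _ rfl).trans (unaryBracket_pairsBracket_two ω v)
    | n + 3 =>
      -- The index `1` is the inner bracket of arity two and the last index is the outer unary
      -- bracket; all other composites vanish.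
      rw [Fintype.sum_eq_add (1 : Fin (n + 3)) (Fin.last (n + 2))]
      · refine (congrArg₂ (· + ·) (bracketComp_two (pairsBracket ω) _ (by simp)
          (fun a => ((k a + 1 : ℕ) : ℤ)) v) (hlast _ (by simp))).trans ?_
        funext p
        change _ + unaryBracket (pairsBracket ω (n + 3) v) p = 0
        rw [sum_bracketComp_two ω hω hv, unaryBracket_pairsBracket ω hω hv]
        split_ifs <;> simp
      · intro h
        have := congrArg Fin.val h
        simp at this
      · rintro i ⟨h1, h2⟩
        refine bracketComp_pairsBracket_eq_zero ω (by omega) ?_ ?_ _ _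
        · intro h
          refine h1 (Fin.ext ?_)
          simp
          omega
        · intro h
          refine h2 (Fin.ext ?_)
          simp
          omega

theorem isLInfinityAlgebra_pairs (hω : dForm (m + 1) ω = 0) :
    IsLInfinityAlgebra (pairs ω) (pairsBracket ω) where
  graded := iSupIndep_pairs ω
  positive := pairs_eq_bot ω
  degree _ hn := pairsBracket_mem_pairs ω hω hn
  symmetric _ hn := pairsBracket_symm ω hn
  jacobi _ hn := pairsBracket_jacobi ω hω hn

theorem isLInfinitySubalgebra_baseRow (hω : dForm (m + 1) ω = 0) :
    IsLInfinitySubalgebra (baseRow ω) (pairs ω) (pairsBracket ω) where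
  le := baseRow_le_pairs ω
  closed _ hn := pairsBracket_mem_baseRow ω hω hn

end Jacobi

/-! ### The base row and the Poisson Lie `m`-algebra -/

section Poisson
variable {A L : Type*} [CommRing A] [Algebra ℝ A] [LieRing L] [LieAlgebra ℝ L] [Module A L]
  [LieRingModule L A] [LieRinehartRing A L] [LieRinehartAlgebra ℝ A L]

local notation "Λ" => Multivectors A L

variable {m : ℕ} (ω : Form A L (m + 1))

theorem mem_poissonLie {k : ℕ} (hk : k + 1 ≤ m) {z : L × Forms A L} :
    z ∈ poissonLie ω k ↔ z.2 ∈ homForms A L (m - (k + 1)) ∧ (k ≠ 0 → z.1 = 0) ∧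
      (k = 0 → contractVF z.1 ω.total = - extDeriv z.2) := by
  rw [poissonLie]
  by_cases h : k = 0
  · subst h
    rw [if_pos ⟨rfl, hk⟩]
    simp only [ne_eq, not_true_eq_false, false_imp_iff, true_and, true_imp_iff]
    exact Iff.rfl
  · rw [if_neg (by omega), if_pos (by omega), Submodule.mem_prod, Submodule.mem_bot]
    simp only [h, ne_eq, not_false_eq_true, true_imp_iff, false_imp_iff, and_true, Int.toNat_natCast]
    rw [and_comm, Nat.sub_sub, Nat.add_comm 1 k]

theorem poissonLie_eq_bot {k : ℤ} (hk : ¬ ∃ i : ℕ, k = i ∧ i + 1 ≤ m) : poissonLie ω k = ⊥ := by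
  rw [poissonLie, if_neg, if_neg]
  · exact fun h => hk ⟨k.toNat, by omega, by omega⟩
  · exact fun h => hk ⟨0, h.1, by omega⟩

theorem baseRow_eq_bot {k : ℤ} (hk : ¬ ∃ i : ℕ, k = i ∧ i + 1 ≤ m) : baseRow ω (k + 1) = ⊥ := by
  refine (Submodule.eq_bot_iff _).2 fun v hv => ?_
  funext ⟨i, j⟩
  by_cases h : (i : ℤ) = k + 1 ∧ j = 0
  · refine pairsOn_apply_eq_zero hv ?_
    by_contra! h'
    exact hk ⟨i - 1, by omega, by omega⟩
  · exact (hv i j).2 h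

/-! ### The inclusion on homogeneous elements -/

theorem poissonLieInclusion_apply_row (z : L × Forms A L) {i : ℕ} (hi : 1 ≤ i) (him : i ≤ m) :
    poissonLieInclusion A L m z (i, 0) =
      (if i = 1 then vf z.1 else 0, - Form.total (z.2 (m - i))) :=
  if_pos ⟨hi, him, rfl⟩

theorem poissonLieInclusion_apply_eq_zero (z : L × Forms A L) {i j : ℕ}
    (h : ¬ (1 ≤ i ∧ i ≤ m ∧ j = 0)) : poissonLieInclusion A L m z (i, j) = 0 :=
  if_neg h

theorem total_zero {n : ℕ} : (0 : Form A L n).total = 0 := Pi.single_zero n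

/-- The inclusion is given by one formula in all degrees, which distributes the components of a form
over the columns. A homogeneous element has a single component and so meets a single column. -/
theorem poissonLieInclusion_of_mem {k : ℕ} (hk : k + 1 ≤ m) {z : L × Forms A L}
    (hz : z ∈ poissonLie ω k) :
    poissonLieInclusion A L m z = Pi.single (k + 1, 0) (vf z.1, - z.2) := by
  obtain ⟨h1, h2, -⟩ := (mem_poissonLie ω hk).1 hz
  funext ⟨i, j⟩
  by_cases h3 : 1 ≤ i ∧ i ≤ m ∧ j = 0
  · obtain ⟨hi, him, rfl⟩ := h3
    rw [poissonLieInclusion_apply_row z hi him]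
    by_cases h : i = k + 1
    · subst h
      rw [Pi.single_eq_same, total_eq_self h1]
      by_cases hk0 : k = 0
      · rw [if_pos (by omega)]
      · rw [h2 hk0, map_zero, ite_self]
    · rw [Pi.single_eq_of_ne (by simpa using h), mem_homForms.1 h1 _ (by omega), total_zero]
      by_cases hk0 : k = 0
      · rw [if_neg (by omega), neg_zero]
        rfl
      · rw [h2 hk0, map_zero, ite_self, neg_zero]
        rfl
  · rw [poissonLieInclusion_apply_eq_zero z h3, Pi.single_eq_of_ne]
    intro h
    obtain ⟨rfl, rfl⟩ := Prod.mk.inj h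
    exact h3 ⟨by omega, hk, rfl⟩

theorem single_mem_baseRow {k : ℕ} {w : Multivectors A L × Forms A L}
    (hw : w ∈ component ω (k + 1) 0) :
    (Pi.single (k + 1, 0) w : Ambient A L) ∈ baseRow ω ((k : ℤ) + 1) := by
  intro i j
  by_cases h : (i, j) = (k + 1, 0)
  · obtain ⟨rfl, rfl⟩ := Prod.mk.inj h
    rw [Pi.single_eq_same]
    exact ⟨hw, fun h => (h ⟨by push_cast; rfl, rfl⟩).elim⟩
  · rw [Pi.single_eq_of_ne h]
    exact ⟨zero_mem _, fun _ => rfl⟩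

theorem eq_single_of_mem_baseRow {k : ℕ} {v : Ambient A L} (hv : v ∈ baseRow ω ((k : ℤ) + 1)) :
    v = Pi.single (k + 1, 0) (v (k + 1, 0)) := by
  funext ⟨i, j⟩
  by_cases h : (i, j) = (k + 1, 0)
  · rw [h, Pi.single_eq_same]
  · rw [Pi.single_eq_of_ne h]
    refine (hv i j).2 fun h' => h ?_
    rw [h'.2]
    congr 1
    omega

theorem exists_vf_of_mem {x : Λ} (hx : x ∈ prodSpan A L 1) : ∃ X : L, vf X = x := by
  have h := prodSpan_le hx
  change _ ∈ (LinearMap.range (ExteriorAlgebra.ι A)) ^ 1 at h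
  rwa [pow_one] at h

/-- The inclusion identifies the Poisson Lie `m`-algebra with the base row. -/
theorem bijOn_poissonLieInclusion (k : ℤ) :
    Set.BijOn (poissonLieInclusion A L m) (poissonLie ω k) (baseRow ω (k + 1)) := by
  by_cases hk : ∃ i : ℕ, k = i ∧ i + 1 ≤ m
  · obtain ⟨k, rfl, hk⟩ := hk
    refine ⟨fun z hz => ?_, fun z hz z' hz' h => ?_, fun v hv => ?_⟩
    · obtain ⟨h1, h2, h3⟩ := (mem_poissonLie ω hk).1 hz
      rw [poissonLieInclusion_of_mem ω hk hz]
      refine single_mem_baseRow ω ?_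
      cases k with
      | zero =>
        refine (mem_component_one ω (by omega)).2 ⟨vf_mem_prodSpan _, neg_mem h1, ?_⟩
        -- The sign in the inclusion turns the convention `ι_v ω = -dα` into `ι_v ω = d(-α)`.
        rw [contractR_vf, h3 rfl, map_neg]
      | succ k =>
        exact (mem_component_add_two ω (by omega)).2
          ⟨by simp [h2 (Nat.succ_ne_zero k)], neg_mem h1⟩
    · rw [poissonLieInclusion_of_mem ω hk hz, poissonLieInclusion_of_mem ω hk hz'] at h
      have h := congrFun h (k + 1, 0)
      rw [Pi.single_eq_same, Pi.single_eq_same] at h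
      obtain ⟨h1, h2⟩ := Prod.mk.inj h
      exact Prod.ext ((ExteriorAlgebra.ι_inj A _ _).1 h1) (neg_injective h2)
    · have h := (hv (k + 1) 0).1
      obtain ⟨X, hX, hz⟩ : ∃ X : L, vf X = (v (k + 1, 0)).1 ∧
          (X, - (v (k + 1, 0)).2) ∈ poissonLie ω k := by
        cases k with
        | zero =>
          obtain ⟨h1, h2, h3⟩ := (mem_component_one ω (by omega)).1 h
          obtain ⟨X, hX⟩ := exists_vf_of_mem h1
          refine ⟨X, hX, (mem_poissonLie ω hk).2 ⟨neg_mem h2, by simp, fun _ => ?_⟩⟩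
          rw [map_neg, neg_neg, ← h3, ← hX, contractR_vf]
        | succ k =>
          obtain ⟨h1, h2⟩ := (mem_component_add_two ω (by omega)).1 h
          exact ⟨0, by rw [h1, map_zero], (mem_poissonLie ω hk).2 ⟨neg_mem h2, by simp, by simp⟩⟩
      refine ⟨_, hz, ?_⟩
      rw [poissonLieInclusion_of_mem ω hk hz, hX, neg_neg]
      exact (eq_single_of_mem_baseRow ω hv).symm
  · rw [poissonLie_eq_bot ω hk, baseRow_eq_bot ω hk]
    simp [Set.bijOn_singleton]

theorem fst_eq_zero_of_mem_poissonLie {e : ℤ} (he : e ≠ 0) {z : L × Forms A L}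
    (hz : z ∈ poissonLie ω e) : z.1 = 0 := by
  by_cases hk : ∃ i : ℕ, e = i ∧ i + 1 ≤ m
  · obtain ⟨k, rfl, hk⟩ := hk
    exact ((mem_poissonLie ω hk).1 hz).2.1 (by simpa using he)
  · rw [poissonLie_eq_bot ω hk] at hz
    rw [(Submodule.mem_bot ℝ).1 hz, Prod.fst_zero]

theorem unaryBracket_poissonLieInclusion (z : Fin 1 → L × Forms A L) :
    unaryBracket (poissonLieInclusion A L m (z 0)) =
      - poissonLieInclusion A L m (poissonLieBracket ω 1 z) := by
  funext ⟨i, j⟩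
  change (if 1 ≤ i then (0, - extDeriv (poissonLieInclusion A L m (z 0) (i + 1, j)).2) else 0) =
    - poissonLieInclusion A L m (0, fun p => if p + 1 ≤ m then extDeriv (z 0).2 p else 0) (i, j)
  by_cases h : 1 ≤ i ∧ i ≤ m ∧ j = 0
  · obtain ⟨hi, him, rfl⟩ := h
    rw [if_pos hi, poissonLieInclusion_apply_row _ hi him]
    refine Prod.ext (by simp) ?_
    change - extDeriv (poissonLieInclusion A L m (z 0) (i + 1, 0)).2 = - - Form.total
      (if m - i + 1 ≤ m then extDeriv (z 0).2 (m - i) else 0)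
    rw [if_pos (by omega), neg_neg]
    by_cases hm : i + 1 ≤ m
    · have hq : m - i = m - (i + 1) + 1 := by omega
      rw [poissonLieInclusion_apply_row _ (by omega) hm, map_neg, neg_neg, extDeriv_total, hq,
        extDeriv_succ]
    -- In the last column, `i = m`, there is no column to the right, and in form degree zero there
    -- are no exact forms.
    · have hq : m - i = 0 := by omega
      rw [poissonLieInclusion_apply_eq_zero _ fun h => hm h.2.1, hq, extDeriv_zero_deg, total_zero,
        Prod.snd_zero, map_zero, neg_zero]
  · rw [poissonLieInclusion_apply_eq_zero _ h, neg_zero]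
    by_cases hi : 1 ≤ i
    · rw [if_pos hi, poissonLieInclusion_apply_eq_zero _ fun h' => h ⟨hi, by omega, h'.2.2⟩,
        Prod.snd_zero, map_zero, neg_zero]
      rfl
    · rw [if_neg hi]

theorem columnOne_poissonLieInclusion (z : L × Forms A L) (j : ℕ) :
    columnOne j (poissonLieInclusion A L m z) = if 1 ≤ m ∧ j = 0 then vf z.1 else 0 := by
  rw [columnOne_apply]
  by_cases h : 1 ≤ m ∧ j = 0
  · obtain ⟨h, rfl⟩ := h
    rw [poissonLieInclusion_apply_row z le_rfl h, if_pos rfl, if_pos ⟨h, rfl⟩]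
  · rw [poissonLieInclusion_apply_eq_zero z fun h' => h h'.2, if_neg h, Prod.fst_zero]

/-- A contraction with `n + 2` vector fields has the form degree of column `n + 1`. The condition on
`X` reflects that a bracket of arity `n + 2` has a vector field part only if it is binary. -/
theorem poissonLieInclusion_contractR {n : ℕ} {x : Λ} (hx : x ∈ prodSpan A L (n + 2)) {X : L}
    (hX : n ≠ 0 → X = 0) (p : ℕ × ℕ) :
    poissonLieInclusion A L m (X, - contractR x ω.total) p =
      if p.1 = n + 1 ∧ p.1 + p.2 ≤ m ∧ p.2 = 0 then (vf X, contractR x ω.total) else 0 := by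
  obtain ⟨i, j⟩ := p
  by_cases h1 : 1 ≤ i ∧ i ≤ m ∧ j = 0
  · obtain ⟨hi, him, rfl⟩ := h1
    rw [poissonLieInclusion_apply_row _ hi him]
    have hfst : (if i = 1 then vf X else 0 : Λ) = if i = n + 1 then vf X else 0 := by
      by_cases hn : n = 0
      · rw [hn]
      · rw [hX hn, map_zero, ite_self, ite_self]
    simp only [hfst]
    by_cases h : i = n + 1
    · rw [if_pos h, if_pos ⟨h, him, trivial⟩, total_eq_self, neg_neg]
      exact neg_mem (contractR_mem_homForms hx (total_mem_homForms ω) (by omega))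
    · rw [if_neg h, if_neg fun h' => h h'.1, Pi.neg_apply,
        contractR_apply_eq_zero hx (total_mem_homForms ω) (by omega), neg_zero, total_zero, neg_zero]
      rfl
  · rw [poissonLieInclusion_apply_eq_zero _ h1, if_neg fun h => h1 ⟨?_, ?_, h.2.2⟩]
    · exact le_of_le_of_eq (Nat.le_add_left 1 n) h.1.symm
    · exact le_trans (Nat.le_add_right _ _) h.2.1

/-! ### Comparison of signs with the Poisson Lie `m`-algebra -/

theorem prod_reverse_ofFn_vf {n : ℕ} (v : Fin n → L) :
    (List.ofFn fun a => (vf (v a) : Λ)).reverse.prod =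
      (-1 : ℝ) ^ (n * (n - 1) / 2) • (List.ofFn fun a => (vf (v a) : Λ)).prod := by
  induction n with
  | zero => simp
  | succ n ih =>
    have h : (List.ofFn fun a : Fin n => (vf (v a.succ) : Λ)).prod ∈ prodSpan A L n := by
      have := ofFn_prod_mem (k := fun _ => 1) fun a : Fin n => vf_mem_prodSpan (A := A) (v a.succ)
      simpa using this
    rw [List.ofFn_succ, List.reverse_cons, List.prod_append, List.prod_singleton, ih,
      smul_mul_assoc, mul_vf_of_mem h, smul_smul, ← pow_add, Nat.triangle_succ, List.prod_cons]

theorem pairBracket_vf (n : ℕ) (v : Fin (n + 2) → L) :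
    pairBracket ω (n + 2) (fun a => vf (v a)) =
      (vf (if n = 0 then ⁅v 0, v 1⁆ else 0),
        contractR (List.ofFn fun a => (vf (v a) : Λ)).prod ω.total) := by
  cases n with
  | zero =>
    rw [pairBracket_two, schouten_vf_vf]
    rfl
  | succ n =>
    rw [pairBracket_add_three, if_neg (Nat.succ_ne_zero n), map_zero]

theorem negOnePow_mul_sub_two (n : ℕ) :
    Int.negOnePow ((n : ℤ) * (n - 2)) = Int.negOnePow n := by
  rw [Int.negOnePow_eq_iff]
  have : (n : ℤ) * (n - 2) - n = (n - 2) * ((n - 2) + 1) + -2 * 1 := by ring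
  rw [this]
  exact (Int.even_mul_succ_self _).add (by decide)

/-- For arity `N ≥ 3` the exponent `N(N+1)/2` of the bracket and the exponent `N(N-1)/2` of the
reversal differ by `N`. Multiplying by `(-1)^N` thus gives one formula for all arities, in
accordance with `ι_{v_2} ι_{v_1} = -ι_{v_1 v_2}` in the binary case. -/
theorem negOnePow_smul_poissonLieBracket (n : ℕ) (z : Fin (n + 2) → L × Forms A L) :
    Int.negOnePow (n + 2 : ℕ) • poissonLieBracket ω (n + 2) z =
      (if n = 0 then ⁅(z 0).1, (z 1).1⁆ else 0,
        - contractR (List.ofFn fun a => (vf (z a).1 : Λ)).prod ω.total) := by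
  cases n with
  | zero =>
    have h : Int.negOnePow ((0 + 2 : ℕ) : ℤ) = 1 := rfl
    have h1 : (List.ofFn fun a : Fin 2 => (vf (z a).1 : Λ)).prod = vf (z 0).1 * vf (z 1).1 := by
      simp [List.ofFn_succ]
    have h2 : (vf (z 0).1 * vf (z 1).1 : Λ) = - (vf (z 1).1 * vf (z 0).1) := by
      rw [mul_vf_of_mem (vf_mem_prodSpan _)]
      simp
    rw [h, one_smul, h1, h2, map_neg, LinearMap.neg_apply, neg_neg, contractR_vf_mul, contractR_vf]
    rfl
  | succ n =>
    have h : poissonLieBracket ω (n + 3) z = (0, (-(-1 : ℝ) ^ ((n + 3) * (n + 4) / 2)) •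
      contractR (List.ofFn fun a => (vf (z a).1 : Λ)).reverse.prod ω.total) := rfl
    have h2 : (n + 3) * (n + 4) / 2 = (n + 3) * (n + 3 - 1) / 2 + (n + 3) := by
      rw [← Nat.triangle_succ, mul_comm]
      rfl
    rw [h, negOnePow_smul, prod_reverse_ofFn_vf fun a => (z a).1, map_smul, LinearMap.smul_apply,
      smul_smul, h2, if_neg (Nat.succ_ne_zero n)]
    refine Prod.ext (smul_zero _) ?_
    rw [Prod.smul_snd, smul_smul]
    rcases neg_one_pow_eq_or ℝ (n + 3) with h | h <;>
    rcases neg_one_pow_eq_or ℝ ((n + 3) * (n + 3 - 1) / 2) with h' | h' <;>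
      simp only [pow_add _ _ (n + 3), h, h'] <;> module

theorem pairsBracket_poissonLieInclusion (n : ℕ) (z : Fin (n + 2) → L × Forms A L) :
    pairsBracket ω (n + 2) (fun a => poissonLieInclusion A L m (z a)) =
      Int.negOnePow (n + 2 : ℕ) • poissonLieInclusion A L m (poissonLieBracket ω (n + 2) z) := by
  have hx : (List.ofFn fun a => (vf (z a).1 : Λ)).prod ∈ prodSpan A L (n + 2) := by
    have := ofFn_prod_mem (k := fun _ => 1) fun a => vf_mem_prodSpan (A := A) (z a).1
    simpa using this
  funext p
  rw [← map_units_smul, negOnePow_smul_poissonLieBracket,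
    poissonLieInclusion_contractR ω hx fun hn => if_neg hn,
    pairsBracket_apply_of_columnOne ω n _ fun _ => 0]
  · rw [Finset.sum_const_zero]
    refine ite_congr rfl (fun h => ?_) fun _ => rfl
    simp only [columnOne_poissonLieInclusion]
    rw [← pairBracket_vf ω n fun a => (z a).1]
    congr 1
    funext a
    exact if_pos ⟨by omega, trivial⟩
  · intro a j hj
    rw [columnOne_poissonLieInclusion, if_neg fun h => hj h.2]

/-- The inclusion intertwines the brackets, up to the signs of the décalage. -/
theorem poissonLieInclusion_intertwines {n : ℕ} (hn : 1 ≤ n) (e : Fin n → ℤ)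
    (z : Fin n → L × Forms A L) (hz : ∀ a, z a ∈ poissonLie ω (e a)) :
    pairsBracket ω n (fun a => poissonLieInclusion A L m (z a)) =
      Int.negOnePow (n * (n - 2) + ∑ a : Fin n, ((n : ℤ) - (a + 1)) * e a) •
        poissonLieInclusion A L m (poissonLieBracket ω n z) := by
  match n with
  | 1 =>
    have h : Int.negOnePow (((1 : ℕ) : ℤ) * ((1 : ℕ) - 2) +
        ∑ a : Fin 1, (((1 : ℕ) : ℤ) - (a + 1)) * e a) = -1 := by
      simp
    rw [h, pairsBracket_one, unaryBracket_poissonLieInclusion ω, Units.neg_smul, one_smul]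
  | n + 2 =>
    -- An argument of nonzero degree has no vector field part, and then both brackets vanish
    -- whatever the sign. Otherwise the décalage sign is `(-1)^(N(N-2)) = (-1)^N` for the arity `N =
    -- n + 2`.
    by_cases he : ∃ a, e a ≠ 0
    · obtain ⟨a, ha⟩ := he
      have hv := fst_eq_zero_of_mem_poissonLie ω ha (hz a)
      have h0 : pairsBracket ω (n + 2) (fun a => poissonLieInclusion A L m (z a)) = 0 := by
        refine pairsBracket_eq_zero ω n _ a fun j => ?_
        rw [columnOne_poissonLieInclusion, hv, map_zero, ite_self]
      have h1 := pairsBracket_poissonLieInclusion ω n z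
      rw [h0, eq_comm, smul_eq_zero_iff_eq] at h1
      rw [h0, h1, smul_zero]
    · push Not at he
      have h : Int.negOnePow (((n + 2 : ℕ) : ℤ) * ((n + 2 : ℕ) - 2) +
          ∑ a : Fin (n + 2), (((n + 2 : ℕ) : ℤ) - (a + 1)) * e a) = Int.negOnePow (n + 2 : ℕ) := by
        simp only [he, mul_zero, Finset.sum_const_zero, add_zero, negOnePow_mul_sub_two]
      rw [h, pairsBracket_poissonLieInclusion]

end Poisson

end PreSymplectic
end

/-- The bigraded space `Ξ̃(M)` of Hamiltonian pairs and form columns of a pre-`m`-symplectic manifold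
`(M, ω)` is an `L∞`-algebra, with brackets of bidegree `(-1, 0)`. Its base row is an
`L∞`-subalgebra, and the inclusion of the Poisson Lie `m`-algebra identifies it, after the
décalage, with this base row. -/
theorem corollary3p3 {E : Type*} [NormedAddCommGroup E] [NormedSpace ℝ E] [FiniteDimensional ℝ E]
    {M : Type*} [TopologicalSpace M] [ChartedSpace E M]
    [IsManifold (modelWithCornersSelf ℝ E) (⊤ : ℕ∞) M] [T2Space M] [SecondCountableTopology M]
    (m : ℕ)
    (ω : PreSymplectic.Form (PreSymplectic.SmoothFun E M) (PreSymplectic.VectorFields E M) (m + 1))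
    (hω : PreSymplectic.dForm (m + 1) ω = 0) :
    PreSymplectic.IsLInfinityAlgebra (PreSymplectic.pairs ω) (PreSymplectic.pairsBracket ω) ∧
    (∀ n ≥ 1, ∀ (p q : Fin n → ℤ)
      (v : Fin n → PreSymplectic.Ambient (PreSymplectic.SmoothFun E M)
        (PreSymplectic.VectorFields E M)),
      (∀ a, v a ∈ PreSymplectic.bihomogeneous ω (p a) (q a)) →
        PreSymplectic.pairsBracket ω n v ∈
          PreSymplectic.bihomogeneous ω (∑ a, p a - 1) (∑ a, q a)) ∧
    PreSymplectic.IsLInfinitySubalgebra (PreSymplectic.baseRow ω) (PreSymplectic.pairs ω)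
      (PreSymplectic.pairsBracket ω) ∧
    (∀ k : ℤ, Set.BijOn
      (PreSymplectic.poissonLieInclusion (PreSymplectic.SmoothFun E M)
        (PreSymplectic.VectorFields E M) m)
      (PreSymplectic.poissonLie ω k) (PreSymplectic.baseRow ω (k + 1))) ∧
    (∀ n ≥ 1, ∀ (e : Fin n → ℤ)
      (z : Fin n → PreSymplectic.VectorFields E M × PreSymplectic.Forms
        (PreSymplectic.SmoothFun E M) (PreSymplectic.VectorFields E M)),
      (∀ a, z a ∈ PreSymplectic.poissonLie ω (e a)) →
        PreSymplectic.pairsBracket ω n (fun a => PreSymplectic.poissonLieInclusion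
            (PreSymplectic.SmoothFun E M) (PreSymplectic.VectorFields E M) m (z a)) =
          Int.negOnePow (n * (n - 2) + ∑ a : Fin n, ((n : ℤ) - (a + 1)) * e a) •
            PreSymplectic.poissonLieInclusion (PreSymplectic.SmoothFun E M)
              (PreSymplectic.VectorFields E M) m (PreSymplectic.poissonLieBracket ω n z)) :=
  ⟨PreSymplectic.isLInfinityAlgebra_pairs ω hω,
    fun _ hn p q v hv => PreSymplectic.pairsBracket_mem_bihomogeneous ω hω hn p q v hv,
    PreSymplectic.isLInfinitySubalgebra_baseRow ω hω,
    PreSymplectic.bijOn_poissonLieInclusion ω,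
    fun _ hn e z hz => PreSymplectic.poissonLieInclusion_intertwines ω hn e z hz⟩
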